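/- Let $\mathbb D$ be the open unit disc. Let $\omega$ be a nonzero finite positive Borel measure on $[0,1)$ in the class $\mathcal R$: writing $\widehat\omega(r)=\omega([r,1))$, there are constants $C_0>0$ and $0<\gamma_0\le\beta_0$ with $$C_0^{-1}\left(\frac{1-r}{1-t}\right)^{\gamma_0}\widehat\omega(t)\le\widehat\omega(r)\le C_0\left(\frac{1-r}{1-t}\right)^{\beta_0}\widehat\omega(t),\qquad 0\le r\le t<1.$$ Let $d\mu(re^{i\theta})=\frac1\pi\, r\,d\omega(r)\,d\theta$ on $\mathbb D$, let $A^2_\omega$ be the space of analytic functions in $L^2(\mathbb D,\mu)$, and let $B^\omega_z$ be its reproducing kernel at $z\in\mathbb D$. Assume that for some $\gamma\ge1$ and some finite positive measure $\nu$ on $[0,1]$ $$B^\omega_z(\zeta)=\frac1{(1-\overline z\zeta)^\gamma}\int_0^1\frac{d\nu(r)}{1-r\overline z\zeta},\qquad z,\zeta\in\mathbb D.$$ Put $P_\omega f(z)=\int_{\mathbb D}f(\zeta)\overline{B^\omega_z(\zeta)}\,d\mu(\zeta)$ and $P^+_\omega f(z)=\int_{\mathbb D}f(\zeta)|B^\omega_z(\zeta)|\,d\mu(\zeta)$.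 Let $1<p<\infty$ and $p'=p/(p-1)$. For an $\omega$-weight $v$, i.e. a positive $\mu$-integrable function on $\mathbb D$, let $L^p_\omega(v)=L^p(v\,d\mu)$, let $L^{p,\infty}_\omega(v)$ be the corresponding weak space, and put $$B_{p,\omega}(v)=\sup_S\frac{\int_S v\,d\mu}{\mu(S)}\left(\frac{\int_S v^{-p'/p}\,d\mu}{\mu(S)}\right)^{p/p'},$$ the supremum being over all Carleson squares $S=\{re^{i\theta}:1-|I|\le r<1,\ e^{i\theta}\in I\}$, where $I$ is an arc of the unit circle and $|I|\in(0,1]$ its normalized length. An operator is called bounded on $L^p_\omega(v)$ if its defining integral converges absolutely for all $f\in L^p_\omega(v)$ and $z\in\mathbb D$ and the norm inequality holds. Then for every $\omega$-weight $v$ the following statements are equivalent: (i) $P^+_\omega:L^p_\omega(v)\to L^p_\omega(v)$ is bounded; (ii) $P_\omega:L^p_\omega(v)\to L^p_\omega(v)$ is bounded; (iii) $P_\omega:L^p_\omega(v)\to L^{p,\infty}_\omega(v)$ is bounded; (iv) $B_{p,\omega}(v)<\infty$. Moreover, there is a constant $C=C(p,\omega)$, independent of $v$, such that whenever $B_{p,\omega}(v)<\infty$,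 $$\|P^+_\omega\|_{L^p_\omega(v)\to L^p_\omega(v)}\le C\,B_{p,\omega}(v)^{\max\{1,\frac1{p-1}\}}.$$ -/

import Mathlib

open MeasureTheory Set Metric
open scoped ENNReal NNReal ComplexConjugate

noncomputable section

namespace BergmanProjection

/-- The measure `ω ⊗ m`, that is `r dω(r) dθ / π` in polar coordinates `z = r e^{iθ}`.
If `ω` is Lebesgue measure on `[0,1)` it is normalized area measure `dx dy / π` on the unit disc.
If `ω` lives on `[0,1)`, this measure lives on the open unit disc. -/
def diskMeasure (ω : Measure ℝ) : Measure ℂ :=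
  Measure.map (fun q : ℝ × ℝ => (q.1 : ℂ) * Complex.exp ((q.2 : ℂ) * Complex.I))
    ((ω.withDensity fun r => ENNReal.ofReal r).prod
      (ENNReal.ofReal (Real.pi)⁻¹ • volume.restrict (Ico 0 (2 * Real.pi))))

/-- The tail `ω̂(r) = ω([r,1))`. -/
def tail (ω : Measure ℝ) (r : ℝ) : ℝ := ω.real (Ico r 1)

/-- The class `𝓡`: nonzero finite Borel measures on `[0,1)` with two-sided power control of the
tail. -/
structure IsRegular (ω : Measure ℝ) : Prop where
  finite : IsFiniteMeasure ω
  ne_zero : ω ≠ 0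
  support : ω (Ico 0 1)ᶜ = 0
  control : ∃ C γ β : ℝ, 0 < C ∧ 0 < γ ∧ γ ≤ β ∧ ∀ r t : ℝ, 0 ≤ r → r ≤ t → t < 1 →
    C⁻¹ * ((1 - r) / (1 - t)) ^ γ * tail ω t ≤ tail ω r ∧
    tail ω r ≤ C * ((1 - r) / (1 - t)) ^ β * tail ω t

/-- Membership in the weighted Bergman space `A²_ω`; the values off the disc are irrelevant. -/
def MemBergman (ω : Measure ℝ) (f : ℂ → ℂ) : Prop :=
  DifferentiableOn ℂ f (ball 0 1) ∧ MemLp f 2 (diskMeasure ω)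

/-- `g` is the reproducing kernel of `A²_ω` at the point `z` of the disc. -/
def IsReproducingKernelAt (ω : Measure ℝ) (z : ℂ) (g : ℂ → ℂ) : Prop :=
  MemBergman ω g ∧
    ∀ f : ℂ → ℂ, MemBergman ω f → f z = ∫ ζ, f ζ * conj (g ζ) ∂(diskMeasure ω)

open Classical in
/-- The Bergman reproducing kernel `B^ω_z(ζ)` (unique on the disc where it exists, which is the
case for `ω` in `𝓡`). -/
def bergmanKernel (ω : Measure ℝ) (z : ℂ) : ℂ → ℂ :=
  if h : ∃ g : ℂ → ℂ, IsReproducingKernelAt ω z g then h.choose else 0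

/-- The kernel of `ω` has the integral representation
`B^ω_z(ζ) = (1 - z̄ζ)^{-γ} ∫ dν(r) / (1 - r z̄ζ)` on the disc, with `ν` a (finite) positive measure
on `[0,1]`. The power is the principal one; `1 - z̄ζ` has positive real part. -/
def HasKernelRepresentation (ω : Measure ℝ) (γ : ℝ) (ν : Measure ℝ) : Prop :=
  IsFiniteMeasure ν ∧ ν (Icc 0 1)ᶜ = 0 ∧
    ∀ z ∈ ball (0 : ℂ) 1, ∀ ζ ∈ ball (0 : ℂ) 1,
      bergmanKernel ω z ζ =
        1 / (1 - conj z * ζ) ^ (γ : ℂ) * ∫ r : ℝ, 1 / (1 - (r : ℂ) * conj z * ζ) ∂ν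

/-- The integral operator `f ↦ ∫ f(ζ) k(z,ζ) d(ω ⊗ m)(ζ)`. -/
def integralOp (ω : Measure ℝ) (k : ℂ → ℂ → ℂ) (f : ℂ → ℂ) (z : ℂ) : ℂ :=
  ∫ ζ, f ζ * k z ζ ∂(diskMeasure ω)

/-- Kernel of the Bergman projection `P_ω`. -/
def projKernel (ω : Measure ℝ) (z ζ : ℂ) : ℂ := conj (bergmanKernel ω z ζ)

/-- Kernel of the maximal Bergman projection `P⁺_ω`. -/
def maxProjKernel (ω : Measure ℝ) (z ζ : ℂ) : ℂ := ((‖bergmanKernel ω z ζ‖ : ℝ) : ℂ)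

/-- An `ω`-weight: positive and integrable with respect to `ω ⊗ m`. -/
def IsOmegaWeight (ω : Measure ℝ) (v : ℂ → ℝ) : Prop :=
  (∀ᵐ z ∂(diskMeasure ω), 0 < v z) ∧ Integrable v (diskMeasure ω)

/-- The measure `v d(ω ⊗ m)`; `L^p_ω(v)` is the `L^p` space of this measure. -/
def weightedMeasure (ω : Measure ℝ) (v : ℂ → ℝ) : Measure ℂ :=
  (diskMeasure ω).withDensity fun z => ENNReal.ofReal (v z)

/-- The operator with kernel `k` is defined, by absolutely convergent integrals, on all of
`L^p_ω(v)`, and maps it to `L^p_ω(v)` with bound `C`. -/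
def HasStrongBound (ω : Measure ℝ) (p : ℝ) (v : ℂ → ℝ) (k : ℂ → ℂ → ℂ) (C : ℝ≥0) : Prop :=
  ∀ f : ℂ → ℂ, MemLp f (ENNReal.ofReal p) (weightedMeasure ω v) →
    (∀ z ∈ ball (0 : ℂ) 1, Integrable (fun ζ => f ζ * k z ζ) (diskMeasure ω)) ∧
    MemLp (integralOp ω k f) (ENNReal.ofReal p) (weightedMeasure ω v) ∧
    eLpNorm (integralOp ω k f) (ENNReal.ofReal p) (weightedMeasure ω v)
      ≤ C * eLpNorm f (ENNReal.ofReal p) (weightedMeasure ω v)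

/-- The operator with kernel `k` is bounded on `L^p_ω(v)`. -/
def StrongBounded (ω : Measure ℝ) (p : ℝ) (v : ℂ → ℝ) (k : ℂ → ℂ → ℂ) : Prop :=
  ∃ C : ℝ≥0, HasStrongBound ω p v k C

/-- The operator norm on `L^p_ω(v)` (infinite when the operator is not bounded). -/
def strongNorm (ω : Measure ℝ) (p : ℝ) (v : ℂ → ℝ) (k : ℂ → ℂ → ℂ) : ℝ≥0∞ :=
  ⨅ (C : ℝ≥0) (_ : HasStrongBound ω p v k C), (C : ℝ≥0∞)

/-- The quasi-norm of the weak Lebesgue space `L^{p,∞}(μ)`. -/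
def weakLpNorm (p : ℝ) (μ : Measure ℂ) (g : ℂ → ℂ) : ℝ≥0∞ :=
  ⨆ t : ℝ≥0, (t : ℝ≥0∞) * μ {z | (t : ℝ) < ‖g z‖} ^ (1 / p)

/-- The operator with kernel `k` is defined, by absolutely convergent integrals, on all of
`L^p_ω(v)`, and is bounded from it to `L^{p,∞}_ω(v)`. -/
def WeakBounded (ω : Measure ℝ) (p : ℝ) (v : ℂ → ℝ) (k : ℂ → ℂ → ℂ) : Prop :=
  ∃ C : ℝ≥0, ∀ f : ℂ → ℂ, MemLp f (ENNReal.ofReal p) (weightedMeasure ω v) →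
    (∀ z ∈ ball (0 : ℂ) 1, Integrable (fun ζ => f ζ * k z ζ) (diskMeasure ω)) ∧
    AEStronglyMeasurable (integralOp ω k f) (weightedMeasure ω v) ∧
    weakLpNorm p (weightedMeasure ω v) (integralOp ω k f)
      ≤ C * eLpNorm f (ENNReal.ofReal p) (weightedMeasure ω v)

/-- The Carleson square over the arc `{e^{iθ} : a ≤ θ < a + 2πh}` of normalized length `h`. -/
def carlesonSquare (a h : ℝ) : Set ℂ :=
  {z | ∃ r θ : ℝ, 1 - h ≤ r ∧ r < 1 ∧ a ≤ θ ∧ θ < a + 2 * Real.pi * h ∧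
    z = (r : ℂ) * Complex.exp ((θ : ℂ) * Complex.I)}

/-- The Bekollé–Bonami characteristic `B_{p,ω}(v)`, a supremum over all Carleson squares; here
`p' = p/(p-1)`. -/
def bekolleBonami (ω : Measure ℝ) (p : ℝ) (v : ℂ → ℝ) : ℝ≥0∞ :=
  ⨆ (a : ℝ) (h : ℝ) (_ : 0 < h) (_ : h ≤ 1),
    ((∫⁻ z in carlesonSquare a h, ENNReal.ofReal (v z) ∂(diskMeasure ω)) /
        diskMeasure ω (carlesonSquare a h)) *
      ((∫⁻ z in carlesonSquare a h,
            ENNReal.ofReal (v z ^ (-(Real.conjExponent p / p))) ∂(diskMeasure ω)) /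
          diskMeasure ω (carlesonSquare a h)) ^ (p / Real.conjExponent p)

end BergmanProjection

end

/-! Write `w = z̄ζ`, and let `μ` be the measure on the disc. The proof needs only the size and the
relative smoothness of the kernel `k(w)` given by the integral representation.

Size. The quantity `|1 - rw|` is comparable with `(1 - r) + |1 - w|`, and the numbers `1 / (1 - rw)`
lie in one quadrant, so they do not cancel. Hence `|k(w)|` is comparable with its value `diagKernel`
at the real point `1 - h` when `h` is comparable with `|1 - w|`. Nothing has to be known about `ν`:
the reproducing property forces `diagKernel` at `h` to be about `1 / μ(S)` for a Carleson square `S`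
of size `h`. The upper bound is `exists_diagKernel_mul_squareMass_le`; the lower bound, for `h ≤
1/2`, is `exists_le_diagKernel_mul_squareMass`.

Sufficiency of the Bekollé–Bonami condition. Any `z` and `ζ` share a square of size at most `4|1 -
z̄ζ|` from one of two dyadic systems, so `|B_z(ζ)|` is at most a constant times the sum of two
positive dyadic kernels (`exists_enorm_reprKernel_le`). By duality it remains to bound a bilinear
form that is a sum over the dyadic squares `Q`. The tops of the squares have bounded overlap and
carry at least half of the mass of their squares. For `p ≥ 2`, `weight_product_le` uses this to
replace the weighted masses of `Q` by those of its top, at the cost of one factor `B`. What is left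
is estimated by Hölder and the embedding `IsLaminar.tsum_average_rpow_mul_le`, whose constant is
independent of the weight. For `p ≤ 2` the form is read with the two weights exchanged, and the dual
characteristic `B^(1/(p-1))` appears.

Necessity. If two squares `S` and `T` of the same size lie far apart relative to that size, then
`k(z̄ζ)` is nearly constant on `T × S` (`norm_reprKernel_sub_le`). The projection of a nonnegative
function on `S` is therefore bounded below on `T` by a multiple of its average. Testing the weak
inequality on the constant `1` and on the dual weight, and multiplying the results, bounds the
characteristic over small squares. Large squares need only that the dual weight has finite total
mass, which follows from local testing and compactness of the closed disc.

The remaining implications are `|P f| ≤ P⁺|f|` and Chebyshev's inequality. -/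

namespace BergmanProjection

/-! ### The explicit kernel -/

section Kernel

/-- The function `w ↦ (1 - w)^{-γ} ∫ dν(r) / (1 - r w)`. -/
noncomputable def reprKernel (γ : ℝ) (ν : Measure ℝ) (w : ℂ) : ℂ :=
  1 / (1 - w) ^ (γ : ℂ) * ∫ r : ℝ, 1 / (1 - (r : ℂ) * w) ∂ν

/-- The value of `reprKernel` at the real point `1 - h`, as a real number. -/
noncomputable def diagKernel (γ : ℝ) (ν : Measure ℝ) (h : ℝ) : ℝ :=
  h ^ (-γ) * ∫ r : ℝ, 1 / (1 - r * (1 - h)) ∂ν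

variable {γ : ℝ} {ν : Measure ℝ} {w w₀ : ℂ} {r h A : ℝ}

lemma one_sub_le_norm_one_sub_mul (hr : r ∈ Icc (0 : ℝ) 1) (hw : ‖w‖ < 1) :
    1 - r ≤ ‖1 - (r : ℂ) * w‖ := by
  have h1 : ‖(r : ℂ) * w‖ ≤ r := by
    rw [norm_mul, Complex.norm_real, Real.norm_of_nonneg hr.1]
    nlinarith [hr.1]
  have h2 := norm_sub_norm_le (1 : ℂ) ((r : ℂ) * w)
  rw [norm_one] at h2
  linarith

lemma one_sub_norm_le_norm_one_sub_mul (hr : r ∈ Icc (0 : ℝ) 1) :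
    1 - ‖w‖ ≤ ‖1 - (r : ℂ) * w‖ := by
  have h1 : ‖(r : ℂ) * w‖ ≤ ‖w‖ := by
    rw [norm_mul, Complex.norm_real, Real.norm_of_nonneg hr.1]
    nlinarith [hr.1, hr.2, norm_nonneg w]
  have h2 := norm_sub_norm_le (1 : ℂ) ((r : ℂ) * w)
  rw [norm_one] at h2
  linarith

lemma norm_one_sub_mul_pos (hr : r ∈ Icc (0 : ℝ) 1) (hw : ‖w‖ < 1) :
    0 < ‖1 - (r : ℂ) * w‖ := by
  have := one_sub_norm_le_norm_one_sub_mul (w := w) hr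
  linarith

lemma norm_one_sub_pos (hw : ‖w‖ < 1) : 0 < ‖1 - w‖ := by
  simpa using norm_one_sub_mul_pos (r := 1) (w := w) (by simp) hw

lemma one_sub_re_pos (hw : ‖w‖ < 1) : 0 < (1 - w).re := by
  have := Complex.re_le_norm w
  simp only [Complex.sub_re, Complex.one_re]
  linarith

/-- With `one_sub_le_norm_one_sub_mul` and `norm_one_sub_mul_le` this makes `|1 - rw|` comparable
with `(1 - r) + |1 - w|`. This is why the size of the kernel depends on `|1 - w|` alone. -/
lemma norm_one_sub_le_two_mul (hr : r ∈ Icc (0 : ℝ) 1) (hw : ‖w‖ < 1) :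
    ‖1 - w‖ ≤ 2 * ‖1 - (r : ℂ) * w‖ := by
  have h0 := one_sub_le_norm_one_sub_mul hr hw
  have h1 : 1 - w = (1 - (r : ℂ) * w) - ((1 - r : ℝ) : ℂ) * w := by push_cast; ring
  have h2 : ‖((1 - r : ℝ) : ℂ) * w‖ ≤ 1 - r := by
    rw [norm_mul, Complex.norm_real, Real.norm_of_nonneg (by linarith [hr.2])]
    nlinarith [hr.2]
  rw [h1]
  linarith [norm_sub_le (1 - (r : ℂ) * w) (((1 - r : ℝ) : ℂ) * w)]

lemma norm_one_sub_mul_le (hr : r ∈ Icc (0 : ℝ) 1) :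
    ‖1 - (r : ℂ) * w‖ ≤ (1 - r) + r * ‖1 - w‖ := by
  have h1 : 1 - (r : ℂ) * w = ((1 - r : ℝ) : ℂ) + (r : ℂ) * (1 - w) := by push_cast; ring
  rw [h1]
  refine (norm_add_le _ _).trans ?_
  rw [norm_mul, Complex.norm_real, Complex.norm_real, Real.norm_of_nonneg hr.1,
    Real.norm_of_nonneg (by linarith [hr.2])]

lemma ae_mem_Icc (hν : ν (Icc 0 1)ᶜ = 0) : ∀ᵐ r ∂ν, r ∈ Icc (0 : ℝ) 1 :=
  measure_eq_zero_iff_ae_notMem.1 hν |>.mono fun _ h => by simpa using h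

lemma one_sub_mul_pos (hr : r ∈ Icc (0 : ℝ) 1) (h1 : h ≤ 1) :
    h ≤ 1 - r * (1 - h) := by
  nlinarith [hr.1, hr.2]

lemma norm_reprKernel :
    ‖reprKernel γ ν w‖ = ‖1 - w‖ ^ (-γ) * ‖∫ r : ℝ, 1 / (1 - (r : ℂ) * w) ∂ν‖ := by
  rw [reprKernel, norm_mul, norm_div, norm_one, Complex.norm_cpow_real,
    Real.rpow_neg (norm_nonneg _), one_div]

lemma reprKernel_ofReal (h0 : 0 < h) :
    reprKernel γ ν ((1 - h : ℝ) : ℂ) = (diagKernel γ ν h : ℂ) := by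
  have : (1 : ℂ) - ((1 - h : ℝ) : ℂ) = (h : ℂ) := by push_cast; ring
  rw [reprKernel, diagKernel, this, ← Complex.ofReal_cpow h0.le, Real.rpow_neg h0.le,
    Complex.ofReal_mul, ← integral_complex_ofReal]
  push_cast
  rw [one_div]

variable [IsFiniteMeasure ν]

lemma integrable_one_div_one_sub_mul (hν : ν (Icc 0 1)ᶜ = 0) (hw : ‖w‖ < 1) :
    Integrable (fun r : ℝ => 1 / (1 - (r : ℂ) * w)) ν := by
  refine Integrable.of_bound (C := 1 / (1 - ‖w‖))
    (Measurable.aestronglyMeasurable (by fun_prop)) ?_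
  filter_upwards [ae_mem_Icc hν] with r hr
  rw [norm_div, norm_one]
  exact one_div_le_one_div_of_le (by linarith) (one_sub_norm_le_norm_one_sub_mul hr)

lemma integrable_one_div_one_sub_mul_real (hν : ν (Icc 0 1)ᶜ = 0) (h0 : 0 < h) (h1 : h ≤ 1) :
    Integrable (fun r : ℝ => 1 / (1 - r * (1 - h))) ν := by
  refine Integrable.of_bound (C := 1 / h)
    (Measurable.aestronglyMeasurable (by fun_prop)) ?_
  filter_upwards [ae_mem_Icc hν] with r hr
  have := one_sub_mul_pos hr h1
  rw [norm_div, norm_one, Real.norm_of_nonneg (by linarith)]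
  exact one_div_le_one_div_of_le h0 this

/-- The values of `1 / (1 - r w)` lie in one quadrant, so their integral does not cancel. -/
lemma integral_norm_le_two_mul_norm_integral (hν : ν (Icc 0 1)ᶜ = 0) (hw : ‖w‖ < 1) :
    ∫ r : ℝ, 1 / ‖1 - (r : ℂ) * w‖ ∂ν ≤ 2 * ‖∫ r : ℝ, 1 / (1 - (r : ℂ) * w) ∂ν‖ := by
  set f : ℝ → ℂ := fun r => 1 / (1 - (r : ℂ) * w) with hf
  have hi : Integrable f ν := integrable_one_div_one_sub_mul hν hw
  have hre : (∫ r, f r ∂ν).re = ∫ r, (f r).re ∂ν := (integral_re hi).symm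
  have him : (∫ r, f r ∂ν).im = ∫ r, (f r).im ∂ν := (integral_im hi).symm
  have himf : ∀ r, (f r).im = r * w.im / Complex.normSq (1 - (r : ℂ) * w) := by
    intro r
    simp [hf, Complex.inv_im]
  -- The imaginary part of `1 / (1 - rw)` has the sign of `Im w` for every `r ≥ 0`, and its real
  -- part is positive, so neither part cancels under the integral.
  have hsgn : ∀ᵐ r ∂ν, |(f r).im| = SignType.sign w.im * (f r).im := by
    filter_upwards [ae_mem_Icc hν] with r hr
    have : (SignType.sign w.im : ℝ) * w.im = |w.im| := sign_mul_self w.im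
    rw [himf, abs_div, abs_mul, abs_of_nonneg hr.1, abs_of_nonneg (Complex.normSq_nonneg _),
      ← this]
    ring
  have hre0 : ∀ᵐ r ∂ν, |(f r).re| = (f r).re := by
    filter_upwards [ae_mem_Icc hν] with r hr
    refine abs_of_nonneg ?_
    have : 0 < (1 - (r : ℂ) * w).re := one_sub_re_pos (by
      rw [norm_mul, Complex.norm_real, Real.norm_of_nonneg hr.1]
      nlinarith [hr.1, hr.2, norm_nonneg w])
    simp only [hf, one_div, Complex.inv_re]
    exact div_nonneg this.le (Complex.normSq_nonneg _)
  have hire : Integrable (fun r => (f r).re) ν := hi.re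
  have hiim : Integrable (fun r => (f r).im) ν := hi.im
  calc ∫ r : ℝ, 1 / ‖1 - (r : ℂ) * w‖ ∂ν = ∫ r, ‖f r‖ ∂ν := by simp [hf]
    _ ≤ ∫ r, (|(f r).re| + |(f r).im|) ∂ν :=
        integral_mono hi.norm (hire.abs.add hiim.abs) fun r => Complex.norm_le_abs_re_add_abs_im _
    _ = ∫ r, |(f r).re| ∂ν + ∫ r, |(f r).im| ∂ν := integral_add hire.abs hiim.abs
    _ = (∫ r, f r ∂ν).re + SignType.sign w.im * (∫ r, f r ∂ν).im := by
        rw [integral_congr_ae hre0, integral_congr_ae hsgn, integral_const_mul, hre, him]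
    _ ≤ ‖∫ r, f r ∂ν‖ + ‖∫ r, f r ∂ν‖ := by
        refine add_le_add (Complex.re_le_norm _) ?_
        refine (le_abs_self _).trans ?_
        rw [abs_mul]
        have h1 : |(SignType.sign w.im : ℝ)| ≤ 1 := by
          rcases lt_trichotomy w.im 0 with h | h | h <;> simp [h]
        calc _ ≤ 1 * |(∫ r, f r ∂ν).im| := by gcongr
          _ ≤ _ := by rw [one_mul]; exact Complex.abs_im_le_norm _
    _ = 2 * ‖∫ r, f r ∂ν‖ := by ring

/-- Pointwise `|1 - rw| ≤ (1 - r) + rAh ≤ A (1 - r(1 - h))`, which compares the two integrands. The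
factor `2` is the price of moving the absolute value out of the integral, and `A ^ γ` comes from the
power. -/
lemma diagKernel_le_norm_reprKernel (hγ : 0 ≤ γ) (hν : ν (Icc 0 1)ᶜ = 0) (h0 : 0 < h)
    (h1 : h ≤ 1) (hA : 1 ≤ A) (hw : ‖w‖ < 1) (hwh : ‖1 - w‖ ≤ A * h) :
    diagKernel γ ν h ≤ 2 * A ^ (γ + 1) * ‖reprKernel γ ν w‖ := by
  have hA0 : 0 < A := by linarith
  have hw0 := norm_one_sub_pos hw
  have e1 : h ^ (-γ) ≤ A ^ γ * ‖1 - w‖ ^ (-γ) := by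
    rw [Real.rpow_neg h0.le, Real.rpow_neg hw0.le, ← div_eq_mul_inv,
      ← Real.div_rpow hA0.le hw0.le, ← Real.inv_rpow h0.le]
    refine Real.rpow_le_rpow (by positivity) ?_ hγ
    rw [le_div_iff₀ hw0, inv_mul_le_iff₀ h0]
    linarith
  have e2 : ∫ r : ℝ, 1 / (1 - r * (1 - h)) ∂ν ≤ A * ∫ r : ℝ, 1 / ‖1 - (r : ℂ) * w‖ ∂ν := by
    rw [← integral_const_mul]
    have hi : Integrable (fun r : ℝ => 1 / ‖1 - (r : ℂ) * w‖) ν := by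
      simpa using (integrable_one_div_one_sub_mul hν hw).norm
    refine integral_mono_ae (integrable_one_div_one_sub_mul_real hν h0 h1) (hi.const_mul A) ?_
    filter_upwards [ae_mem_Icc hν] with r hr
    have h2 := norm_one_sub_mul_le (w := w) hr
    have h3 := norm_one_sub_mul_pos hr hw
    have h4 := one_sub_mul_pos hr h1
    rw [mul_one_div, div_le_div_iff₀ (by linarith) h3]
    nlinarith [hr.1, hr.2, mul_le_mul_of_nonneg_left hwh hr.1,
      mul_nonneg (sub_nonneg.2 hA) (sub_nonneg.2 hr.2)]
  have e3 := integral_norm_le_two_mul_norm_integral hν hw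
  rw [norm_reprKernel, diagKernel, Real.rpow_add hA0, Real.rpow_one]
  have h5 : 0 ≤ ∫ r : ℝ, 1 / ‖1 - (r : ℂ) * w‖ ∂ν := integral_nonneg fun r => by positivity
  calc _ ≤ (A ^ γ * ‖1 - w‖ ^ (-γ)) * (A * (2 * ‖∫ r : ℝ, 1 / (1 - (r : ℂ) * w) ∂ν‖)) := by
        refine mul_le_mul e1 (e2.trans (by gcongr)) (integral_nonneg_of_ae ?_) (by positivity)
        filter_upwards [ae_mem_Icc hν] with r hr
        have := one_sub_mul_pos hr h1
        exact one_div_nonneg.2 (by linarith)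
    _ = _ := by ring

/-- Here the triangle inequality suffices: `1 - r(1 - h) = (1 - r) + rh ≤ |1 - rw| + A|1 - w|`, and
`|1 - w| ≤ 2|1 - rw|` gives the factor `2A + 1`. -/
lemma norm_reprKernel_le_diagKernel (hγ : 0 ≤ γ) (hν : ν (Icc 0 1)ᶜ = 0) (h0 : 0 < h)
    (h1 : h ≤ 1) (hA : 0 < A) (hw : ‖w‖ < 1) (hwh : h ≤ A * ‖1 - w‖) :
    ‖reprKernel γ ν w‖ ≤ A ^ γ * (2 * A + 1) * diagKernel γ ν h := by
  have hw0 := norm_one_sub_pos hw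
  have e1 : ‖1 - w‖ ^ (-γ) ≤ A ^ γ * h ^ (-γ) := by
    rw [Real.rpow_neg h0.le, Real.rpow_neg hw0.le, ← div_eq_mul_inv,
      ← Real.div_rpow hA.le h0.le, ← Real.inv_rpow hw0.le]
    refine Real.rpow_le_rpow (by positivity) ?_ hγ
    rw [le_div_iff₀ h0, inv_mul_le_iff₀ hw0]
    linarith
  have e2 : ‖∫ r : ℝ, 1 / (1 - (r : ℂ) * w) ∂ν‖
      ≤ (2 * A + 1) * ∫ r : ℝ, 1 / (1 - r * (1 - h)) ∂ν := by
    rw [← integral_const_mul]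
    refine norm_integral_le_of_norm_le
      ((integrable_one_div_one_sub_mul_real hν h0 h1).const_mul _) ?_
    filter_upwards [ae_mem_Icc hν] with r hr
    have h2 := norm_one_sub_le_two_mul hr hw
    have h3 := norm_one_sub_mul_pos hr hw
    have h4 := one_sub_mul_pos hr h1
    have h5 := one_sub_le_norm_one_sub_mul hr hw
    rw [norm_div, norm_one, mul_one_div, div_le_div_iff₀ h3 (by linarith)]
    nlinarith [hr.1, hr.2, mul_le_mul_of_nonneg_left hwh hr.1,
      mul_le_mul_of_nonneg_left h2 hA.le, mul_le_mul_of_nonneg_right hr.2 h0.le]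
  rw [norm_reprKernel, diagKernel]
  calc _ ≤ (A ^ γ * h ^ (-γ)) * ((2 * A + 1) * ∫ r : ℝ, 1 / (1 - r * (1 - h)) ∂ν) := by
        gcongr
    _ = _ := by ring

/-- Relative smoothness. A small relative change of `1 - w₀` multiplies the power by `exp y` with
`y` small and changes the integral `J₀` by a small multiple of itself. The choice `1 / (64γ)` makes
both relative errors at most `1/8`, and `1/8 + 1/8 + 1/64 ≤ 1/2`. -/
lemma norm_reprKernel_sub_le (hγ : 1 ≤ γ) (hν : ν (Icc 0 1)ᶜ = 0) (hw : ‖w‖ < 1)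
    (hw₀ : ‖w₀‖ < 1) (hd : ‖w - w₀‖ ≤ 1 / (64 * γ) * ‖1 - w₀‖) :
    ‖reprKernel γ ν w - reprKernel γ ν w₀‖ ≤ 1 / 2 * ‖reprKernel γ ν w₀‖ := by
  have hγ0 : 0 < γ := by linarith
  set ε := 1 / (64 * γ) with hε
  have hε1 : ε ≤ 1 / 64 := by
    rw [hε]; exact one_div_le_one_div_of_le (by norm_num) (by linarith)
  have hεγ : ε * γ = 1 / 64 := by rw [hε]; field_simp
  have hε0 : 0 < ε := by positivity
  have p := norm_one_sub_pos hw
  have p₀ := norm_one_sub_pos hw₀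
  have n₀ : 1 - w₀ ≠ 0 := norm_pos_iff.1 p₀
  have n : 1 - w ≠ 0 := norm_pos_iff.1 p
  set x : ℂ := (w₀ - w) / (1 - w₀) with hx
  have hxε : ‖x‖ ≤ ε := by
    rw [hx, norm_div, div_le_iff₀ p₀, norm_sub_rev]; exact hd
  have hux : 1 - w = (1 - w₀) * (1 + x) := by rw [hx]; field_simp; ring
  have n1 : 1 + x ≠ 0 := by rintro h; rw [hux, h, mul_zero] at n; exact n rfl
  have hre : 0 < (1 + x).re := by
    have := Complex.abs_re_le_norm x
    have := neg_abs_le x.re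
    simp only [Complex.add_re, Complex.one_re]; linarith
  -- Both factors have positive real part, so their arguments add up without crossing the branch
  -- cut.
  have hlog : Complex.log (1 - w) = Complex.log (1 - w₀) + Complex.log (1 + x) := by
    rw [hux]
    refine Complex.log_mul n₀ n1 ?_
    have a1 := abs_lt.1 (Complex.abs_arg_lt_pi_div_two_iff.2 (Or.inl (one_sub_re_pos hw₀)))
    have a2 := abs_lt.1 (Complex.abs_arg_lt_pi_div_two_iff.2 (Or.inl hre))
    constructor <;> linarith [a1.1, a1.2, a2.1, a2.2]
  have hlogx : ‖Complex.log (1 + x)‖ ≤ 3 / 2 * ‖x‖ :=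
    Complex.norm_log_one_add_half_le_self (by linarith)
  set y : ℂ := -(Complex.log (1 + x) * γ) with hy
  have hyn : ‖y‖ ≤ 3 / 128 := by
    rw [hy, norm_neg, norm_mul, Complex.norm_real, Real.norm_of_nonneg hγ0.le]
    nlinarith
  have hpow : 1 / (1 - w) ^ (γ : ℂ) = 1 / (1 - w₀) ^ (γ : ℂ) * Complex.exp y := by
    rw [Complex.cpow_def_of_ne_zero n, Complex.cpow_def_of_ne_zero n₀, one_div, one_div,
      ← Complex.exp_neg, ← Complex.exp_neg, ← Complex.exp_add, hlog, hy]
    ring_nf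
  have hey : ‖Complex.exp y - 1‖ ≤ 1 / 8 :=
    (Complex.norm_exp_sub_one_le (by linarith)).trans (by linarith)
  set J := ∫ r : ℝ, 1 / (1 - (r : ℂ) * w) ∂ν with hJ
  set J₀ := ∫ r : ℝ, 1 / (1 - (r : ℂ) * w₀) ∂ν with hJ₀
  have hhalf : ‖1 - w₀‖ ≤ 2 * ‖1 - w‖ := by
    have := norm_add_le (1 - w) (w - w₀)
    rw [sub_add_sub_cancel] at this
    nlinarith
  have hJd : ‖J - J₀‖ ≤ 1 / 8 * ‖J₀‖ := by
    have h1 : ‖J - J₀‖ ≤ (4 * ε) * ∫ r : ℝ, 1 / ‖1 - (r : ℂ) * w₀‖ ∂ν := by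
      rw [hJ, hJ₀, ← integral_sub (integrable_one_div_one_sub_mul hν hw)
        (integrable_one_div_one_sub_mul hν hw₀), ← integral_const_mul]
      have hi : Integrable (fun r : ℝ => 1 / ‖1 - (r : ℂ) * w₀‖) ν := by
        simpa using (integrable_one_div_one_sub_mul hν hw₀).norm
      refine norm_integral_le_of_norm_le (hi.const_mul _) ?_
      filter_upwards [ae_mem_Icc hν] with r hr
      have q := norm_one_sub_mul_pos hr hw
      have q₀ := norm_one_sub_mul_pos hr hw₀
      have e : 1 / (1 - (r : ℂ) * w) - 1 / (1 - (r : ℂ) * w₀)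
          = (r * (w - w₀)) / ((1 - (r : ℂ) * w) * (1 - (r : ℂ) * w₀)) := by
        have := norm_pos_iff.1 q
        have := norm_pos_iff.1 q₀
        field_simp
        ring
      rw [e, norm_div, norm_mul, norm_mul, Complex.norm_real, Real.norm_of_nonneg hr.1,
        mul_one_div, div_le_div_iff₀ (by positivity) q₀]
      have b1 : r * ‖w - w₀‖ ≤ ε * ‖1 - w₀‖ := by nlinarith [hr.1, hr.2, norm_nonneg (w - w₀)]
      have b2 : ‖1 - w₀‖ ≤ 4 * ‖1 - (r : ℂ) * w‖ := by
        linarith [norm_one_sub_le_two_mul hr hw]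
      have b3 : r * ‖w - w₀‖ ≤ 4 * ε * ‖1 - (r : ℂ) * w‖ := by nlinarith
      calc _ ≤ (4 * ε * ‖1 - (r : ℂ) * w‖) * ‖1 - (r : ℂ) * w₀‖ := by gcongr
        _ = _ := by ring
    have h2 := integral_norm_le_two_mul_norm_integral hν hw₀
    nlinarith [norm_nonneg J₀]
  have key : reprKernel γ ν w - reprKernel γ ν w₀ = 1 / (1 - w₀) ^ (γ : ℂ) *
      ((Complex.exp y - 1) * (J - J₀) + (Complex.exp y - 1) * J₀ + (J - J₀)) := by
    rw [reprKernel, reprKernel, hpow]; ring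
  rw [key, reprKernel, norm_mul, norm_mul, ← hJ₀]
  have : ‖(Complex.exp y - 1) * (J - J₀) + (Complex.exp y - 1) * J₀ + (J - J₀)‖
      ≤ 1 / 2 * ‖J₀‖ := by
    refine (norm_add₃_le).trans ?_
    rw [norm_mul, norm_mul]
    nlinarith [norm_nonneg J₀, norm_nonneg (J - J₀), norm_nonneg (Complex.exp y - 1)]
  calc _ ≤ ‖1 / (1 - w₀) ^ (γ : ℂ)‖ * (1 / 2 * ‖J₀‖) := by gcongr
    _ = _ := by ring

lemma stronglyMeasurable_reprKernel : StronglyMeasurable (reprKernel γ ν) := by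
  refine StronglyMeasurable.mul (Measurable.stronglyMeasurable (by fun_prop)) ?_
  have : StronglyMeasurable fun q : ℂ × ℝ => 1 / (1 - (q.2 : ℂ) * q.1) :=
    Measurable.stronglyMeasurable (by fun_prop)
  exact this.integral_prod_right'

/-- For fixed `z` the kernel is bounded in `ζ`; this crude bound serves only for the absolute
convergence of the defining integral. -/
lemma norm_reprKernel_le (hγ : 0 ≤ γ) (hν : ν (Icc 0 1)ᶜ = 0) {s : ℝ}
    (hws : ‖w‖ ≤ s) (hs : s < 1) :
    ‖reprKernel γ ν w‖ ≤ (1 - s) ^ (-γ) * (ν.real univ * (1 / (1 - s))) := by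
  rw [norm_reprKernel]
  have h1 : 1 - s ≤ ‖1 - w‖ := by
    have := one_sub_norm_le_norm_one_sub_mul (r := 1) (w := w) (by simp)
    simp only [Complex.ofReal_one, one_mul] at this
    linarith
  refine mul_le_mul (Real.rpow_le_rpow_of_nonpos (by linarith) h1 (by linarith)) ?_
    (norm_nonneg _) (by have : 0 < 1 - s := by linarith
                        positivity)
  rw [mul_comm]
  refine norm_integral_le_of_norm_le_const ?_
  filter_upwards [ae_mem_Icc hν] with r hr
  rw [norm_div, norm_one]
  exact one_div_le_one_div_of_le (by linarith)
    (le_trans (by linarith) (one_sub_norm_le_norm_one_sub_mul hr))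

end Kernel

/-! ### Polar coordinates and Carleson squares -/

section Disk

variable {ω : Measure ℝ} {a h s t : ℝ}

lemma measurable_polar :
    Measurable fun q : ℝ × ℝ => (q.1 : ℂ) * Complex.exp ((q.2 : ℂ) * Complex.I) := by
  fun_prop

lemma norm_polar {r : ℝ} (hr : 0 ≤ r) (θ : ℝ) :
    ‖(r : ℂ) * Complex.exp ((θ : ℂ) * Complex.I)‖ = r := by
  rw [norm_mul, Complex.norm_exp_ofReal_mul_I, mul_one, Complex.norm_real, Real.norm_of_nonneg hr]

lemma exists_arg_polar {r : ℝ} (hr : 0 < r) (θ : ℝ) :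
    ∃ k : ℤ, ((r : ℂ) * Complex.exp ((θ : ℂ) * Complex.I)).arg = θ + 2 * Real.pi * k := by
  refine ⟨-toIocDiv Real.two_pi_pos (-Real.pi) θ, ?_⟩
  rw [Complex.arg_real_mul _ hr, Complex.arg_exp_mul_I, ← self_sub_toIocDiv_zsmul, zsmul_eq_mul]
  push_cast
  ring

lemma eq_polar_arg (z : ℂ) (n : ℤ) :
    z = (‖z‖ : ℂ) * Complex.exp (((z.arg + 2 * Real.pi * n : ℝ) : ℂ) * Complex.I) := by
  have : ((z.arg + 2 * Real.pi * n : ℝ) : ℂ) * Complex.I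
      = z.arg * Complex.I + n * (2 * Real.pi * Complex.I) := by push_cast; ring
  rw [this, Complex.exp_add, Complex.exp_int_mul_two_pi_mul_I, mul_one,
    Complex.norm_mul_exp_arg_mul_I]

instance instSFiniteDiskMeasure [SFinite ω] : SFinite (diskMeasure ω) := by
  unfold diskMeasure; infer_instance

instance instIsFiniteMeasureRestrictAngle : IsFiniteMeasure
    (ENNReal.ofReal (Real.pi)⁻¹ • (volume : Measure ℝ).restrict (Ico 0 (2 * Real.pi))) :=
  Measure.smul_finite _ ENNReal.ofReal_ne_top

lemma lintegral_diskMeasure [SFinite ω] {f : ℂ → ℝ≥0∞} (hf : Measurable f) :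
    ∫⁻ z, f z ∂(diskMeasure ω) = ∫⁻ r, ENNReal.ofReal r * (ENNReal.ofReal (Real.pi)⁻¹ *
      ∫⁻ θ in Ico 0 (2 * Real.pi), f (r * Complex.exp (θ * Complex.I))) ∂ω := by
  rw [diskMeasure, lintegral_map hf measurable_polar,
    lintegral_prod _ (by exact (hf.comp measurable_polar).aemeasurable),
    lintegral_withDensity_eq_lintegral_mul _ (by fun_prop)]
  · simp only [Pi.mul_apply, lintegral_smul_measure, smul_eq_mul]
  · exact (hf.comp measurable_polar).lintegral_prod_right'

lemma ae_mem_Ico (hω : ω (Ico 0 1)ᶜ = 0) : ∀ᵐ r ∂ω, r ∈ Ico (0 : ℝ) 1 :=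
  measure_eq_zero_iff_ae_notMem.1 hω |>.mono fun _ h => by simpa using h

lemma ae_mem_ball [SFinite ω] (hω : ω (Ico 0 1)ᶜ = 0) :
    ∀ᵐ z ∂(diskMeasure ω), z ∈ ball (0 : ℂ) 1 := by
  have hm : MeasurableSet (ball (0 : ℂ) 1)ᶜ := measurableSet_ball.compl
  have : diskMeasure ω (ball 0 1)ᶜ = 0 := by
    rw [← lintegral_indicator_one hm, lintegral_diskMeasure (measurable_one.indicator hm)]
    rw [lintegral_congr_ae (g := fun _ => 0)]
    · simp
    filter_upwards [ae_mem_Ico hω] with r hr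
    have h0 : ∀ θ : ℝ, (ball (0 : ℂ) 1)ᶜ.indicator (1 : ℂ → ℝ≥0∞)
        (r * Complex.exp (θ * Complex.I)) = 0 := by
      intro θ
      rw [indicator_of_notMem]
      simp only [mem_compl_iff, mem_ball_zero_iff, not_not, norm_polar hr.1]
      exact hr.2
    simp [h0]
  exact measure_eq_zero_iff_ae_notMem.1 this |>.mono fun _ h => by simpa using h

/-- The points of polar radius in `[s, t)` and polar angle in `[a, a + 2πh)`. -/
def polarSector (s t a h : ℝ) : Set ℂ :=
  {z | s ≤ ‖z‖ ∧ ‖z‖ < t ∧ ∃ n : ℤ, a ≤ z.arg + 2 * Real.pi * n ∧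
    z.arg + 2 * Real.pi * n < a + 2 * Real.pi * h}

lemma measurableSet_exists_int_shift {α : Type*} [MeasurableSpace α] {u : α → ℝ}
    (hu : Measurable u) : MeasurableSet {x | ∃ n : ℤ, a ≤ u x + 2 * Real.pi * n ∧
      u x + 2 * Real.pi * n < a + 2 * Real.pi * h} := by
  have : {x | ∃ n : ℤ, a ≤ u x + 2 * Real.pi * n ∧ u x + 2 * Real.pi * n < a + 2 * Real.pi * h}
      = ⋃ n : ℤ, {x | a ≤ u x + 2 * Real.pi * n ∧
        u x + 2 * Real.pi * n < a + 2 * Real.pi * h} := by ext; simp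
  rw [this]
  refine MeasurableSet.iUnion fun n => ?_
  have hm : Measurable fun x => u x + 2 * Real.pi * n := hu.add_const _
  exact (measurableSet_le measurable_const hm).inter (measurableSet_lt hm measurable_const)

lemma measurableSet_polarSector : MeasurableSet (polarSector s t a h) :=
  (measurableSet_le measurable_const measurable_norm).inter
    ((measurableSet_lt measurable_norm measurable_const).inter
      (measurableSet_exists_int_shift Complex.measurable_arg))

lemma exists_int_shift_mem_Ico (x a : ℝ) :
    ∃ n : ℤ, a ≤ x + 2 * Real.pi * n ∧ x + 2 * Real.pi * n < a + 2 * Real.pi := by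
  obtain ⟨n, hn, -⟩ := existsUnique_add_zsmul_mem_Ico Real.two_pi_pos x a
  refine ⟨n, ?_⟩
  simpa [mul_comm] using hn

lemma carlesonSquare_eq (h1 : h ≤ 1) :
    carlesonSquare a h = polarSector (1 - h) 1 a h := by
  ext z
  constructor
  · rintro ⟨r, θ, h2, h3, h4, h5, rfl⟩
    have hr : 0 ≤ r := by linarith
    rw [polarSector, mem_ofPred_eq, norm_polar hr]
    refine ⟨h2, h3, ?_⟩
    -- The origin belongs to the square only when `h = 1`. The arc is then the whole circle, so the
    -- conventional value `arg 0 = 0` does no harm.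
    rcases hr.eq_or_lt with rfl | hr
    · have : h = 1 := by linarith
      subst this
      simpa using exists_int_shift_mem_Ico 0 a
    · obtain ⟨k, hk⟩ := exists_arg_polar hr θ
      refine ⟨-k, ?_⟩
      rw [hk]
      push_cast
      constructor <;> linarith
  · rintro ⟨h2, h3, n, h4, h5⟩
    exact ⟨‖z‖, _, h2, h3, h4, h5, eq_polar_arg z n⟩

lemma measurableSet_carlesonSquare (h1 : h ≤ 1) : MeasurableSet (carlesonSquare a h) :=
  carlesonSquare_eq h1 ▸ measurableSet_polarSector

lemma carlesonSquare_subset_ball (h1 : h ≤ 1) : carlesonSquare a h ⊆ ball 0 1 := by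
  rw [carlesonSquare_eq h1]
  exact fun z hz => by simpa using hz.2.1

lemma carlesonSquare_one : carlesonSquare a 1 = ball 0 1 := by
  refine (carlesonSquare_subset_ball le_rfl).antisymm fun z hz => ?_
  rw [carlesonSquare_eq le_rfl]
  refine ⟨by simp, by simpa using hz, ?_⟩
  simpa using exists_int_shift_mem_Ico z.arg a

/-- The set of angles is `2π`-periodic, so its measure is the same over every interval of length
`2π`. Over `[a, a + 2π)` it is a single interval, because `h ≤ 1`. -/
lemma volume_angle (h1 : h ≤ 1) :
    volume ({θ : ℝ | ∃ n : ℤ, a ≤ θ + 2 * Real.pi * n ∧ θ + 2 * Real.pi * n < a + 2 * Real.pi * h}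
      ∩ Ico 0 (2 * Real.pi)) = ENNReal.ofReal (2 * Real.pi * h) := by
  set A := {θ : ℝ | ∃ n : ℤ, a ≤ θ + 2 * Real.pi * n ∧
    θ + 2 * Real.pi * n < a + 2 * Real.pi * h} with hA
  have hp := Real.two_pi_pos
  have hAm : MeasurableSet A := measurableSet_exists_int_shift measurable_id
  have hinv : ∀ g : AddSubgroup.zmultiples (2 * Real.pi), (fun x => g +ᵥ x) ⁻¹' A = A := by
    rintro ⟨g, hg⟩
    obtain ⟨k, rfl⟩ := AddSubgroup.mem_zmultiples_iff.1 hg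
    ext θ
    simp only [hA, mem_preimage, mem_ofPred_eq, AddSubgroup.vadd_def, vadd_eq_add, zsmul_eq_mul]
    constructor
    · rintro ⟨n, h2, h3⟩
      refine ⟨n + k, ?_⟩
      push_cast
      constructor <;> linarith
    · rintro ⟨n, h2, h3⟩
      refine ⟨n - k, ?_⟩
      push_cast
      constructor <;> linarith
  have e1 := (isAddFundamentalDomain_Ioc hp 0).measure_set_eq (isAddFundamentalDomain_Ioc hp a)
    hAm hinv
  rw [zero_add] at e1
  have e2 : ∀ b c : ℝ, volume (A ∩ Ico b c) = volume (A ∩ Ioc b c) := fun b c =>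
    measure_congr ((ae_eq_refl A).inter Ico_ae_eq_Ioc)
  have e3 : A ∩ Ico a (a + 2 * Real.pi) = Ico a (a + 2 * Real.pi * h) := by
    ext θ
    constructor
    · rintro ⟨⟨n, h2, h3⟩, h4, h5⟩
      have hn1 : (n : ℝ) < 1 := by nlinarith
      have hn2 : (-1 : ℝ) < n := by nlinarith
      have : n = 0 := by
        have : n < 1 := by exact_mod_cast hn1
        have : -1 < n := by exact_mod_cast hn2
        omega
      subst this
      simp only [Int.cast_zero, mul_zero, add_zero] at h2 h3
      exact ⟨h2, h3⟩
    · rintro ⟨h2, h3⟩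
      exact ⟨⟨0, by simpa using h2, by simpa using h3⟩, h2, by nlinarith⟩
  rw [e2, e1, ← e2, e3, Real.volume_Ico]
  congr 1
  ring

/-- The mass `∫_{[s,t)} r dω(r)`. -/
noncomputable def radialMass (ω : Measure ℝ) (s t : ℝ) : ℝ≥0∞ :=
  ∫⁻ r in Ico s t, ENNReal.ofReal r ∂ω

lemma diskMeasure_polarSector [SFinite ω] (hω : ω (Ico 0 1)ᶜ = 0) (h1 : h ≤ 1) :
    diskMeasure ω (polarSector s t a h) = ENNReal.ofReal (2 * h) * radialMass ω s t := by
  have hm : MeasurableSet (polarSector s t a h) := measurableSet_polarSector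
  rw [← lintegral_indicator_one hm, lintegral_diskMeasure (measurable_one.indicator hm),
    radialMass, ← lintegral_indicator measurableSet_Ico,
    ← lintegral_const_mul _ (Measurable.indicator (by fun_prop) measurableSet_Ico)]
  refine lintegral_congr_ae ?_
  filter_upwards [ae_mem_Ico hω] with r hr
  -- A possible atom of `ω` at `0` is killed by the density `r`.
  rcases hr.1.eq_or_lt with rfl | hr0
  · simp [indicator]
  by_cases hst : r ∈ Ico s t
  · have e : ∀ θ : ℝ, (polarSector s t a h).indicator (1 : ℂ → ℝ≥0∞)
        (r * Complex.exp (θ * Complex.I)) = {θ : ℝ | ∃ n : ℤ, a ≤ θ + 2 * Real.pi * n ∧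
          θ + 2 * Real.pi * n < a + 2 * Real.pi * h}.indicator 1 θ := by
      intro θ
      obtain ⟨k, hk⟩ := exists_arg_polar hr0 θ
      have : (r * Complex.exp (θ * Complex.I)) ∈ polarSector s t a h ↔
          θ ∈ {θ : ℝ | ∃ n : ℤ, a ≤ θ + 2 * Real.pi * n ∧
          θ + 2 * Real.pi * n < a + 2 * Real.pi * h} := by
        simp only [polarSector, mem_ofPred_eq, norm_polar hr.1, hst.1, hst.2, true_and, hk]
        constructor
        · rintro ⟨n, h2, h3⟩
          refine ⟨n + k, ?_⟩
          push_cast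
          constructor <;> linarith
        · rintro ⟨n, h2, h3⟩
          refine ⟨n - k, ?_⟩
          push_cast
          constructor <;> linarith
      by_cases h2 : (r * Complex.exp (θ * Complex.I)) ∈ polarSector s t a h
      · rw [indicator_of_mem h2, indicator_of_mem (this.1 h2)]; rfl
      · rw [indicator_of_notMem h2, indicator_of_notMem (mt this.2 h2)]
    simp only [e, indicator_of_mem hst]
    rw [lintegral_indicator_one₀, Measure.restrict_apply₀, volume_angle h1,
      ← ENNReal.ofReal_mul (by positivity), mul_comm]
    · congr 2
      field_simp
    all_goals
      exact (measurableSet_exists_int_shift measurable_id).nullMeasurableSet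
  · have e : ∀ θ : ℝ, (polarSector s t a h).indicator (1 : ℂ → ℝ≥0∞)
        (r * Complex.exp (θ * Complex.I)) = 0 := by
      intro θ
      rw [indicator_of_notMem]
      rintro ⟨h2, h3, -⟩
      rw [norm_polar hr.1] at h2 h3
      exact hst ⟨h2, h3⟩
    simp [e, indicator_of_notMem hst]

lemma diskMeasure_carlesonSquare [SFinite ω] (hω : ω (Ico 0 1)ᶜ = 0) (h1 : h ≤ 1) :
    diskMeasure ω (carlesonSquare a h) = ENNReal.ofReal (2 * h) * radialMass ω (1 - h) 1 := by
  rw [carlesonSquare_eq h1, diskMeasure_polarSector hω h1]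

lemma diskMeasure_univ [SFinite ω] (hω : ω (Ico 0 1)ᶜ = 0) :
    diskMeasure ω univ = 2 * radialMass ω 0 1 := by
  rw [← measure_congr (Filter.eventuallyEq_univ.2 (ae_mem_ball hω)),
    show {x | (fun z => z ∈ ball (0 : ℂ) 1) x} = ball 0 1 from rfl, ← carlesonSquare_one (a := 0), diskMeasure_carlesonSquare hω le_rfl]
  simp

lemma radialMass_le_measure (ht : t ≤ 1) : radialMass ω s t ≤ ω (Ico s t) := by
  rw [radialMass, ← setLIntegral_one]
  refine setLIntegral_mono measurable_const fun r hr => ?_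
  exact ENNReal.ofReal_le_one.2 (hr.2.le.trans ht)

lemma isFiniteMeasure_diskMeasure [IsFiniteMeasure ω] (hω : ω (Ico 0 1)ᶜ = 0) :
    IsFiniteMeasure (diskMeasure ω) := by
  refine ⟨?_⟩
  rw [diskMeasure_univ hω]
  exact ENNReal.mul_lt_top (by simp) ((radialMass_le_measure le_rfl).trans_lt (measure_lt_top _ _))

/-- The mean value property, integrated against a radial function. -/
lemma integral_radial_mul [IsFiniteMeasure ω] (hω : ω (Ico 0 1)ᶜ = 0) {φ : ℝ → ℂ} {G : ℂ → ℂ}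
    (hφ : Integrable (fun z => φ ‖z‖) (diskMeasure ω)) (hG : DifferentiableOn ℂ G (ball 0 1))
    (hint : Integrable (fun z => φ ‖z‖ * G z) (diskMeasure ω)) :
    ∫ z, φ ‖z‖ * G z ∂(diskMeasure ω) = (∫ z, φ ‖z‖ ∂(diskMeasure ω)) * G 0 := by
  have : IsFiniteMeasure (ω.withDensity fun r => ENNReal.ofReal r) := by
    refine isFiniteMeasure_withDensity (ne_of_lt ?_)
    have : ∫⁻ r, ENNReal.ofReal r ∂ω ≤ ∫⁻ _, 1 ∂ω := lintegral_mono_ae (by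
      filter_upwards [ae_mem_Ico hω] with r hr using ENNReal.ofReal_le_one.2 hr.2.le)
    exact this.trans_lt (by simp)
  have hP := measurable_polar
  have key : ∀ (F : ℂ → ℂ), Integrable F (diskMeasure ω) → ∫ z, F z ∂(diskMeasure ω) =
      ∫ r : ℝ, ((Real.pi)⁻¹ • ∫ θ in Ico 0 (2 * Real.pi), F (r * Complex.exp (θ * Complex.I)))
        ∂(ω.withDensity fun r => ENNReal.ofReal r) := by
    intro F hF
    rw [diskMeasure, integral_map hP.aemeasurable hF.1, integral_prod]
    · simp only [integral_smul_measure]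
      rw [ENNReal.toReal_ofReal (by positivity)]
    · exact (integrable_map_measure hF.1 hP.aemeasurable).1 hF
  rw [key _ hint, key _ hφ, ← integral_mul_const]
  refine integral_congr_ae ?_
  have hae : ∀ᵐ r ∂(ω.withDensity fun r => ENNReal.ofReal r), r ∈ Ico (0 : ℝ) 1 :=
    (withDensity_absolutelyContinuous _ _).ae_le (ae_mem_Ico hω)
  filter_upwards [hae] with r hr
  simp only [norm_polar hr.1]
  have hd : DiffContOnCl ℂ G (ball 0 |r|) := by
    rw [abs_of_nonneg hr.1]
    refine (hG.mono ?_).diffContOnCl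
    intro z hz
    have := closure_ball_subset_closedBall hz
    simp only [mem_closedBall, dist_zero_right, mem_ball] at this ⊢
    linarith [hr.2]
  have hc := hd.circleAverage
  rw [Real.circleAverage_def, intervalIntegral.integral_of_le Real.two_pi_pos.le,
    ← integral_Ico_eq_integral_Ioc] at hc
  simp only [circleMap_zero] at hc
  rw [integral_const_mul, setIntegral_const, ← hc]
  simp only [Complex.real_smul, measureReal_def, Real.volume_Ico, sub_zero,
    ENNReal.toReal_ofReal Real.two_pi_pos.le]
  have : (Real.pi : ℂ) ≠ 0 := by exact_mod_cast Real.pi_ne_zero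
  push_cast
  generalize (∫ θ in Ico 0 (2 * Real.pi), G (r * Complex.exp (θ * Complex.I))) = J
  field_simp

end Disk

/-! ### Regular radial measures -/

section Tail

variable {ω : Measure ℝ} {a h s t : ℝ}

lemma tail_nonneg (ω : Measure ℝ) (t : ℝ) : 0 ≤ tail ω t := measureReal_nonneg

lemma ofReal_tail [IsFiniteMeasure ω] (t : ℝ) : ENNReal.ofReal (tail ω t) = ω (Ico t 1) :=
  ofReal_measureReal

lemma tail_antitone [IsFiniteMeasure ω] (h : s ≤ t) : tail ω t ≤ tail ω s :=
  measureReal_mono (Ico_subset_Ico_left h)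

lemma tail_eq_of_nonpos [IsFiniteMeasure ω] (hω : ω (Ico 0 1)ᶜ = 0) (ht : t ≤ 0) :
    tail ω t = tail ω 0 := by
  refine le_antisymm ?_ (tail_antitone ht)
  refine ENNReal.toReal_mono (measure_ne_top _ _) (measure_mono_ae ?_)
  filter_upwards [ae_mem_Ico hω] with r hr _ using hr

lemma IsRegular.tail_zero_pos (hω : IsRegular ω) : 0 < tail ω 0 := by
  have := hω.finite
  refine (tail_nonneg ω 0).lt_of_ne fun h0 => hω.ne_zero ?_
  have h1 : ω (Ico 0 1) = 0 := by rw [← ofReal_tail, ← h0, ENNReal.ofReal_zero]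
  rw [← Measure.measure_univ_eq_zero, ← union_compl_self (Ico (0 : ℝ) 1)]
  exact le_antisymm ((measure_union_le _ _).trans (by rw [h1, hω.support, add_zero])) bot_le

/-- Doubling of the tail, for all dilation factors at once. -/
lemma IsRegular.exists_tail_le (hω : IsRegular ω) :
    ∃ C β : ℝ, 0 < C ∧ 0 < β ∧ ∀ h A : ℝ, 0 < h → h ≤ 1 → 1 ≤ A →
      tail ω (1 - A * h) ≤ C * A ^ β * tail ω (1 - h) := by
  have := hω.finite
  obtain ⟨C, γ, β, hC, hγ, hγβ, H⟩ := hω.control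
  have hβ : 0 < β := hγ.trans_le hγβ
  refine ⟨C, β, hC, hβ, fun h A h0 h1 hA => ?_⟩
  have key : ∀ B, 1 ≤ B → B * h ≤ 1 → tail ω (1 - B * h) ≤ C * B ^ β * tail ω (1 - h) := by
    intro B hB hBh
    have := (H (1 - B * h) (1 - h) (by linarith) (by nlinarith) (by linarith)).2
    rwa [show (1 - (1 - B * h)) / (1 - (1 - h)) = B by
      rw [sub_sub_cancel, sub_sub_cancel]; field_simp] at this
  -- Once `Ah` exceeds `1` the tail no longer grows, and the case of the factor `1 / h ≤ A` gives
  -- the bound.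
  rcases le_total (A * h) 1 with hAh | hAh
  · exact key A hA hAh
  · rw [tail_eq_of_nonpos hω.support (by linarith)]
    have h2 := key (1 / h) (by rw [le_div_iff₀ h0]; linarith) (by field_simp; rfl)
    rw [show 1 - 1 / h * h = 0 by field_simp; ring] at h2
    refine h2.trans ?_
    have : 1 / h ≤ A := by rw [div_le_iff₀ h0]; exact hAh
    have := tail_nonneg ω (1 - h)
    gcongr

lemma IsRegular.tail_pos (hω : IsRegular ω) (h0 : 0 < h) (h1 : h ≤ 1) : 0 < tail ω (1 - h) := by
  obtain ⟨C, β, hC, hβ, H⟩ := hω.exists_tail_le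
  have h2 := H h (1 / h) h0 h1 (by rw [le_div_iff₀ h0]; linarith)
  rw [show 1 - 1 / h * h = 0 by field_simp; ring] at h2
  have h3 := hω.tail_zero_pos
  by_contra h4
  have := mul_nonneg (by positivity : (0 : ℝ) ≤ C * (1 / h) ^ β) (by linarith : 0 ≤ -tail ω (1 - h))
  linarith

/-- The density `r` is at least `1/2` on `[1/2, 1)`. For `h > 1/2` doubling first reduces the tail
to the one at `1/2`. -/
lemma IsRegular.exists_tail_le_radialMass (hω : IsRegular ω) :
    ∃ C : ℝ, 0 < C ∧ ∀ h : ℝ, 0 < h → h ≤ 1 →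
      ENNReal.ofReal (tail ω (1 - h)) ≤ ENNReal.ofReal C * radialMass ω (1 - h) 1 := by
  have := hω.finite
  obtain ⟨C, β, hC, hβ, H⟩ := hω.exists_tail_le
  have key : ∀ s, 1 / 2 ≤ s → ENNReal.ofReal (tail ω s) ≤ ENNReal.ofReal 2 * radialMass ω s 1 := by
    intro s hs
    rw [ofReal_tail, radialMass, ← lintegral_const_mul _ (by fun_prop), ← setLIntegral_one]
    refine setLIntegral_mono (by fun_prop) fun r hr => ?_
    rw [← ENNReal.ofReal_mul (by norm_num), ENNReal.one_le_ofReal]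
    linarith [hr.1]
  have hmono : ∀ s t, s ≤ t → radialMass ω t 1 ≤ radialMass ω s 1 := fun s t hst =>
    lintegral_mono_set (Ico_subset_Ico_left hst)
  refine ⟨max 2 (C * 2 ^ β * 2), by positivity, fun h h0 h1 => ?_⟩
  rcases le_total h (1 / 2) with hh | hh
  · refine (key _ (by linarith)).trans ?_
    gcongr
    exact le_max_left _ _
  · have e1 := H (1 / 2) 2 (by norm_num) (by norm_num) (by norm_num)
    have e2 : tail ω (1 - h) ≤ C * 2 ^ β * tail ω (1 - 1 / 2) :=
      (tail_antitone (by linarith)).trans e1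
    calc ENNReal.ofReal (tail ω (1 - h)) ≤ ENNReal.ofReal (C * 2 ^ β * tail ω (1 - 1 / 2)) :=
          ENNReal.ofReal_le_ofReal e2
      _ = ENNReal.ofReal (C * 2 ^ β) * ENNReal.ofReal (tail ω (1 - 1 / 2)) :=
          ENNReal.ofReal_mul (by positivity)
      _ ≤ ENNReal.ofReal (C * 2 ^ β) * (ENNReal.ofReal 2 * radialMass ω (1 - h) 1) := by
          gcongr
          refine (key _ (by norm_num)).trans ?_
          gcongr
          exact hmono _ _ (by linarith)
      _ = ENNReal.ofReal (C * 2 ^ β * 2) * radialMass ω (1 - h) 1 := by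
          rw [← mul_assoc, ← ENNReal.ofReal_mul (by positivity)]
      _ ≤ _ := by
          gcongr
          exact le_max_right _ _

/-- The tops of Carleson squares carry a fixed proportion of their mass. -/
lemma IsRegular.exists_radialMass_le_half (hω : IsRegular ω) :
    ∃ k : ℕ, ∀ h : ℝ, 0 < h → h ≤ 1 →
      radialMass ω (1 - h / 2 ^ k) 1 ≤ 1 / 2 * radialMass ω (1 - h) 1 := by
  have := hω.finite
  obtain ⟨C₁, hC₁, H₁⟩ := hω.exists_tail_le_radialMass
  obtain ⟨C, γ, β, hC, hγ, hγβ, H⟩ := hω.control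
  -- The lower power control makes the tail at `1 - h / 2 ^ k` smaller than that at `1 - h` by the
  -- factor `C / 2 ^ (kγ)`. This has to absorb the loss `C₁` between tail and radial mass and still
  -- leave `1/2`.
  obtain ⟨k, hk⟩ : ∃ k : ℕ, C * C₁ * 2 ≤ (2 ^ γ : ℝ) ^ k :=
    (pow_unbounded_of_one_lt (C * C₁ * 2) (Real.one_lt_rpow one_lt_two hγ)).imp
      fun _ h => h.le
  refine ⟨k, fun h h0 h1 => ?_⟩
  have p2 : (1 : ℝ) ≤ 2 ^ k := one_le_pow₀ (by norm_num)
  have hd : h / 2 ^ k ≤ h := div_le_self h0.le p2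
  have hd0 : 0 < h / 2 ^ k := by positivity
  have e1 := (H (1 - h) (1 - h / 2 ^ k) (by linarith) (by linarith) (by linarith)).1
  rw [show (1 - (1 - h)) / (1 - (1 - h / 2 ^ k)) = 2 ^ k by
      rw [sub_sub_cancel, sub_sub_cancel]; field_simp,
    ← Real.rpow_natCast_mul zero_le_two, mul_comm (k : ℝ), Real.rpow_mul_natCast zero_le_two] at e1
  have e2 : tail ω (1 - h / 2 ^ k) * (2 * C₁) ≤ tail ω (1 - h) := by
    refine le_trans ?_ e1
    have := tail_nonneg ω (1 - h / 2 ^ k)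
    rw [mul_comm]
    refine mul_le_mul_of_nonneg_right ?_ this
    rw [le_inv_mul_iff₀ hC]
    linarith
  have hC2 : (0 : ℝ) < 2 * C₁ := by positivity
  calc radialMass ω (1 - h / 2 ^ k) 1 ≤ ENNReal.ofReal (tail ω (1 - h / 2 ^ k)) := by
        rw [ofReal_tail]; exact radialMass_le_measure le_rfl
    _ ≤ ENNReal.ofReal (tail ω (1 - h) * (2 * C₁)⁻¹) := by
        refine ENNReal.ofReal_le_ofReal ?_
        rw [← div_eq_mul_inv, le_div_iff₀ hC2]; exact e2
    _ = ENNReal.ofReal (2 * C₁)⁻¹ * ENNReal.ofReal (tail ω (1 - h)) := by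
        rw [mul_comm, ENNReal.ofReal_mul (by positivity)]
    _ ≤ ENNReal.ofReal (2 * C₁)⁻¹ * (ENNReal.ofReal C₁ * radialMass ω (1 - h) 1) := by
        gcongr; exact H₁ h h0 h1
    _ = ENNReal.ofReal (1 / 2) * radialMass ω (1 - h) 1 := by
        rw [← mul_assoc, ← ENNReal.ofReal_mul (by positivity)]
        congr 2
        field_simp
    _ = _ := by
        rw [ENNReal.ofReal_div_of_pos two_pos]; simp

/-- Moments of order at least `1/h` are controlled by the tail at `1 - h`. -/
lemma IsRegular.exists_moment_le (hω : IsRegular ω) :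
    ∃ C : ℝ, 0 < C ∧ ∀ (h : ℝ) (N : ℕ), 0 < h → h ≤ 1 → 1 / h ≤ N →
      ∫⁻ r, ENNReal.ofReal (r ^ (2 * N)) ∂ω ≤ ENNReal.ofReal (C * tail ω (1 - h)) := by
  have := hω.finite
  obtain ⟨C, β, hC, hβ, H⟩ := hω.exists_tail_le
  -- On the annulus where `1 - r` is about `2 ^ i * h` one has `r ^ (2N) ≤ exp (-2 ^ i) ≤ n! 2 ^
  -- (-in)`, while the tail there has grown by at most `C 2 ^ (iβ)`. With `n ≥ β + 1` the products
  -- are at most a multiple of `2 ^ (-i)` and have a finite sum.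
  obtain ⟨n, hn⟩ := exists_nat_ge (β + 1)
  refine ⟨n.factorial * C * 2, by positivity, fun h N h0 h1 hN => ?_⟩
  have hT := tail_nonneg ω (1 - h)
  have hpt : ∀ r ∈ Ico (0 : ℝ) 1, ENNReal.ofReal (r ^ (2 * N)) ≤
      ∑' i : ℕ, (Ico (1 - 2 ^ i * h) 1).indicator
        (fun _ => ENNReal.ofReal (n.factorial * ((2 : ℝ) ^ (i * n))⁻¹)) r := by
    intro r hr
    have hex : ∃ i : ℕ, 1 - r ≤ 2 ^ i * h := by
      obtain ⟨i, hi⟩ := pow_unbounded_of_one_lt ((1 - r) / h) one_lt_two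
      exact ⟨i, by rw [div_lt_iff₀ h0] at hi; exact hi.le⟩
    classical
    set i := Nat.find hex with hi
    have hi1 : 1 - r ≤ 2 ^ i * h := Nat.find_spec hex
    refine le_trans ?_ (ENNReal.le_tsum i)
    have hmem : r ∈ Ico (1 - 2 ^ i * h) 1 := ⟨by linarith, hr.2⟩
    rw [indicator_of_mem hmem]
    refine ENNReal.ofReal_le_ofReal ?_
    have hfac : (1 : ℝ) ≤ n.factorial := by exact_mod_cast Nat.one_le_iff_ne_zero.2 n.factorial_ne_zero
    rcases Nat.eq_zero_or_pos i with hi0 | hi0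
    · rw [hi0]
      simpa using (pow_le_one₀ hr.1 hr.2.le).trans hfac
    · have hlt : 2 ^ (i - 1) * h < 1 - r := not_le.1 (Nat.find_min hex (by omega))
      have h2i : (2 : ℝ) ^ i = 2 * 2 ^ (i - 1) := by rw [← pow_succ', Nat.sub_add_cancel hi0]
      have hNh : 1 ≤ N * h := by rwa [div_le_iff₀ h0] at hN
      have e0 : r ≤ Real.exp (-(1 - r)) := by
        have := Real.add_one_le_exp (-(1 - r)); linarith
      have e1 : r ^ (2 * N) ≤ Real.exp (-(2 ^ i)) := by
        calc r ^ (2 * N) ≤ Real.exp (-(1 - r)) ^ (2 * N) := pow_le_pow_left₀ hr.1 e0 _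
          _ = Real.exp (-((2 * N : ℕ) * (1 - r))) := by rw [← Real.exp_nat_mul]; ring_nf
          _ ≤ _ := by
            refine Real.exp_le_exp.2 (neg_le_neg ?_)
            push_cast
            rw [h2i]
            have : 2 ^ (i - 1) * 1 ≤ 2 ^ (i - 1) * (N * h) := by gcongr
            have : (N : ℝ) * (2 ^ (i - 1) * h) ≤ N * (1 - r) := by gcongr
            linarith
      have e2 := Real.pow_div_factorial_le_exp ((2 : ℝ) ^ i) (by positivity) n
      refine e1.trans ?_
      rw [Real.exp_neg, pow_mul, inv_le_comm₀ (Real.exp_pos _) (by positivity), mul_inv, inv_inv]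
      rwa [inv_mul_eq_div]
  have hterm : ∀ i : ℕ, ∫⁻ r, (Ico (1 - 2 ^ i * h) 1).indicator
      (fun _ => ENNReal.ofReal (n.factorial * ((2 : ℝ) ^ (i * n))⁻¹)) r ∂ω ≤
      ENNReal.ofReal (n.factorial * C * tail ω (1 - h)) * (2⁻¹ : ℝ≥0∞) ^ i := by
    intro i
    rw [lintegral_indicator_const measurableSet_Ico, ← ofReal_tail,
      ← ENNReal.ofReal_mul (by positivity)]
    have e3 := H h (2 ^ i) h0 h1 (one_le_pow₀ (by norm_num))
    have e4 : ((2 : ℝ) ^ i) ^ β ≤ 2 ^ (i * n) * (2⁻¹) ^ i := by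
      have : ((2 : ℝ) ^ i) ^ (β + 1) ≤ ((2 : ℝ) ^ i) ^ (n : ℝ) :=
        Real.rpow_le_rpow_of_exponent_le (one_le_pow₀ (by norm_num)) hn
      rw [Real.rpow_add (by positivity), Real.rpow_one, Real.rpow_natCast, ← pow_mul] at this
      rw [inv_pow, ← div_eq_mul_inv, le_div_iff₀ (by positivity)]
      exact this
    have e5 : (2⁻¹ : ℝ≥0∞) ^ i = ENNReal.ofReal ((2⁻¹ : ℝ) ^ i) := by
      rw [ENNReal.ofReal_pow (by positivity), ENNReal.ofReal_inv_of_pos two_pos]; simp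
    rw [e5, ← ENNReal.ofReal_mul (by positivity)]
    refine ENNReal.ofReal_le_ofReal ?_
    calc n.factorial * ((2 : ℝ) ^ (i * n))⁻¹ * tail ω (1 - 2 ^ i * h)
        ≤ n.factorial * ((2 : ℝ) ^ (i * n))⁻¹ *
          (C * (2 ^ (i * n) * (2⁻¹) ^ i) * tail ω (1 - h)) := by
          gcongr
          refine e3.trans ?_
          gcongr
      _ = _ := by field_simp
  calc ∫⁻ r, ENNReal.ofReal (r ^ (2 * N)) ∂ω
      ≤ ∫⁻ r, ∑' i : ℕ, (Ico (1 - 2 ^ i * h) 1).indicator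
        (fun _ => ENNReal.ofReal (n.factorial * ((2 : ℝ) ^ (i * n))⁻¹)) r ∂ω := by
        refine lintegral_mono_ae ?_
        filter_upwards [ae_mem_Ico hω.support] with r hr using hpt r hr
    _ = ∑' i : ℕ, ∫⁻ r, (Ico (1 - 2 ^ i * h) 1).indicator
        (fun _ => ENNReal.ofReal (n.factorial * ((2 : ℝ) ^ (i * n))⁻¹)) r ∂ω :=
        lintegral_tsum fun i => (measurable_const.indicator measurableSet_Ico).aemeasurable
    _ ≤ ∑' i : ℕ, ENNReal.ofReal (n.factorial * C * tail ω (1 - h)) * (2⁻¹ : ℝ≥0∞) ^ i :=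
        ENNReal.tsum_le_tsum hterm
    _ = ENNReal.ofReal (n.factorial * C * tail ω (1 - h)) * 2 := by
        rw [ENNReal.tsum_mul_left, ENNReal.tsum_geometric, ENNReal.one_sub_inv_two, inv_inv]
    _ = _ := by
        rw [show (2 : ℝ≥0∞) = ENNReal.ofReal 2 by simp, ← ENNReal.ofReal_mul (by positivity)]
        ring_nf

end Tail

/-! ### The reproducing kernel of a regular measure -/

section Bergman

variable {ω ν : Measure ℝ} {γ a h : ℝ}

/-- The mass of a Carleson square of normalized side length `h`. -/
noncomputable def squareMass (ω : Measure ℝ) (h : ℝ) : ℝ :=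
  2 * h * (radialMass ω (1 - h) 1).toReal

lemma diskMeasure_carlesonSquare_eq_ofReal [IsFiniteMeasure ω] (hω : ω (Ico 0 1)ᶜ = 0)
    (h0 : 0 ≤ h) (h1 : h ≤ 1) :
    diskMeasure ω (carlesonSquare a h) = ENNReal.ofReal (squareMass ω h) := by
  rw [diskMeasure_carlesonSquare hω h1, squareMass, ENNReal.ofReal_mul (q := ENNReal.toReal _)
    (by positivity), ENNReal.ofReal_toReal]
  exact ((radialMass_le_measure le_rfl).trans_lt (measure_lt_top _ _)).ne

lemma IsRegular.exists_tail_le_squareMass (hω : IsRegular ω) :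
    ∃ C : ℝ, 0 < C ∧ ∀ h : ℝ, 0 < h → h ≤ 1 → h * tail ω (1 - h) ≤ C * squareMass ω h := by
  have := hω.finite
  obtain ⟨C, hC, H⟩ := hω.exists_tail_le_radialMass
  refine ⟨C, hC, fun h h0 h1 => ?_⟩
  have hfin : radialMass ω (1 - h) 1 ≠ ∞ :=
    ((radialMass_le_measure le_rfl).trans_lt (measure_lt_top _ _)).ne
  have h2 := ENNReal.toReal_mono (ENNReal.mul_ne_top ENNReal.ofReal_ne_top hfin) (H h h0 h1)
  rw [ENNReal.toReal_ofReal (tail_nonneg _ _), ENNReal.toReal_mul,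
    ENNReal.toReal_ofReal hC.le] at h2
  have h3 : 0 ≤ h * (C * (radialMass ω (1 - h) 1).toReal) := by positivity
  rw [squareMass]
  nlinarith

lemma IsRegular.squareMass_pos (hω : IsRegular ω) (h0 : 0 < h) (h1 : h ≤ 1) :
    0 < squareMass ω h := by
  obtain ⟨C, hC, H⟩ := hω.exists_tail_le_squareMass
  have h2 := (mul_pos h0 (hω.tail_pos h0 h1)).trans_le (H h h0 h1)
  exact pos_of_mul_pos_right h2 hC.le

lemma isReproducingKernelAt_bergmanKernel {z : ℂ} (h : ∃ g, IsReproducingKernelAt ω z g) :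
    IsReproducingKernelAt ω z (bergmanKernel ω z) := by
  rw [bergmanKernel, dif_pos h]
  exact h.choose_spec

lemma memBergman_of_bounded [IsFiniteMeasure ω] (hω : ω (Ico 0 1)ᶜ = 0) {f : ℂ → ℂ} {C : ℝ}
    (hf : DifferentiableOn ℂ f (ball 0 1)) (hm : Measurable f)
    (hC : ∀ z ∈ ball (0 : ℂ) 1, ‖f z‖ ≤ C) : MemBergman ω f := by
  have := isFiniteMeasure_diskMeasure hω
  refine ⟨hf, MemLp.of_bound hm.aestronglyMeasurable C ?_⟩
  filter_upwards [ae_mem_ball hω] with z hz using hC z hz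

/-- By the mean value property, evaluation at the origin is the average over the disc. -/
lemma IsRegular.isReproducingKernelAt_zero (hω : IsRegular ω) : IsReproducingKernelAt ω 0
    (fun _ => (((diskMeasure ω).real univ)⁻¹ : ℝ)) := by
  have := hω.finite
  have := isFiniteMeasure_diskMeasure hω.support
  have hpos : (diskMeasure ω).real univ ≠ 0 := by
    have h1 := diskMeasure_carlesonSquare_eq_ofReal (a := 0) hω.support zero_le_one le_rfl
    have h2 := hω.squareMass_pos one_pos le_rfl
    have h3 : (diskMeasure ω).real (carlesonSquare 0 1) ≤ (diskMeasure ω).real univ :=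
      measureReal_mono (subset_univ _)
    rw [measureReal_def, h1, ENNReal.toReal_ofReal h2.le] at h3
    linarith
  refine ⟨memBergman_of_bounded hω.support (differentiableOn_const _) measurable_const
    (fun z _ => le_rfl), fun f hf => ?_⟩
  have hfi : Integrable f (diskMeasure ω) := hf.2.integrable one_le_two
  have h1 := integral_radial_mul hω.support (φ := fun _ => 1) (integrable_const _) hf.1
    (by simpa using hfi)
  simp only [one_mul] at h1
  simp only [Complex.conj_ofReal]
  rw [integral_mul_const, h1, integral_const]
  have : ((diskMeasure ω).real univ : ℂ) ≠ 0 := by exact_mod_cast hpos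
  simp only [Complex.real_smul]
  push_cast
  field_simp

variable (hω : IsRegular ω) (hγ : 1 ≤ γ) (hrep : HasKernelRepresentation ω γ ν)
include hrep

lemma bergmanKernel_eq_reprKernel {z ζ : ℂ} (hz : z ∈ ball (0 : ℂ) 1) (hζ : ζ ∈ ball (0 : ℂ) 1) :
    bergmanKernel ω z ζ = reprKernel γ ν (conj z * ζ) := by
  rw [hrep.2.2 z hz ζ hζ, reprKernel]
  simp only [mul_assoc]

include hω in
-- If `ν` vanished, the kernel at the origin would vanish on the disc, yet it reproduces the
-- constant `1`.
lemma representingMeasure_ne_zero : ν ≠ 0 := by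
  rintro rfl
  have := hω.finite
  have h0 := isReproducingKernelAt_bergmanKernel ⟨_, hω.isReproducingKernelAt_zero⟩
  have h1 := h0.2 (fun _ => 1) (memBergman_of_bounded hω.support (differentiableOn_const _)
    measurable_const (fun z _ => le_rfl))
  rw [integral_congr_ae (g := fun _ => 0)] at h1
  · simp at h1
  · filter_upwards [ae_mem_ball hω.support] with ζ hζ
    rw [bergmanKernel_eq_reprKernel hrep (by simp) hζ]
    simp [reprKernel]

include hω in
lemma diagKernel_pos (h0 : 0 < h) (h1 : h ≤ 1) : 0 < diagKernel γ ν h := by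
  have := hrep.1
  have hν := representingMeasure_ne_zero hω hrep
  refine mul_pos (by positivity) ?_
  have h2 : ∫ _, (1 : ℝ) ∂ν ≤ ∫ r : ℝ, 1 / (1 - r * (1 - h)) ∂ν := by
    refine integral_mono_ae (integrable_const _)
      (integrable_one_div_one_sub_mul_real hrep.2.1 h0 h1) ?_
    filter_upwards [ae_mem_Icc hrep.2.1] with r hr
    have := one_sub_mul_pos hr h1
    rw [le_div_iff₀ (by linarith)]
    nlinarith [hr.1, hr.2]
  have h3 : 0 < ν.real univ := by
    rw [measureReal_def]
    exact ENNReal.toReal_pos (by simpa using hν) (measure_ne_top _ _)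
  simp only [integral_const, smul_eq_mul, mul_one] at h2
  linarith

omit hrep in
lemma sqrt_mem_ball (h0 : 0 < h) : ((√(1 - h) : ℝ) : ℂ) ∈ ball (0 : ℂ) 1 := by
  rw [mem_ball_zero_iff, Complex.norm_real, Real.norm_of_nonneg (Real.sqrt_nonneg _),
    Real.sqrt_lt' one_pos]
  linarith

/-- For the point `x = √(1 - h)` one has `x̄x = 1 - h`, so `diagKernel` is the kernel on the
diagonal, that is, the squared norm of the kernel function at `x`. -/
lemma bergmanKernel_sqrt (h0 : 0 < h) (h1 : h ≤ 1) :
    bergmanKernel ω (√(1 - h) : ℝ) (√(1 - h) : ℝ) = diagKernel γ ν h := by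
  rw [bergmanKernel_eq_reprKernel hrep (sqrt_mem_ball h0) (sqrt_mem_ball h0),
    Complex.conj_ofReal, ← Complex.ofReal_mul, Real.mul_self_sqrt (by linarith),
    reprKernel_ofReal h0]

include hω in
-- Existence of the kernel is read off from the representation: without a reproducing kernel
-- `bergmanKernel` takes its default value `0`, but its value on the diagonal is positive.
lemma isReproducingKernelAt_sqrt (h0 : 0 < h) (h1 : h ≤ 1) :
    IsReproducingKernelAt ω (√(1 - h) : ℝ) (bergmanKernel ω (√(1 - h) : ℝ)) := by
  refine isReproducingKernelAt_bergmanKernel ?_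
  by_contra hcon
  have h2 := bergmanKernel_sqrt hrep h0 h1
  rw [bergmanKernel, dif_neg hcon] at h2
  have h3 := diagKernel_pos hω hrep h0 h1
  simp only [Pi.zero_apply] at h2
  have : diagKernel γ ν h = 0 := by exact_mod_cast h2.symm
  linarith

include hω in
lemma diagKernel_eq_integral (h0 : 0 < h) (h1 : h ≤ 1) :
    diagKernel γ ν h = ∫ ζ, ‖bergmanKernel ω (√(1 - h) : ℝ) ζ‖ ^ 2 ∂(diskMeasure ω) := by
  have hk := isReproducingKernelAt_sqrt hω hrep h0 h1
  have h2 := hk.2 _ hk.1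
  rw [bergmanKernel_sqrt hrep h0 h1] at h2
  have h3 : ∀ ζ, bergmanKernel ω (√(1 - h) : ℝ) ζ * conj (bergmanKernel ω (√(1 - h) : ℝ) ζ)
      = ((‖bergmanKernel ω (√(1 - h) : ℝ) ζ‖ ^ 2 : ℝ) : ℂ) := fun ζ => by
    rw [Complex.mul_conj, Complex.normSq_eq_norm_sq]
  simp only [h3, integral_complex_ofReal] at h2
  exact_mod_cast h2

include hω in
-- Cauchy–Schwarz in the reproducing formula. It serves to bound `diagKernel` from below by means of
-- a test function.
lemma norm_sq_le_mul_diagKernel (h0 : 0 < h) (h1 : h ≤ 1) {f : ℂ → ℂ} (hf : MemBergman ω f) :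
    ‖f (√(1 - h) : ℝ)‖ ^ 2 ≤ (∫ ζ, ‖f ζ‖ ^ 2 ∂(diskMeasure ω)) * diagKernel γ ν h := by
  have hk := isReproducingKernelAt_sqrt hω hrep h0 h1
  have h2 := hk.2 f hf
  have e2 : ENNReal.ofReal 2 = 2 := by simp
  have h3 := integral_mul_norm_le_Lp_mul_Lq Real.HolderConjugate.two_two
    (by rw [e2]; exact hf.2) (by rw [e2]; exact hk.1.2)
  have h4 : ‖f (√(1 - h) : ℝ)‖ ≤
      ∫ ζ, ‖f ζ‖ * ‖bergmanKernel ω (√(1 - h) : ℝ) ζ‖ ∂(diskMeasure ω) := by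
    rw [h2]
    refine (norm_integral_le_integral_norm _).trans_eq ?_
    simp
  simp only [Real.rpow_two, ← Real.sqrt_eq_rpow] at h3
  rw [← diagKernel_eq_integral hω hrep h0 h1] at h3
  have h5 := pow_le_pow_left₀ (norm_nonneg _) (h4.trans h3) 2
  rwa [mul_pow, Real.sq_sqrt (integral_nonneg fun _ => by positivity),
    Real.sq_sqrt (diagKernel_pos hω hrep h0 h1).le] at h5

omit hrep in
lemma norm_one_sub_polar_le {ρ : ℝ} (h0 : 0 ≤ ρ) (h1 : ρ ≤ 1) (θ : ℝ) :
    ‖1 - (ρ : ℂ) * Complex.exp (θ * Complex.I)‖ ≤ (1 - ρ) + |θ| := by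
  have h2 := norm_one_sub_mul_le (w := Complex.exp (θ * Complex.I)) ⟨h0, h1⟩
  have h3 : ‖1 - Complex.exp (θ * Complex.I)‖ ≤ |θ| := by
    rw [norm_sub_rev, mul_comm]; exact Real.norm_exp_I_mul_ofReal_sub_one_le
  nlinarith [abs_nonneg θ]

omit hrep in
-- Jordan's inequality bounds the chord `|1 - e^{iθ}|` below by `2|θ| / π`, and shrinking the radius
-- to `ρ` costs at most a factor `2`.
lemma abs_le_pi_mul_norm_one_sub_polar {ρ : ℝ} (h0 : 0 ≤ ρ) (h1 : ρ ≤ 1) {θ : ℝ}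
    (hθ : |θ| ≤ Real.pi) : |θ| ≤ Real.pi * ‖1 - (ρ : ℂ) * Complex.exp (θ * Complex.I)‖ := by
  set e := Complex.exp (θ * Complex.I) with he
  have hen : ‖e‖ = 1 := Complex.norm_exp_ofReal_mul_I θ
  have h2 : 1 - ρ ≤ ‖1 - (ρ : ℂ) * e‖ := by
    have := norm_sub_norm_le (1 : ℂ) ((ρ : ℂ) * e)
    rwa [norm_one, norm_mul, hen, mul_one, Complex.norm_real, Real.norm_of_nonneg h0] at this
  have h3 : ‖1 - e‖ ≤ ‖1 - (ρ : ℂ) * e‖ + (1 - ρ) := by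
    have h4 : 1 - e = (1 - (ρ : ℂ) * e) - ((1 - ρ : ℝ) : ℂ) * e := by push_cast; ring
    rw [h4]
    refine (norm_sub_le _ _).trans ?_
    rw [norm_mul ((1 - ρ : ℝ) : ℂ), hen, mul_one, Complex.norm_real,
      Real.norm_of_nonneg (by linarith)]
  have h5 : ‖1 - e‖ = 2 * |Real.sin (θ / 2)| := by
    rw [norm_sub_rev, he, mul_comm, Complex.norm_exp_I_mul_ofReal_sub_one, norm_mul,
      Real.norm_eq_abs, Real.norm_eq_abs, abs_two]
  have h6 := Real.mul_abs_le_abs_sin (x := θ / 2) (by rw [abs_div, abs_two]; linarith)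
  rw [abs_div, abs_two, div_mul_div_comm, mul_comm 2 |θ|, mul_div_mul_right _ _ two_ne_zero,
    div_le_iff₀ Real.pi_pos] at h6
  nlinarith [Real.pi_pos]

omit hrep in
lemma norm_one_sub_sqrt_mul_le (h0 : 0 < h) (h1 : h ≤ 1) {ζ : ℂ}
    (hζ : ζ ∈ carlesonSquare (-(Real.pi * h)) h) : ‖1 - ((√(1 - h) : ℝ) : ℂ) * ζ‖ ≤ 6 * h := by
  obtain ⟨ρ, θ, h2, h3, h4, h5, rfl⟩ := hζ
  have hs1 : √(1 - h) ≤ 1 := Real.sqrt_le_one.2 (by linarith)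
  have hs2 := Real.sq_sqrt (show 0 ≤ 1 - h by linarith)
  have hs3 := Real.sqrt_nonneg (1 - h)
  have hs0 : 1 - h ≤ √(1 - h) := by nlinarith
  rw [← mul_assoc, ← Complex.ofReal_mul]
  refine (norm_one_sub_polar_le (by nlinarith) (by nlinarith) θ).trans ?_
  have : |θ| ≤ Real.pi * h := abs_le.2 ⟨h4, by linarith⟩
  have := Real.pi_lt_four
  have : 1 - 2 * h ≤ √(1 - h) * ρ := by nlinarith
  nlinarith

include hω hγ in
-- On the square `S` of size `h` around the positive axis, `|1 - xζ| ≤ 6h` for `x = √(1 - h)`, so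
-- the kernel function at `x` has modulus at least `diagKernel / c` there. Its squared norm is
-- `diagKernel` itself, so `μ(S) diagKernel² / c² ≤ diagKernel`, and one factor cancels.
lemma exists_diagKernel_mul_squareMass_le :
    ∃ C : ℝ, 0 < C ∧ ∀ h, 0 < h → h ≤ 1 → diagKernel γ ν h * squareMass ω h ≤ C := by
  have := hω.finite
  have := hrep.1
  have := isFiniteMeasure_diskMeasure hω.support
  set c : ℝ := 2 * 6 ^ (γ + 1) with hc
  have hc0 : 0 < c := by positivity
  refine ⟨c ^ 2, by positivity, fun h h0 h1 => ?_⟩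
  have hd := diagKernel_pos hω hrep h0 h1
  set S := carlesonSquare (-(Real.pi * h)) h with hS
  have hk := isReproducingKernelAt_sqrt hω hrep h0 h1
  have hint : Integrable (fun ζ => ‖bergmanKernel ω (√(1 - h) : ℝ) ζ‖ ^ 2) (diskMeasure ω) :=
    hk.1.2.integrable_norm_pow two_ne_zero
  have h2 : (diskMeasure ω).real S • (diagKernel γ ν h / c) ^ 2 ≤
      ∫ ζ in S, ‖bergmanKernel ω (√(1 - h) : ℝ) ζ‖ ^ 2 ∂(diskMeasure ω) := by
    refine setIntegral_ge_of_const_le (measurableSet_carlesonSquare h1) (measure_ne_top _ _)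
      (fun ζ hζ => ?_) hint.integrableOn
    have hζ1 := carlesonSquare_subset_ball h1 hζ
    have hw : ‖((√(1 - h) : ℝ) : ℂ) * ζ‖ < 1 := by
      have := sqrt_mem_ball h0
      rw [mem_ball_zero_iff] at this hζ1
      rw [norm_mul]
      nlinarith [norm_nonneg ζ]
    refine pow_le_pow_left₀ (by positivity) ?_ 2
    rw [div_le_iff₀ hc0, bergmanKernel_eq_reprKernel hrep (sqrt_mem_ball h0) hζ1,
      Complex.conj_ofReal, mul_comm]
    exact diagKernel_le_norm_reprKernel (by linarith) hrep.2.1 h0 h1 (by norm_num) hw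
      (norm_one_sub_sqrt_mul_le h0 h1 hζ)
  have h3 : ∫ ζ in S, ‖bergmanKernel ω (√(1 - h) : ℝ) ζ‖ ^ 2 ∂(diskMeasure ω) ≤
      diagKernel γ ν h := by
    rw [diagKernel_eq_integral hω hrep h0 h1]
    exact setIntegral_le_integral hint (Filter.Eventually.of_forall fun _ => by positivity)
  have h4 : (diskMeasure ω).real S = squareMass ω h := by
    rw [measureReal_def, diskMeasure_carlesonSquare_eq_ofReal hω.support h0.le h1,
      ENNReal.toReal_ofReal (hω.squareMass_pos h0 h1).le]
  have h5 := h2.trans h3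
  rw [h4, smul_eq_mul, div_pow, mul_div_assoc', div_le_iff₀ (by positivity)] at h5
  exact le_of_mul_le_mul_left (by linarith) hd

include hω in
-- The test function is `ζ ^ N / (1 - xζ)` with `x² = 1 - h` and `N` about `1 / h`. Its squared
-- modulus at `x` is about `h⁻²`. The factor `ζ ^ N` concentrates it near the circle, which brings
-- its squared norm down to at most a multiple of `h⁻¹` times the tail at `1 - h`.
lemma exists_le_diagKernel_mul_squareMass :
    ∃ c : ℝ, 0 < c ∧ ∀ h, 0 < h → h ≤ 1 / 2 → c ≤ diagKernel γ ν h * squareMass ω h := by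
  have := hω.finite
  have := isFiniteMeasure_diskMeasure hω.support
  obtain ⟨C, hC, H⟩ := hω.exists_moment_le
  obtain ⟨C₁, hC₁, H₁⟩ := hω.exists_tail_le_squareMass
  refine ⟨Real.exp (-3) / (2 * C * C₁), by positivity, fun h h0 h12 => ?_⟩
  have h1 : h ≤ 1 := by linarith
  set x : ℝ := √(1 - h) with hx
  have hx0 : 0 ≤ x := Real.sqrt_nonneg _
  have hxx : x * x = 1 - h := Real.mul_self_sqrt (by linarith)
  have hx1 : x < 1 := by nlinarith
  obtain ⟨N, hN⟩ : ∃ N : ℕ, N = ⌈1 / h⌉₊ := ⟨_, rfl⟩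
  have hN1 : 1 / h ≤ N := hN ▸ Nat.le_ceil _
  have hN2 : h * N ≤ 3 / 2 := by
    have : (N : ℝ) < 1 / h + 1 := hN ▸ Nat.ceil_lt_add_one (by positivity)
    have := mul_lt_mul_of_pos_left this h0
    rw [mul_add, mul_one_div_cancel h0.ne'] at this
    linarith
  have hden : ∀ ζ ∈ ball (0 : ℂ) 1, 1 - x ≤ ‖1 - (x : ℂ) * ζ‖ := fun ζ hζ =>
    one_sub_le_norm_one_sub_mul ⟨hx0, hx1.le⟩ (by simpa using hζ)
  have hne : ∀ ζ ∈ ball (0 : ℂ) 1, 1 - (x : ℂ) * ζ ≠ 0 := fun ζ hζ => by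
    rw [← norm_pos_iff]; linarith [hden ζ hζ]
  set f : ℂ → ℂ := fun ζ => ζ ^ N / (1 - (x : ℂ) * ζ) with hf
  -- `Re G = (1 - x²|ζ|²) / |1 - xζ|²` is a Poisson kernel. Since `1 - x²|ζ|² ≥ h`, it dominates `h
  -- / |1 - xζ|²`, and integrating it against the radial function `|ζ| ^ (2N)` just replaces it by
  -- `G 0 = 1`.
  set G : ℂ → ℂ := fun ζ => (1 + (x : ℂ) * ζ) / (1 - (x : ℂ) * ζ) with hG
  have hfB : MemBergman ω f := by
    refine memBergman_of_bounded (C := 1 / (1 - x)) hω.support ?_ (by fun_prop) fun ζ hζ => ?_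
    · exact DifferentiableOn.div (by fun_prop) (by fun_prop) hne
    · rw [hf, norm_div, norm_pow]
      have := hden ζ hζ
      have : ‖ζ‖ ^ N ≤ 1 := pow_le_one₀ (norm_nonneg _) (mem_ball_zero_iff.1 hζ).le
      gcongr
  have hGB : MemBergman ω G := by
    refine memBergman_of_bounded (C := 2 / (1 - x)) hω.support ?_ (by fun_prop) fun ζ hζ => ?_
    · exact DifferentiableOn.div (by fun_prop) (by fun_prop) hne
    · rw [hG, norm_div]
      have h2 := hden ζ hζ
      have h3 : ‖(x : ℂ) * ζ‖ ≤ 1 := by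
        rw [mem_ball_zero_iff] at hζ
        rw [norm_mul, Complex.norm_real, Real.norm_of_nonneg hx0]
        nlinarith [norm_nonneg ζ]
      have := norm_add_le 1 ((x : ℂ) * ζ)
      rw [norm_one] at this
      gcongr
      linarith
  have hφm : Measurable fun ζ : ℂ => ((‖ζ‖ ^ (2 * N) : ℝ) : ℂ) := by fun_prop
  have hφ1 : ∀ ζ ∈ ball (0 : ℂ) 1, ‖((‖ζ‖ ^ (2 * N) : ℝ) : ℂ)‖ ≤ 1 := fun ζ hζ => by
    rw [Complex.norm_real, Real.norm_of_nonneg (by positivity)]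
    exact pow_le_one₀ (norm_nonneg _) (mem_ball_zero_iff.1 hζ).le
  have hφae : ∀ᵐ ζ ∂(diskMeasure ω), ‖((‖ζ‖ ^ (2 * N) : ℝ) : ℂ)‖ ≤ 1 := by
    filter_upwards [ae_mem_ball hω.support] with ζ hζ using hφ1 ζ hζ
  have hφi : Integrable (fun ζ : ℂ => ((‖ζ‖ ^ (2 * N) : ℝ) : ℂ)) (diskMeasure ω) :=
    Integrable.of_bound hφm.aestronglyMeasurable 1 hφae
  have hGi : Integrable (fun ζ => ((‖ζ‖ ^ (2 * N) : ℝ) : ℂ) * G ζ) (diskMeasure ω) :=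
    (hGB.2.integrable one_le_two).bdd_mul hφm.aestronglyMeasurable hφae
  have hmv := integral_radial_mul hω.support (φ := fun r => ((r ^ (2 * N) : ℝ) : ℂ)) hφi hGB.1 hGi
  rw [show G 0 = 1 by simp [hG], mul_one, integral_complex_ofReal] at hmv
  have hIle : ∫ ζ, ‖f ζ‖ ^ 2 ∂(diskMeasure ω) ≤
      1 / h * ∫ ζ, ‖ζ‖ ^ (2 * N) ∂(diskMeasure ω) := by
    have hre : ∫ ζ, ‖ζ‖ ^ (2 * N) ∂(diskMeasure ω) =
        ∫ ζ, (((‖ζ‖ ^ (2 * N) : ℝ) : ℂ) * G ζ).re ∂(diskMeasure ω) := by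
      have := integral_re hGi
      simp only [RCLike.re_eq_complex_re] at this
      rw [this, hmv, Complex.ofReal_re]
    rw [hre, ← integral_const_mul]
    refine integral_mono_ae (hfB.2.integrable_norm_pow two_ne_zero) (hGi.re.const_mul _) ?_
    filter_upwards [ae_mem_ball hω.support] with ζ hζ
    have hn := hne ζ hζ
    have hζ1 : ‖ζ‖ < 1 := by simpa using hζ
    have hGre : (G ζ).re = (1 - x ^ 2 * ‖ζ‖ ^ 2) / ‖1 - (x : ℂ) * ζ‖ ^ 2 := by
      rw [hG, Complex.div_re, ← Complex.normSq_eq_norm_sq, ← Complex.normSq_eq_norm_sq,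
        ← add_div]
      congr 1
      simp [Complex.normSq_apply]
      ring
    simp only [Complex.re_ofReal_mul, hGre]
    rw [hf, norm_div, norm_pow, div_pow, ← pow_mul, mul_comm N 2]
    have hn2 : 0 < ‖1 - (x : ℂ) * ζ‖ ^ 2 := by have := norm_pos_iff.2 hn; positivity
    rw [mul_div_assoc', mul_div_assoc', div_le_div_iff_of_pos_right hn2, one_div,
      inv_mul_eq_div, le_div_iff₀ h0]
    refine mul_le_mul_of_nonneg_left ?_ (by positivity)
    nlinarith [norm_nonneg ζ, mul_nonneg (sub_nonneg.2 h1)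
      (mul_nonneg (sub_nonneg.2 hζ1.le) (by positivity : 0 ≤ 1 + ‖ζ‖))]
  have hmom : ∫ ζ, ‖ζ‖ ^ (2 * N) ∂(diskMeasure ω) ≤ 2 * C * tail ω (1 - h) := by
    rw [integral_eq_lintegral_of_nonneg_ae (Filter.Eventually.of_forall fun _ => by positivity)
      (by fun_prop)]
    refine ENNReal.toReal_le_of_le_ofReal (by have := tail_nonneg ω (1 - h); positivity) ?_
    rw [lintegral_diskMeasure (by fun_prop)]
    calc _ ≤ ∫⁻ r, 2 * ENNReal.ofReal (r ^ (2 * N)) ∂ω := by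
          refine lintegral_mono_ae ?_
          filter_upwards [ae_mem_Ico hω.support] with r hr
          simp only [norm_polar hr.1, lintegral_const, Measure.restrict_apply_univ,
            Real.volume_Ico, sub_zero]
          have e : ENNReal.ofReal (Real.pi)⁻¹ * ENNReal.ofReal (2 * Real.pi) = 2 := by
            rw [← ENNReal.ofReal_mul (by positivity),
              show (Real.pi)⁻¹ * (2 * Real.pi) = 2 by field_simp]
            simp
          calc _ = ENNReal.ofReal r * ((ENNReal.ofReal (Real.pi)⁻¹ * ENNReal.ofReal (2 * Real.pi))
                * ENNReal.ofReal (r ^ (2 * N))) := by ring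
            _ ≤ 1 * ((ENNReal.ofReal (Real.pi)⁻¹ * ENNReal.ofReal (2 * Real.pi))
                * ENNReal.ofReal (r ^ (2 * N))) := by
                gcongr; exact ENNReal.ofReal_le_one.2 hr.2.le
            _ = _ := by rw [e, one_mul]
      _ = 2 * ∫⁻ r, ENNReal.ofReal (r ^ (2 * N)) ∂ω := lintegral_const_mul _ (by fun_prop)
      _ ≤ 2 * ENNReal.ofReal (C * tail ω (1 - h)) := by gcongr; exact H h N h0 h1 hN1
      _ = _ := by
          rw [mul_assoc, ENNReal.ofReal_mul zero_le_two]; simp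
  have hfx : ‖f x‖ ^ 2 = (1 - h) ^ N / h ^ 2 := by
    have e1 : (1 : ℂ) - (x : ℂ) * x = (h : ℂ) := by
      rw [← Complex.ofReal_mul, hxx]; push_cast; ring
    simp only [hf]
    rw [e1, norm_div, norm_pow, Complex.norm_real, Complex.norm_real,
      Real.norm_of_nonneg hx0, Real.norm_of_nonneg h0.le, div_pow, ← pow_mul, mul_comm N 2, pow_mul,
      pow_two x, hxx]
  -- For `h ≤ 1/2` one has `1 - h ≥ exp (-2h)` and `hN ≤ 1 + h ≤ 3/2`.
  have hexp : Real.exp (-3) ≤ (1 - h) ^ N := by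
    have e1 : Real.exp (-(2 * h)) ≤ 1 - h := by
      rw [Real.exp_neg, inv_le_comm₀ (Real.exp_pos _) (by linarith)]
      refine le_trans ?_ (Real.add_one_le_exp _)
      rw [inv_le_iff_one_le_mul₀ (by linarith)]
      nlinarith
    calc Real.exp (-3) ≤ Real.exp (-(2 * h)) ^ N := by
          rw [← Real.exp_nat_mul]
          exact Real.exp_le_exp.2 (by nlinarith)
      _ ≤ _ := pow_le_pow_left₀ (Real.exp_pos _).le e1 _
  have hmain := norm_sq_le_mul_diagKernel hω hrep h0 h1 hfB
  rw [← hx, hfx, div_le_iff₀ (by positivity)] at hmain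
  have hd := diagKernel_pos hω hrep h0 h1
  rw [div_le_iff₀ (by positivity)]
  have hT := H₁ h h0 h1
  calc Real.exp (-3) ≤ (1 - h) ^ N := hexp
    _ ≤ (∫ ζ, ‖f ζ‖ ^ 2 ∂(diskMeasure ω)) * diagKernel γ ν h * h ^ 2 := hmain
    _ ≤ (1 / h * (2 * C * tail ω (1 - h))) * diagKernel γ ν h * h ^ 2 := by
        gcongr
        exact hIle.trans (by gcongr)
    _ = 2 * C * diagKernel γ ν h * (h * tail ω (1 - h)) := by field_simp
    _ ≤ 2 * C * diagKernel γ ν h * (C₁ * squareMass ω h) := by gcongr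
    _ = _ := by ring

end Bergman

/-! ### Laminar families of sets: maximal inequality and bilinear embedding -/

section Laminar

/-- Layer-cake formula for a single extended nonnegative number. -/
lemma rpow_eq_lintegral_layers {p : ℝ} (hp : 0 < p) (x : ℝ≥0∞) :
    x ^ p = ∫⁻ t in Ioi (0 : ℝ), {t : ℝ | ENNReal.ofReal t < x}.indicator
      (fun t => ENNReal.ofReal (p * t ^ (p - 1))) t := by
  have key : ∀ y : ℝ, 0 ≤ y → ∫⁻ t in Ioi (0 : ℝ),
      {t : ℝ | ENNReal.ofReal t < ENNReal.ofReal y}.indicator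
      (fun t => ENNReal.ofReal (p * t ^ (p - 1))) t = ENNReal.ofReal (y ^ p) := by
    intro y hy
    have hm : MeasurableSet {t : ℝ | ENNReal.ofReal t < ENNReal.ofReal y} :=
      measurableSet_lt (by fun_prop) measurable_const
    rw [lintegral_indicator hm, Measure.restrict_restrict hm]
    have hset : {t : ℝ | ENNReal.ofReal t < ENNReal.ofReal y} ∩ Ioi 0 = Ioo 0 y := by
      ext t
      simp only [mem_inter_iff, mem_ofPred_eq, mem_Ioi, mem_Ioo]
      constructor
      · rintro ⟨h1, h2⟩
        exact ⟨h2, (ENNReal.ofReal_lt_ofReal_iff_of_nonneg h2.le).1 h1⟩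
      · rintro ⟨h1, h2⟩
        exact ⟨(ENNReal.ofReal_lt_ofReal_iff_of_nonneg h1.le).2 h2, h1⟩
    have hint : IntervalIntegrable (fun t : ℝ => p * t ^ (p - 1)) volume 0 y :=
      (intervalIntegral.intervalIntegrable_rpow' (by linarith)).const_mul p
    rw [hset, Measure.restrict_congr_set Ioo_ae_eq_Ioc, ← ofReal_integral_eq_lintegral_ofReal]
    · rw [← intervalIntegral.integral_of_le hy, intervalIntegral.integral_const_mul,
        integral_rpow (Or.inl (by linarith)), sub_add_cancel, Real.zero_rpow hp.ne', sub_zero,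
        mul_div_cancel₀ _ hp.ne']
    · exact (intervalIntegrable_iff_integrableOn_Ioc_of_le hy).1 hint
    · refine (ae_restrict_iff' measurableSet_Ioc).2 (Filter.Eventually.of_forall fun t ht => ?_)
      have := ht.1
      simp only [Pi.zero_apply]
      positivity
  rcases eq_or_ne x ∞ with rfl | hx
  · rw [ENNReal.top_rpow_of_pos hp, eq_comm, eq_top_iff]
    refine ENNReal.le_of_forall_nnreal_lt fun r _ => ?_
    have h1 := key ((r : ℝ) ^ (1 / p)) (by positivity)
    rw [← Real.rpow_mul (NNReal.coe_nonneg r), one_div_mul_cancel hp.ne', Real.rpow_one,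
      ENNReal.ofReal_coe_nnreal] at h1
    rw [← h1]
    refine lintegral_mono fun t => ?_
    refine indicator_le_indicator_of_subset (fun t _ => ENNReal.ofReal_lt_top) (by simp) t
  · rw [← ENNReal.ofReal_toReal hx, key _ ENNReal.toReal_nonneg,
      ENNReal.ofReal_rpow_of_nonneg ENNReal.toReal_nonneg hp.le]

variable {α ι : Type*} [MeasurableSpace α] [Countable ι]

/-- A countable family of measurable sets, graded by a level, in which two sets are either
disjoint or nested according to their levels. -/
structure IsLaminar (Q : ι → Set α) (lev : ι → ℕ) : Prop where
  measurable : ∀ i, MeasurableSet (Q i)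
  nested : ∀ i j, lev i ≤ lev j → Q j ⊆ Q i ∨ Disjoint (Q i) (Q j)
  disjoint : ∀ i j, i ≠ j → lev i = lev j → Disjoint (Q i) (Q j)

variable {Q E : ι → Set α} {lev : ι → ℕ} {σ : Measure α}

/-- Weak-type bound for the maximal function, with constant `1` for every measure. Each point of the
union lies in a selected set of least level. Such sets suffice to cover the union, and laminarity
makes them pairwise disjoint, so the hypothesis can be summed over them. -/
lemma IsLaminar.mul_measure_biUnion_le (hQ : IsLaminar Q lev) {g : α → ℝ≥0∞} {c : ℝ≥0∞}
    (A : Set ι) (hA : ∀ i ∈ A, c * σ (Q i) ≤ ∫⁻ x in Q i, g x ∂σ) :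
    c * σ (⋃ i ∈ A, Q i) ≤ ∫⁻ x, g x ∂σ := by
  set A' := {i ∈ A | ∀ j ∈ A, lev j < lev i → Disjoint (Q j) (Q i)} with hA'
  have hcover : (⋃ i ∈ A, Q i) ⊆ ⋃ i ∈ A', Q i := by
    intro x hx
    simp only [mem_iUnion, exists_prop] at hx ⊢
    have hex : ∃ n, ∃ i, (i ∈ A ∧ x ∈ Q i) ∧ lev i = n := by
      obtain ⟨i, hi⟩ := hx
      exact ⟨_, i, hi, rfl⟩
    classical
    obtain ⟨i, ⟨hi, hxi⟩, hn⟩ := Nat.find_spec hex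
    refine ⟨i, ⟨hi, fun j hj hji => ?_⟩, hxi⟩
    rcases hQ.nested j i hji.le with h | h
    · exact absurd ⟨j, ⟨hj, h hxi⟩, rfl⟩ (Nat.find_min hex (hn ▸ hji))
    · exact h
  have hdisj : A'.PairwiseDisjoint Q := by
    intro i hi j hj hij
    rcases lt_trichotomy (lev i) (lev j) with h | h | h
    · exact hj.2 i hi.1 h
    · exact hQ.disjoint i j hij h
    · exact (hi.2 j hj.1 h).symm
  calc c * σ (⋃ i ∈ A, Q i) ≤ c * σ (⋃ i ∈ A', Q i) := by gcongr
    _ = ∑' i : A', c * σ (Q i) := by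
        rw [measure_biUnion A'.to_countable hdisj fun i _ => hQ.measurable i, ENNReal.tsum_mul_left]
    _ ≤ ∑' i : A', ∫⁻ x in Q i, g x ∂σ := ENNReal.tsum_le_tsum fun i => hA i i.2.1
    _ = ∫⁻ x in ⋃ i ∈ A', Q i, g x ∂σ :=
        (lintegral_biUnion A'.to_countable (fun i _ => hQ.measurable i) hdisj g).symm
    _ ≤ ∫⁻ x, g x ∂σ := setLIntegral_le_lintegral _ _

/-- Carleson embedding for a laminar family, with a constant not depending on the measure. -/
lemma IsLaminar.tsum_average_rpow_mul_le (hQ : IsLaminar Q lev) [IsFiniteMeasure σ]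
    (hE : ∀ i, MeasurableSet (E i)) (hEQ : ∀ i, E i ⊆ Q i) {k : ℝ≥0∞}
    (hk : ∀ x, ∑' i, (E i).indicator 1 x ≤ k) {p : ℝ} (hp : 1 < p) {F : α → ℝ≥0∞}
    (hF : Measurable F) :
    ∑' i, ((∫⁻ x in Q i, F x ∂σ) / σ (Q i)) ^ p * σ (E i) ≤
      ENNReal.ofReal (2 ^ p * (p / (p - 1))) * k * ∫⁻ x, F x ^ p ∂σ := by
  set a : ι → ℝ≥0∞ := fun i => (∫⁻ x in Q i, F x ∂σ) / σ (Q i) with ha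
  have hp0 : 0 < p := by linarith
  -- If the average over `Q i` exceeds `2t`, the part of `F` below `t` contributes at most half of
  -- that average, so `F` restricted to `{F > t}` still has average at least `t`. Integrating the
  -- resulting bound against `p t ^ (p - 1) dt` and exchanging the integrals produces `2 ^ p` and `p
  -- / (p - 1)`.
  have hlevel : ∀ t : ℝ, 0 < t →
      ENNReal.ofReal t * ∑' i, {i | ENNReal.ofReal t < a i / 2}.indicator (fun i => σ (E i)) i ≤
        k * ∫⁻ x, {x | ENNReal.ofReal t < F x}.indicator F x ∂σ := by
    intro t ht
    set A := {i | ENNReal.ofReal t < a i / 2} with hA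
    have hm : MeasurableSet {x | ENNReal.ofReal t < F x} := measurableSet_lt measurable_const hF
    have h1 : ∑' i, A.indicator (fun i => σ (E i)) i ≤ k * σ (⋃ i ∈ A, Q i) := by
      have hmU : MeasurableSet (⋃ i ∈ A, Q i) :=
        MeasurableSet.biUnion A.to_countable fun i _ => hQ.measurable i
      calc ∑' i, A.indicator (fun i => σ (E i)) i
          = ∑' i, ∫⁻ x, A.indicator (fun i => (E i).indicator 1 x) i ∂σ := by
            refine tsum_congr fun i => ?_
            by_cases hi : i ∈ A
            · simp only [indicator_of_mem hi, lintegral_indicator_one (hE i)]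
            · simp only [indicator_of_notMem hi, lintegral_zero]
        _ = ∫⁻ x, ∑' i, A.indicator (fun i => (E i).indicator 1 x) i ∂σ := by
            refine (lintegral_tsum fun i => ?_).symm
            by_cases hi : i ∈ A
            · simp only [indicator_of_mem hi]
              exact (measurable_one.indicator (hE i)).aemeasurable
            · simp only [indicator_of_notMem hi]
              exact aemeasurable_const
        _ ≤ ∫⁻ x, k * (⋃ i ∈ A, Q i).indicator 1 x ∂σ := by
            refine lintegral_mono fun x => ?_
            by_cases hx : x ∈ ⋃ i ∈ A, Q i
            · rw [indicator_of_mem hx, Pi.one_apply, mul_one]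
              exact (ENNReal.tsum_le_tsum fun i => indicator_le_self _ _ i).trans (hk x)
            · rw [indicator_of_notMem hx, mul_zero]
              refine (ENNReal.tsum_eq_zero.2 fun i => ?_).le
              by_cases hi : i ∈ A
              · rw [indicator_of_mem hi, indicator_of_notMem]
                exact fun h => hx (mem_biUnion hi (hEQ i h))
              · rw [indicator_of_notMem hi]
        _ = k * σ (⋃ i ∈ A, Q i) := by
            rw [lintegral_const_mul _ (measurable_one.indicator hmU), lintegral_indicator_one hmU]
    have h2 : ENNReal.ofReal t * σ (⋃ i ∈ A, Q i) ≤
        ∫⁻ x, {x | ENNReal.ofReal t < F x}.indicator F x ∂σ := by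
      refine hQ.mul_measure_biUnion_le A fun i hi => ?_
      have h3 : ENNReal.ofReal t * 2 < a i :=
        (ENNReal.lt_div_iff_mul_lt (Or.inl two_ne_zero) (Or.inl ENNReal.ofNat_ne_top)).1 hi
      have h4 : ENNReal.ofReal t * 2 * σ (Q i) ≤ ∫⁻ x in Q i, F x ∂σ :=
        ENNReal.mul_le_of_le_div h3.le
      have h5 : ∫⁻ x in Q i, F x ∂σ ≤
          ∫⁻ x in Q i, {x | ENNReal.ofReal t < F x}.indicator F x ∂σ +
            ENNReal.ofReal t * σ (Q i) := by
        rw [← setLIntegral_const, ← lintegral_add_right _ measurable_const]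
        refine lintegral_mono fun x => ?_
        by_cases hx : ENNReal.ofReal t < F x
        · rw [indicator_of_mem (by exact hx)]; exact le_self_add
        · exact (not_lt.1 hx).trans le_add_self
      refine ENNReal.le_of_add_le_add_right
        (ENNReal.mul_ne_top ENNReal.ofReal_ne_top (measure_ne_top σ (Q i))) (le_trans ?_ h5)
      rw [← two_mul, ← mul_assoc, mul_comm 2]
      exact h4
    calc _ ≤ ENNReal.ofReal t * (k * σ (⋃ i ∈ A, Q i)) := by gcongr
      _ = k * (ENNReal.ofReal t * σ (⋃ i ∈ A, Q i)) := by ring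
      _ ≤ _ := by gcongr
  have hmi : ∀ i, Measurable fun t : ℝ => {t : ℝ | ENNReal.ofReal t < a i / 2}.indicator
      (fun t => ENNReal.ofReal (p * t ^ (p - 1))) t := fun i =>
    Measurable.indicator (by fun_prop) (measurableSet_lt (by fun_prop) measurable_const)
  have e1 : ∑' i, a i ^ p * σ (E i) = ENNReal.ofReal (2 ^ p) * ∫⁻ t in Ioi (0 : ℝ),
      ENNReal.ofReal (p * t ^ (p - 1)) *
        ∑' i, {i | ENNReal.ofReal t < a i / 2}.indicator (fun i => σ (E i)) i := by
    have h1 : ∀ i, a i ^ p * σ (E i) = ENNReal.ofReal (2 ^ p) * ∫⁻ t in Ioi (0 : ℝ),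
        {t : ℝ | ENNReal.ofReal t < a i / 2}.indicator
          (fun t => ENNReal.ofReal (p * t ^ (p - 1))) t * σ (E i) := by
      intro i
      rw [lintegral_mul_const _ (hmi i), ← rpow_eq_lintegral_layers hp0, ← mul_assoc,
        ← ENNReal.ofReal_rpow_of_pos two_pos, show ENNReal.ofReal 2 = 2 by simp,
        ← ENNReal.mul_rpow_of_nonneg _ _ hp0.le,
        ENNReal.mul_div_cancel two_ne_zero ENNReal.ofNat_ne_top]
    rw [tsum_congr h1, ENNReal.tsum_mul_left, ← lintegral_tsum
      fun i => ((hmi i).mul_const _).aemeasurable]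
    congr 1
    refine lintegral_congr fun t => ?_
    rw [← ENNReal.tsum_mul_left]
    refine tsum_congr fun i => ?_
    by_cases hi : ENNReal.ofReal t < a i / 2
    · rw [indicator_of_mem (by exact hi), indicator_of_mem (by exact hi)]
    · rw [indicator_of_notMem (by exact hi), indicator_of_notMem (by exact hi), zero_mul, mul_zero]
  have hmF : Measurable (Function.uncurry fun (t : ℝ) (x : α) =>
      {t : ℝ | ENNReal.ofReal t < F x}.indicator
        (fun t => ENNReal.ofReal ((p - 1) * t ^ (p - 1 - 1))) t * F x) := by
    refine Measurable.mul ?_ (hF.comp measurable_snd)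
    have : (fun q : ℝ × α => {t : ℝ | ENNReal.ofReal t < F q.2}.indicator
        (fun t => ENNReal.ofReal ((p - 1) * t ^ (p - 1 - 1))) q.1) =
        {q : ℝ × α | ENNReal.ofReal q.1 < F q.2}.indicator
          (fun q => ENNReal.ofReal ((p - 1) * q.1 ^ (p - 1 - 1))) := by
      ext q; rfl
    rw [this]
    exact Measurable.indicator (by fun_prop) (measurableSet_lt (by fun_prop) (by fun_prop))
  rw [e1]
  calc ENNReal.ofReal (2 ^ p) * ∫⁻ t in Ioi (0 : ℝ), ENNReal.ofReal (p * t ^ (p - 1)) *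
        ∑' i, {i | ENNReal.ofReal t < a i / 2}.indicator (fun i => σ (E i)) i
      ≤ ENNReal.ofReal (2 ^ p) * ∫⁻ t in Ioi (0 : ℝ), ENNReal.ofReal (p / (p - 1)) * k *
        ∫⁻ x, {t : ℝ | ENNReal.ofReal t < F x}.indicator
          (fun t => ENNReal.ofReal ((p - 1) * t ^ (p - 1 - 1))) t * F x ∂σ := by
        gcongr 1
        refine setLIntegral_mono' measurableSet_Ioi fun t ht => ?_
        have ht0 : (0 : ℝ) < t := ht
        have hp1 : 0 < p - 1 := by linarith
        have h1 : p * t ^ (p - 1) = p / (p - 1) * ((p - 1) * t ^ (p - 1 - 1)) * t := by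
          rw [Real.rpow_sub_one ht0.ne' (p - 1)]
          field_simp
        rw [h1, ENNReal.ofReal_mul (by positivity), ENNReal.ofReal_mul (by positivity)]
        calc _ = ENNReal.ofReal (p / (p - 1)) * ENNReal.ofReal ((p - 1) * t ^ (p - 1 - 1)) *
              (ENNReal.ofReal t *
                ∑' i, {i | ENNReal.ofReal t < a i / 2}.indicator (fun i => σ (E i)) i) := by ring
          _ ≤ ENNReal.ofReal (p / (p - 1)) * ENNReal.ofReal ((p - 1) * t ^ (p - 1 - 1)) *
              (k * ∫⁻ x, {x | ENNReal.ofReal t < F x}.indicator F x ∂σ) := by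
              gcongr 1; exact hlevel t ht0
          _ = ENNReal.ofReal (p / (p - 1)) * k * (ENNReal.ofReal ((p - 1) * t ^ (p - 1 - 1)) *
              ∫⁻ x, {x | ENNReal.ofReal t < F x}.indicator F x ∂σ) := by ring
          _ = _ := by
              rw [← lintegral_const_mul _ (hF.indicator (measurableSet_lt measurable_const hF))]
              congr 1
              refine lintegral_congr fun x => ?_
              by_cases hx : ENNReal.ofReal t < F x
              · rw [indicator_of_mem (by exact hx), indicator_of_mem (by exact hx)]
              · rw [indicator_of_notMem (by exact hx), indicator_of_notMem (by exact hx), zero_mul,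
                  mul_zero]
    _ = ENNReal.ofReal (2 ^ p) * (ENNReal.ofReal (p / (p - 1)) * k * ∫⁻ x, F x ^ p ∂σ) := by
        have e2 := lintegral_const_mul (μ := volume.restrict (Ioi (0 : ℝ)))
          (ENNReal.ofReal (p / (p - 1)) * k) (hmF.lintegral_prod_right' (ν := σ))
        simp only [Function.uncurry] at e2
        rw [e2, lintegral_lintegral_swap hmF.aemeasurable]
        congr 2
        refine lintegral_congr fun x => ?_
        rw [lintegral_mul_const _ (Measurable.indicator (by fun_prop)
          (measurableSet_lt (by fun_prop) measurable_const)),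
          ← rpow_eq_lintegral_layers (by linarith)]
        nth_rw 2 [← ENNReal.rpow_one (F x)]
        rw [← ENNReal.rpow_add_of_nonneg _ _ (by linarith) zero_le_one, sub_add_cancel]
    _ = _ := by
        rw [ENNReal.ofReal_mul (by positivity)]; ring

lemma ENNReal.tsum_mul_le_Lp_mul_Lq {p q : ℝ} (hpq : p.HolderConjugate q) (f g : ι → ℝ≥0∞) :
    ∑' i, f i * g i ≤ (∑' i, f i ^ p) ^ (1 / p) * (∑' i, g i ^ q) ^ (1 / q) := by
  let _ : MeasurableSpace ι := ⊤
  have := ENNReal.lintegral_mul_le_Lp_mul_Lq (Measure.count : Measure ι) hpq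
    (measurable_from_top (f := f)).aemeasurable (measurable_from_top (f := g)).aemeasurable
  simpa only [lintegral_count, Pi.mul_apply] using this

/-- Here `s, v, m` are the dual, weighted and plain masses of a square, and `s', v', e` those of its
top. Write `sv = (v s^(p-1)) s^(2-p)` and apply the characteristic once. Because `2 - p ≤ 0`,
passing from `s` to the smaller `s'` increases the last factor; the powers of `m` are moved to the
top by `m ≤ ce` and Hölder. The exponents match since `(p-1)/q + 2 - p = 1/p`. -/
lemma weight_product_le {p q : ℝ} (hp : 2 ≤ p) (hpq : p.HolderConjugate q)
    {s v m e s' v' B c : ℝ} (hs : 0 < s) (hm : 0 < m)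
    (hs' : 0 < s') (hv' : 0 < v') (hB0 : 0 ≤ B) (hc : 0 < c)
    (hB : v * s ^ (p - 1) ≤ B * m ^ p) (hme : m ≤ c * e) (hss : s' ≤ s)
    (he' : e ≤ v' ^ (1 / p) * s' ^ (1 / q)) :
    s * v ≤ B * c ^ (p - 1) * (s' ^ (1 / p) * v' ^ (1 / q)) * m := by
  have hp0 : 0 < p := by linarith
  have hq : 1 / q = (p - 1) / p := by
    have := hpq.one_sub_inv
    rw [one_div, ← this]
    field_simp
  have h1 : s * v ≤ B * (m ^ (p - 1) * s ^ (2 - p)) * m := by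
    have e1 : s = s ^ (p - 1) * s ^ (2 - p) := by
      rw [← Real.rpow_add hs]; ring_nf; exact (Real.rpow_one s).symm
    have e2 : m ^ p = m ^ (p - 1) * m := by
      rw [← Real.rpow_add_one hm.ne']; ring_nf
    calc s * v = (v * s ^ (p - 1)) * s ^ (2 - p) := by nth_rw 1 [e1]; ring
      _ ≤ (B * m ^ p) * s ^ (2 - p) := by gcongr
      _ = _ := by rw [e2]; ring
  refine h1.trans ?_
  rw [mul_assoc B (c ^ (p - 1))]
  gcongr B * ?_ * m
  have h2 : m ^ (p - 1) ≤ c ^ (p - 1) * (v' ^ (1 / q) * s' ^ ((p - 1) / q)) := by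
    calc m ^ (p - 1) ≤ (c * (v' ^ (1 / p) * s' ^ (1 / q))) ^ (p - 1) := by
          refine Real.rpow_le_rpow hm.le (hme.trans (by gcongr)) (by linarith)
      _ = _ := by
          rw [Real.mul_rpow hc.le (by positivity), Real.mul_rpow (by positivity) (by positivity),
            ← Real.rpow_mul hv'.le, ← Real.rpow_mul hs'.le, one_div_mul_eq_div,
            one_div_mul_eq_div, ← hq]
  have h3 : s ^ (2 - p) ≤ s' ^ (2 - p) :=
    Real.rpow_le_rpow_of_nonpos hs' hss (by linarith)
  have h4 : s' ^ ((p - 1) / q) * s' ^ (2 - p) = s' ^ (1 / p) := by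
    rw [← Real.rpow_add hs', div_eq_mul_one_div, hq]
    congr 1
    field_simp
    ring
  calc m ^ (p - 1) * s ^ (2 - p)
      ≤ c ^ (p - 1) * (v' ^ (1 / q) * s' ^ ((p - 1) / q)) * s' ^ (2 - p) := by gcongr
    _ = c ^ (p - 1) * (v' ^ (1 / q) * (s' ^ ((p - 1) / q) * s' ^ (2 - p))) := by ring
    _ = _ := by rw [h4]; ring

lemma ENNReal.weight_product_le {p q : ℝ} (hp : 2 ≤ p) (hpq : p.HolderConjugate q)
    {s v m e s' v' B c : ℝ≥0∞} (hs : s ≠ ∞) (hv : v ≠ ∞) (hm0 : m ≠ 0) (hm : m ≠ ∞)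
    (hem : e ≤ m) (hBt : B ≠ ∞) (hct : c ≠ ∞)
    (hB : v * s ^ (p - 1) ≤ B * m ^ p) (hme : m ≤ c * e) (hss : s' ≤ s) (hvv : v' ≤ v)
    (he' : e ≤ v' ^ (1 / p) * s' ^ (1 / q)) :
    s * v / m ≤ B * c ^ (p - 1) * (s' ^ (1 / p) * v' ^ (1 / q)) := by
  have hp0 : 0 < p := by linarith
  have hq0 : 0 < q := hpq.symm.pos
  have hc0 : c ≠ 0 := by rintro rfl; rw [zero_mul] at hme; exact hm0 (le_antisymm hme bot_le)
  have he0 : e ≠ 0 := by rintro rfl; rw [mul_zero] at hme; exact hm0 (le_antisymm hme bot_le)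
  -- A null top for either weight would make `e`, hence `m`, vanish.
  have hs0 : s' ≠ 0 := by
    rintro rfl
    rw [ENNReal.zero_rpow_of_pos (by positivity), mul_zero] at he'
    exact he0 (le_antisymm he' bot_le)
  have hv0 : v' ≠ 0 := by
    rintro rfl
    rw [ENNReal.zero_rpow_of_pos (by positivity), zero_mul] at he'
    exact he0 (le_antisymm he' bot_le)
  have hs't := ne_top_of_le_ne_top hs hss
  have hv't := ne_top_of_le_ne_top hv hvv
  have het := ne_top_of_le_ne_top hm hem
  refine ENNReal.div_le_of_le_mul ?_
  lift s to ℝ≥0 using hs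
  lift v to ℝ≥0 using hv
  lift m to ℝ≥0 using hm
  lift e to ℝ≥0 using het
  lift s' to ℝ≥0 using hs't
  lift v' to ℝ≥0 using hv't
  lift B to ℝ≥0 using hBt
  lift c to ℝ≥0 using hct
  have hp1 : 0 ≤ p - 1 := by linarith
  have hpi : 0 ≤ 1 / p := by positivity
  have hqi : 0 ≤ 1 / q := by positivity
  have hm0' : 0 < m := pos_iff_ne_zero.2 (by exact_mod_cast hm0)
  have hs0' : 0 < s' := pos_iff_ne_zero.2 (by exact_mod_cast hs0)
  have hv0' : 0 < v' := pos_iff_ne_zero.2 (by exact_mod_cast hv0)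
  have hc0' : 0 < c := pos_iff_ne_zero.2 (by exact_mod_cast hc0)
  simp only [← ENNReal.coe_rpow_of_nonneg _ hp1, ← ENNReal.coe_rpow_of_nonneg _ hpi,
    ← ENNReal.coe_rpow_of_nonneg _ hqi, ← ENNReal.coe_rpow_of_nonneg _ hp0.le,
    ← ENNReal.coe_mul, ENNReal.coe_le_coe] at hB hme hss he' ⊢
  have hs1 : 0 < s := hs0'.trans_le hss
  rw [← NNReal.coe_le_coe] at hB hme hss he' ⊢
  push_cast at hB hme hss he' ⊢
  exact BergmanProjection.weight_product_le hp hpq hs1 hm0' hs0' hv0' B.2 hc0' hB hme hss he'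

/-- Bilinear embedding for a laminar family of sets with large disjoint-like parts, with linear
dependence on the characteristic of the pair of weights in the range `p ≥ 2`. -/
lemma IsLaminar.bilinear_le (hQ : IsLaminar Q lev) {μ σ τ : Measure α} [IsFiniteMeasure σ]
    [IsFiniteMeasure τ] (hE : ∀ i, MeasurableSet (E i)) (hEQ : ∀ i, E i ⊆ Q i) {k : ℝ≥0∞}
    (hk : ∀ x, ∑' i, (E i).indicator 1 x ≤ k) {p q : ℝ} (hp : 2 ≤ p) (hpq : p.HolderConjugate q)
    {B c : ℝ≥0∞} (hBt : B ≠ ∞) (hct : c ≠ ∞) (hμ0 : ∀ i, μ (Q i) ≠ 0) (hμ : ∀ i, μ (Q i) ≠ ∞)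
    (hc : ∀ i, μ (Q i) ≤ c * μ (E i))
    (hB : ∀ i, τ (Q i) * σ (Q i) ^ (p - 1) ≤ B * μ (Q i) ^ p)
    (hH : ∀ i, μ (E i) ≤ τ (E i) ^ (1 / p) * σ (E i) ^ (1 / q))
    {F G : α → ℝ≥0∞} (hF : Measurable F) (hG : Measurable G) :
    ∑' i, (∫⁻ x in Q i, F x ∂σ) * (∫⁻ x in Q i, G x ∂τ) / μ (Q i) ≤
      B * (c ^ (p - 1) * ((ENNReal.ofReal (2 ^ p * (p / (p - 1))) * k) ^ (1 / p) *
        (ENNReal.ofReal (2 ^ q * (q / (q - 1))) * k) ^ (1 / q))) *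
      ((∫⁻ x, F x ^ p ∂σ) ^ (1 / p) * (∫⁻ x, G x ^ q ∂τ) ^ (1 / q)) := by
  have hp0 : 0 < p := hpq.pos
  have hq0 : 0 < q := hpq.symm.pos
  set a : ι → ℝ≥0∞ := fun i => (∫⁻ x in Q i, F x ∂σ) / σ (Q i) with ha
  set b : ι → ℝ≥0∞ := fun i => (∫⁻ x in Q i, G x ∂τ) / τ (Q i) with hb
  -- On null sets the average is `0 / 0 = 0`, which is consistent because the integral vanishes too.
  have hav : ∀ (π : Measure α) [IsFiniteMeasure π] (H : α → ℝ≥0∞) (i : ι),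
      ∫⁻ x in Q i, H x ∂π = (∫⁻ x in Q i, H x ∂π) / π (Q i) * π (Q i) := by
    intro π _ H i
    by_cases h0 : π (Q i) = 0
    · rw [setLIntegral_measure_zero _ _ h0, h0, mul_zero]
    · exact (ENNReal.div_mul_cancel h0 (measure_ne_top _ _)).symm
  have hterm : ∀ i, (∫⁻ x in Q i, F x ∂σ) * (∫⁻ x in Q i, G x ∂τ) / μ (Q i) ≤
      B * c ^ (p - 1) * ((a i * σ (E i) ^ (1 / p)) * (b i * τ (E i) ^ (1 / q))) := by
    intro i
    have h1 := ENNReal.weight_product_le hp hpq (measure_ne_top σ (Q i)) (measure_ne_top τ (Q i))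
      (hμ0 i) (hμ i) (measure_mono (hEQ i)) hBt hct (hB i) (hc i) (measure_mono (hEQ i))
      (measure_mono (hEQ i)) (hH i)
    calc (∫⁻ x in Q i, F x ∂σ) * (∫⁻ x in Q i, G x ∂τ) / μ (Q i)
        = a i * b i * (σ (Q i) * τ (Q i) / μ (Q i)) := by
          rw [hav σ F i, hav τ G i, div_eq_mul_inv, div_eq_mul_inv _ (μ (Q i))]
          ring
      _ ≤ a i * b i * (B * c ^ (p - 1) * (σ (E i) ^ (1 / p) * τ (E i) ^ (1 / q))) := by gcongr
      _ = _ := by ring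
  have hcarl : ∀ (π : Measure α) [IsFiniteMeasure π] {H : α → ℝ≥0∞} (_ : Measurable H) {r : ℝ}
      (_ : 1 < r), (∑' i, ((∫⁻ x in Q i, H x ∂π) / π (Q i) * π (E i) ^ (1 / r)) ^ r) ^ (1 / r) ≤
        (ENNReal.ofReal (2 ^ r * (r / (r - 1))) * k) ^ (1 / r) * (∫⁻ x, H x ^ r ∂π) ^ (1 / r) := by
    intro π _ H hH r hr
    have hr0 : 0 < r := by linarith
    rw [← ENNReal.mul_rpow_of_nonneg _ _ (by positivity)]
    refine ENNReal.rpow_le_rpow ?_ (by positivity)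
    refine le_trans (le_of_eq ?_) (hQ.tsum_average_rpow_mul_le hE hEQ hk hr hH)
    refine tsum_congr fun i => ?_
    rw [ENNReal.mul_rpow_of_nonneg _ _ hr0.le, ← ENNReal.rpow_mul, one_div_mul_cancel hr0.ne',
      ENNReal.rpow_one]
  calc _ ≤ ∑' i, B * c ^ (p - 1) * ((a i * σ (E i) ^ (1 / p)) * (b i * τ (E i) ^ (1 / q))) :=
        ENNReal.tsum_le_tsum hterm
    _ = B * c ^ (p - 1) * ∑' i, (a i * σ (E i) ^ (1 / p)) * (b i * τ (E i) ^ (1 / q)) :=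
        ENNReal.tsum_mul_left
    _ ≤ B * c ^ (p - 1) * ((∑' i, (a i * σ (E i) ^ (1 / p)) ^ p) ^ (1 / p) *
          (∑' i, (b i * τ (E i) ^ (1 / q)) ^ q) ^ (1 / q)) := by
        gcongr
        exact ENNReal.tsum_mul_le_Lp_mul_Lq hpq _ _
    _ ≤ B * c ^ (p - 1) * (((ENNReal.ofReal (2 ^ p * (p / (p - 1))) * k) ^ (1 / p) *
          (∫⁻ x, F x ^ p ∂σ) ^ (1 / p)) * ((ENNReal.ofReal (2 ^ q * (q / (q - 1))) * k) ^ (1 / q) *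
          (∫⁻ x, G x ^ q ∂τ) ^ (1 / q))) := by
        gcongr
        · exact hcarl σ hF hpq.lt
        · exact hcarl τ hG hpq.symm.lt
    _ = _ := by ring

end Laminar

/-! ### Two dyadic systems of Carleson squares -/

section Dyadic

/-- A cell of a finer dyadic grid determines the coarser cell containing it; this gives the nesting
of the squares. -/
lemma floor_pow_two_mul_eq_div {j l : ℕ} (hjl : j ≤ l) (x : ℝ) :
    ⌊(2 : ℝ) ^ j * x⌋ = ⌊(2 : ℝ) ^ l * x⌋ / 2 ^ (l - j) := by
  have h1 : (2 : ℝ) ^ j * x = ((2 : ℝ) ^ l * x) / ((2 ^ (l - j) : ℕ) : ℝ) := by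
    have : (2 : ℝ) ^ l = 2 ^ j * 2 ^ (l - j) := by rw [← pow_add]; congr 1; omega
    rw [this]
    push_cast
    field_simp
  rw [h1, Int.floor_div_natCast]
  push_cast
  rfl

/-- Passage from the line to the circle: points in one cell have the same integer part, so they stay
in one cell after reduction modulo `1`. -/
lemma floor_mul_fract_congr {j : ℕ} {x y : ℝ} (h : ⌊(2 : ℝ) ^ j * x⌋ = ⌊(2 : ℝ) ^ j * y⌋) :
    ⌊(2 : ℝ) ^ j * Int.fract x⌋ = ⌊(2 : ℝ) ^ j * Int.fract y⌋ := by
  have key : ∀ t : ℝ, ⌊(2 : ℝ) ^ j * Int.fract t⌋ = ⌊(2 : ℝ) ^ j * t⌋ - 2 ^ j * ⌊t⌋ := by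
    intro t
    rw [← Int.floor_sub_intCast]
    congr 1
    push_cast
    rw [Int.fract]
    ring
  have h0 : ∀ t : ℝ, ⌊t⌋ = ⌊(2 : ℝ) ^ j * t⌋ / 2 ^ j := fun t => by
    simpa using floor_pow_two_mul_eq_div (Nat.zero_le j) t
  rw [key, key, h0 x, h0 y, h]

/-- Two numbers at distance less than `2^{-j}/3` share a cell of one of the dyadic grids of
generation `j` based at `0` and at `1/3`. -/
lemma floor_eq_or_floor_sub_third_eq {j : ℕ} {x y : ℝ} (h : 3 * 2 ^ j * |x - y| < 1) :
    ⌊(2 : ℝ) ^ j * x⌋ = ⌊(2 : ℝ) ^ j * y⌋ ∨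
      ⌊(2 : ℝ) ^ j * (x - 1 / 3)⌋ = ⌊(2 : ℝ) ^ j * (y - 1 / 3)⌋ := by
  wlog hxy : x ≤ y generalizing x y
  · rw [abs_sub_comm] at h
    exact (this h (not_le.1 hxy).le).imp Eq.symm Eq.symm
  by_contra! hne
  rw [abs_of_nonpos (by linarith)] at h
  have p2 : (0 : ℝ) < 2 ^ j := by positivity
  have h1 : ⌊(2 : ℝ) ^ j * x⌋ < ⌊(2 : ℝ) ^ j * y⌋ :=
    lt_of_le_of_ne (Int.floor_le_floor (by gcongr)) hne.1
  have h2 : ⌊(2 : ℝ) ^ j * (x - 1 / 3)⌋ < ⌊(2 : ℝ) ^ j * (y - 1 / 3)⌋ :=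
    lt_of_le_of_ne (Int.floor_le_floor (by gcongr)) hne.2
  set k := ⌊(2 : ℝ) ^ j * y⌋
  set l := ⌊(2 : ℝ) ^ j * (y - 1 / 3)⌋
  have a1 : (2 : ℝ) ^ j * x < k := Int.floor_lt.1 h1
  have a2 : (k : ℝ) ≤ 2 ^ j * y := Int.floor_le _
  have b1 : (2 : ℝ) ^ j * (x - 1 / 3) < l := Int.floor_lt.1 h2
  have b2 : (l : ℝ) ≤ 2 ^ j * (y - 1 / 3) := Int.floor_le _
  -- If both grids separate `x` from `y`, each has an endpoint between them, `k / 2 ^ j` and `l / 2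
  -- ^ j + 1 / 3`. These are less than `2 ^ (-j) / 3` apart, so the integer `3(k - l) - 2 ^ j` is
  -- zero and `3` divides a power of `2`.
  have c1 : (3 * (k - l) - 2 ^ j : ℝ) < 1 := by nlinarith
  have c2 : (-1 : ℝ) < 3 * (k - l) - 2 ^ j := by nlinarith
  have d1 : 3 * (k - l) - 2 ^ j < 1 := by exact_mod_cast c1
  have d2 : -1 < 3 * (k - l) - 2 ^ j := by exact_mod_cast c2
  have d3 : (3 : ℤ) ∣ 2 ^ j := ⟨k - l, by omega⟩
  have := Int.Prime.dvd_pow' Nat.prime_three d3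
  norm_num at this

/-- The Carleson squares over the dyadic arcs of the grid rotated by `2πδ`; the index consists of
the generation `j` and the position in the generation. -/
def dyadicSquare (δ : ℝ) (i : Σ j : ℕ, Fin (2 ^ j)) : Set ℂ :=
  {z | 1 - 1 / 2 ^ i.1 ≤ ‖z‖ ∧ ‖z‖ < 1 ∧
    ⌊2 ^ i.1 * Int.fract (z.arg / (2 * Real.pi) - δ)⌋ = (i.2 : ℤ)}

/-- The part of a dyadic square with radii below `1 - 2^{-j-k}`. -/
def dyadicTop (δ : ℝ) (k : ℕ) (i : Σ j : ℕ, Fin (2 ^ j)) : Set ℂ :=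
  dyadicSquare δ i ∩ {z | ‖z‖ < 1 - 1 / 2 ^ i.1 / 2 ^ k}

variable {δ : ℝ} {k : ℕ}

lemma floor_mul_fract_eq_iff {N m : ℕ} (hm : m < N) (u : ℝ) :
    ⌊(N : ℝ) * Int.fract u⌋ = (m : ℤ) ↔ ∃ n : ℤ, (m : ℝ) ≤ N * (u + n) ∧ N * (u + n) < m + 1 := by
  rw [Int.floor_eq_iff]
  push_cast
  have hN : (0 : ℝ) < N := by exact_mod_cast (Nat.zero_le m).trans_lt hm
  have hmN : (m : ℝ) + 1 ≤ N := by exact_mod_cast hm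
  constructor
  · intro h
    refine ⟨-⌊u⌋, ?_⟩
    push_cast
    rwa [← sub_eq_add_neg]
  · rintro ⟨n, h1, h2⟩
    have : Int.fract u = u + n := by
      refine Int.fract_eq_iff.2 ⟨?_, ?_, -n, by push_cast; ring⟩
      · have : (0 : ℝ) ≤ m := by positivity
        nlinarith
      · nlinarith
    rw [this]
    exact ⟨h1, h2⟩

lemma one_div_two_pow_pos (j : ℕ) : (0 : ℝ) < 1 / 2 ^ j := by positivity

lemma one_div_two_pow_le_one (j : ℕ) : (1 : ℝ) / 2 ^ j ≤ 1 :=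
  div_le_one_of_le₀ (one_le_pow₀ (by norm_num)) (by positivity)

lemma dyadicSquare_eq (i : Σ j : ℕ, Fin (2 ^ j)) : dyadicSquare δ i =
    polarSector (1 - 1 / 2 ^ i.1) 1 (2 * Real.pi * ((i.2 : ℕ) / 2 ^ i.1 + δ)) (1 / 2 ^ i.1) := by
  obtain ⟨j, m, hm⟩ := i
  ext z
  simp only [dyadicSquare, polarSector, mem_ofPred_eq, and_congr_right_iff]
  intro _ _
  have h1 := floor_mul_fract_eq_iff hm (z.arg / (2 * Real.pi) - δ)
  push_cast at h1
  rw [h1]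
  have p2 : (0 : ℝ) < 2 ^ j := by positivity
  have hpi := Real.two_pi_pos
  refine exists_congr fun n => ?_
  set θ := z.arg
  have e1 : θ + 2 * Real.pi * n - 2 * Real.pi * (m / 2 ^ j + δ) =
      2 * Real.pi / 2 ^ j * (2 ^ j * (θ / (2 * Real.pi) - δ + n) - m) := by
    field_simp
    ring
  have e2 : 2 * Real.pi * (m / 2 ^ j + δ) + 2 * Real.pi * (1 / 2 ^ j) - (θ + 2 * Real.pi * n) =
      2 * Real.pi / 2 ^ j * (m + 1 - 2 ^ j * (θ / (2 * Real.pi) - δ + n)) := by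
    field_simp
    ring
  have hc : 0 < 2 * Real.pi / 2 ^ j := by positivity
  refine and_congr ?_ ?_
  · rw [← sub_nonneg, ← sub_nonneg (b := 2 * Real.pi * _), e1, mul_nonneg_iff_of_pos_left hc]
  · rw [← sub_pos, ← sub_pos (b := θ + _), e2, mul_pos_iff_of_pos_left hc]

lemma dyadicSquare_eq_carlesonSquare (i : Σ j : ℕ, Fin (2 ^ j)) : dyadicSquare δ i =
    carlesonSquare (2 * Real.pi * ((i.2 : ℕ) / 2 ^ i.1 + δ)) (1 / 2 ^ i.1) := by
  rw [dyadicSquare_eq, carlesonSquare_eq (one_div_two_pow_le_one _)]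

lemma dyadicTop_eq (i : Σ j : ℕ, Fin (2 ^ j)) : dyadicTop δ k i =
    polarSector (1 - 1 / 2 ^ i.1) (1 - 1 / 2 ^ i.1 / 2 ^ k)
      (2 * Real.pi * ((i.2 : ℕ) / 2 ^ i.1 + δ)) (1 / 2 ^ i.1) := by
  rw [dyadicTop, dyadicSquare_eq]
  ext z
  simp only [polarSector, mem_inter_iff, mem_ofPred_eq]
  have h1 : 1 - 1 / 2 ^ i.1 / 2 ^ k ≤ (1 : ℝ) := by
    have : (0 : ℝ) ≤ 1 / 2 ^ i.1 / 2 ^ k := by positivity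
    linarith
  constructor
  · rintro ⟨⟨a, b, c⟩, d⟩
    exact ⟨a, d, c⟩
  · rintro ⟨a, d, c⟩
    exact ⟨⟨a, d.trans_le h1, c⟩, d⟩

lemma measurableSet_dyadicTop (i : Σ j : ℕ, Fin (2 ^ j)) : MeasurableSet (dyadicTop δ k i) :=
  dyadicTop_eq i ▸ measurableSet_polarSector

lemma isLaminar_dyadicSquare : IsLaminar (dyadicSquare δ) Sigma.fst where
  measurable i := dyadicSquare_eq i ▸ measurableSet_polarSector
  nested := by
    intro i l hil
    by_cases h : ∃ z, z ∈ dyadicSquare δ i ∧ z ∈ dyadicSquare δ l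
    · left
      obtain ⟨z, ⟨h1, h2, h3⟩, h4, h5, h6⟩ := h
      intro y hy
      obtain ⟨h7, h8, h9⟩ := hy
      refine ⟨le_trans ?_ h7, h8, ?_⟩
      · have : (1 : ℝ) / 2 ^ l.1 ≤ 1 / 2 ^ i.1 :=
          one_div_le_one_div_of_le (by positivity) (pow_le_pow_right₀ (by norm_num) hil)
        linarith
      · rw [floor_pow_two_mul_eq_div hil, h9, ← h3, floor_pow_two_mul_eq_div hil, h6]
    · right
      rw [Set.disjoint_left]
      exact fun z h1 h2 => h ⟨z, h1, h2⟩
  disjoint := by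
    rintro ⟨j, m⟩ ⟨j', m'⟩ hne rfl
    rw [Set.disjoint_left]
    rintro z ⟨-, -, h1⟩ ⟨-, -, h2⟩
    apply hne
    simp only at h1 h2
    rw [h1] at h2
    congr 1
    exact Fin.ext (by exact_mod_cast h2)

/-- A point lies in a top of generation `j` only if `2 ^ (-j-k) < 1 - |z| ≤ 2 ^ (-j)`. This allows
at most `k` consecutive generations, and in each of them the squares are disjoint. -/
lemma tsum_indicator_dyadicTop_le (z : ℂ) :
    ∑' i, (dyadicTop δ k i).indicator (1 : ℂ → ℝ≥0∞) z ≤ k := by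
  set J : Set ℕ := {j | ∃ m, z ∈ dyadicTop δ k ⟨j, m⟩} with hJ
  have h1 : ∑' i, (dyadicTop δ k i).indicator (1 : ℂ → ℝ≥0∞) z ≤
      ∑' j, J.indicator (1 : ℕ → ℝ≥0∞) j := by
    rw [ENNReal.tsum_sigma']
    refine ENNReal.tsum_le_tsum fun j => ?_
    by_cases hj : ∃ m, z ∈ dyadicTop δ k ⟨j, m⟩
    · rw [indicator_of_mem (show j ∈ J from hj)]
      obtain ⟨m, hm⟩ := hj
      rw [tsum_eq_single m, indicator_of_mem hm]
      · exact le_rfl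
      · intro m' hm'
        rw [indicator_of_notMem]
        intro h
        exact Set.disjoint_left.1 (isLaminar_dyadicSquare.disjoint ⟨j, m'⟩ ⟨j, m⟩
          (by simpa using hm') rfl) h.1 hm.1
    · rw [tsum_congr fun m => indicator_of_notMem (fun h => hj ⟨m, h⟩) _]
      simp
  refine h1.trans ?_
  rcases J.eq_empty_or_nonempty with h | h
  · simp [h]
  classical
  set j₀ := Nat.find h with hj₀
  have h2 : J ⊆ (Finset.Ico j₀ (j₀ + k) : Set ℕ) := by
    intro j hj
    have h3 : j₀ ≤ j := Nat.find_min' h hj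
    obtain ⟨m, ⟨h4, -, -⟩, -⟩ := hj
    obtain ⟨m', -, h5⟩ := Nat.find_spec h
    simp only [mem_ofPred_eq, ← hj₀] at h4 h5
    have h6 : (1 : ℝ) / 2 ^ (j₀ + k) < 1 / 2 ^ j := by
      rw [pow_add, ← div_div]; linarith
    have h7 : (2 : ℝ) ^ j < 2 ^ (j₀ + k) :=
      (one_div_lt_one_div (by positivity) (by positivity)).1 h6
    have := (pow_lt_pow_iff_right₀ (one_lt_two : (1 : ℝ) < 2)).1 h7
    simp [h3, this]
  calc ∑' j, J.indicator (1 : ℕ → ℝ≥0∞) j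
      ≤ ∑' j, (Finset.Ico j₀ (j₀ + k) : Set ℕ).indicator (1 : ℕ → ℝ≥0∞) j :=
        ENNReal.tsum_le_tsum fun j => indicator_le_indicator_of_subset h2 (by simp) j
    _ = ∑ j ∈ Finset.Ico j₀ (j₀ + k), 1 := by
        rw [tsum_eq_sum (s := Finset.Ico j₀ (j₀ + k))]
        · exact Finset.sum_congr rfl fun j hj => indicator_of_mem (by exact_mod_cast hj) _
        · intro j hj
          exact indicator_of_notMem (by exact_mod_cast hj) _
    _ = k := by simp

lemma exists_mem_dyadicSquare {j : ℕ} {z ζ : ℂ} (hz : z ∈ ball (0 : ℂ) 1) (hζ : ζ ∈ ball (0 : ℂ) 1)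
    (hz1 : 1 - 1 / 2 ^ j ≤ ‖z‖) (hζ1 : 1 - 1 / 2 ^ j ≤ ‖ζ‖)
    (h : ⌊(2 : ℝ) ^ j * Int.fract (z.arg / (2 * Real.pi) - δ)⌋ =
      ⌊(2 : ℝ) ^ j * Int.fract (ζ.arg / (2 * Real.pi) - δ)⌋) :
    ∃ m : Fin (2 ^ j), z ∈ dyadicSquare δ ⟨j, m⟩ ∧ ζ ∈ dyadicSquare δ ⟨j, m⟩ := by
  set n := ⌊(2 : ℝ) ^ j * Int.fract (z.arg / (2 * Real.pi) - δ)⌋ with hn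
  have p2 : (0 : ℝ) < 2 ^ j := by positivity
  have h0 : 0 ≤ n := Int.floor_nonneg.2 (mul_nonneg p2.le (Int.fract_nonneg _))
  have h1 : n < 2 ^ j := by
    have : (2 : ℝ) ^ j * Int.fract (z.arg / (2 * Real.pi) - δ) < 2 ^ j := by
      nlinarith [Int.fract_lt_one (z.arg / (2 * Real.pi) - δ)]
    exact Int.floor_lt.2 (by exact_mod_cast this)
  obtain ⟨m, hm⟩ := Int.eq_ofNat_of_zero_le h0
  have hm2 : m < 2 ^ j := by rw [hm] at h1; exact_mod_cast h1
  exact ⟨⟨m, hm2⟩, ⟨hz1, by simpa using hz, hm⟩, hζ1, by simpa using hζ, h ▸ hm⟩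

/-- Any two points `z, ζ` of the disc lie in a common dyadic square, of side length at most
`4 |1 - z̄ζ|`, of one of two systems. -/
lemma exists_common_dyadicSquare {z ζ : ℂ} (hz : z ∈ ball (0 : ℂ) 1) (hζ : ζ ∈ ball (0 : ℂ) 1) :
    ∃ i : Σ j : ℕ, Fin (2 ^ j), 1 / 2 ^ i.1 ≤ 4 * ‖1 - conj z * ζ‖ ∧
      ((z ∈ dyadicSquare 0 i ∧ ζ ∈ dyadicSquare 0 i) ∨
        (z ∈ dyadicSquare (1 / 3) i ∧ ζ ∈ dyadicSquare (1 / 3) i)) := by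
  set h := ‖1 - conj z * ζ‖ with hh
  have hz' : ‖z‖ < 1 := by simpa using hz
  have hζ' : ‖ζ‖ < 1 := by simpa using hζ
  -- When `h ≥ 1/4` the whole disc, generation `0`, is a square of admissible size.
  rcases le_total (1 / 4) h with h4 | h4
  · have hfl : ∀ x : ℝ, ⌊(2 : ℝ) ^ 0 * Int.fract x⌋ = 0 := fun x => by simp
    obtain ⟨m, hm⟩ := exists_mem_dyadicSquare (j := 0) (δ := 0) hz hζ (by simp) (by simp)
      (by rw [hfl, hfl])
    exact ⟨⟨0, m⟩, by simp only [pow_zero]; linarith, Or.inl hm⟩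
  · have hprod : 1 - ‖z‖ * ‖ζ‖ ≤ h := by
      have := norm_sub_norm_le 1 (conj z * ζ)
      rwa [norm_one, norm_mul, Complex.norm_conj] at this
    have h0 : 0 < h := by nlinarith [norm_nonneg z, norm_nonneg ζ]
    -- The generation satisfies `2h ≤ 2 ^ (-j) < 4h`. Both radii exceed `1 - h` or equal it, and the
    -- angular distance in turns is at most `h / 2 ≤ 2 ^ (-j) / 4`, below the threshold `2 ^ (-j) /
    -- 3` of the two grids.
    obtain ⟨j, hj1, hj2⟩ := exists_nat_pow_near_of_lt_one (x := 2 * h) (y := 1 / 2)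
      (by positivity) (by linarith) (by norm_num) (by norm_num)
    rw [div_pow, one_pow] at hj1 hj2
    rw [pow_succ, ← div_div] at hj1
    obtain ⟨n, hn1, hn2⟩ := exists_int_shift_mem_Ico (ζ.arg - z.arg) (-Real.pi)
    set ψ := ζ.arg - z.arg + 2 * Real.pi * n with hψ
    have hw : conj z * ζ = ((‖z‖ * ‖ζ‖ : ℝ) : ℂ) * Complex.exp (ψ * Complex.I) := by
      have e1 : conj z = (‖z‖ : ℂ) * Complex.exp (((-z.arg : ℝ) : ℂ) * Complex.I) := by
        conv_lhs => rw [← Complex.norm_mul_exp_arg_mul_I z]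
        rw [map_mul, Complex.conj_ofReal, ← Complex.exp_conj, map_mul, Complex.conj_ofReal,
          Complex.conj_I]
        push_cast
        ring_nf
      conv_lhs => rw [e1, eq_polar_arg ζ n]
      rw [mul_mul_mul_comm, ← Complex.exp_add, hψ]
      push_cast
      ring_nf
    have hψ1 : |ψ| ≤ Real.pi * h := by
      rw [hh, hw]
      refine abs_le_pi_mul_norm_one_sub_polar (by positivity)
        (by nlinarith [norm_nonneg z, norm_nonneg ζ]) (abs_le.2 ⟨hn1, by linarith⟩)
    have hz1 : 1 - 1 / 2 ^ j ≤ ‖z‖ := by nlinarith [norm_nonneg z, norm_nonneg ζ]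
    have hζ1 : 1 - 1 / 2 ^ j ≤ ‖ζ‖ := by nlinarith [norm_nonneg z, norm_nonneg ζ]
    have hclose : 3 * 2 ^ j * |z.arg / (2 * Real.pi) - (ζ.arg / (2 * Real.pi) + n)| < 1 := by
      have e1 : z.arg / (2 * Real.pi) - (ζ.arg / (2 * Real.pi) + n) = -(ψ / (2 * Real.pi)) := by
        rw [hψ]
        have := Real.pi_ne_zero
        field_simp
        ring
      have e2 : |ψ| / (2 * Real.pi) ≤ h / 2 := by
        rw [div_le_iff₀ Real.two_pi_pos]
        linarith
      have p2 : (0 : ℝ) < 2 ^ j := by positivity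
      rw [le_div_iff₀ p2] at hj2
      rw [e1, abs_neg, abs_div, abs_of_pos Real.two_pi_pos]
      nlinarith
    have hfr : ∀ δ : ℝ, Int.fract (ζ.arg / (2 * Real.pi) + n - δ) =
        Int.fract (ζ.arg / (2 * Real.pi) - δ) := fun δ => by
      rw [show ζ.arg / (2 * Real.pi) + n - δ = ζ.arg / (2 * Real.pi) - δ + n by ring,
        Int.fract_add_intCast]
    have hj4 : 1 / 2 ^ j ≤ 4 * h := by linarith
    rcases floor_eq_or_floor_sub_third_eq hclose with h5 | h5
    · have h6 := floor_mul_fract_congr (x := z.arg / (2 * Real.pi) - 0)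
        (y := ζ.arg / (2 * Real.pi) + n - 0) (by simpa using h5)
      rw [hfr] at h6
      obtain ⟨m, hm⟩ := exists_mem_dyadicSquare hz hζ hz1 hζ1 h6
      exact ⟨⟨j, m⟩, hj4, Or.inl hm⟩
    · have h6 := floor_mul_fract_congr h5
      rw [hfr] at h6
      obtain ⟨m, hm⟩ := exists_mem_dyadicSquare hz hζ hz1 hζ1 h6
      exact ⟨⟨j, m⟩, hj4, Or.inr hm⟩

variable {ω ν : Measure ℝ} {γ : ℝ}

lemma diskMeasure_dyadicSquare [IsFiniteMeasure ω] (hω : ω (Ico 0 1)ᶜ = 0)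
    (i : Σ j : ℕ, Fin (2 ^ j)) :
    diskMeasure ω (dyadicSquare δ i) = ENNReal.ofReal (squareMass ω (1 / 2 ^ i.1)) := by
  rw [dyadicSquare_eq_carlesonSquare, diskMeasure_carlesonSquare_eq_ofReal hω
    (one_div_two_pow_pos _).le (one_div_two_pow_le_one _)]

lemma diskMeasure_dyadicSquare_le [IsFiniteMeasure ω] (hω : ω (Ico 0 1)ᶜ = 0)
    (hk : ∀ h : ℝ, 0 < h → h ≤ 1 →
      radialMass ω (1 - h / 2 ^ k) 1 ≤ 1 / 2 * radialMass ω (1 - h) 1)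
    (i : Σ j : ℕ, Fin (2 ^ j)) :
    diskMeasure ω (dyadicSquare δ i) ≤ 2 * diskMeasure ω (dyadicTop δ k i) := by
  set h : ℝ := 1 / 2 ^ i.1 with hh
  have h0 : 0 < h := one_div_two_pow_pos _
  have h1 : h ≤ 1 := one_div_two_pow_le_one _
  rw [dyadicSquare_eq, dyadicTop_eq, diskMeasure_polarSector hω h1,
    diskMeasure_polarSector hω h1, mul_left_comm]
  gcongr
  have hd : h / 2 ^ k ≤ h := div_le_self h0.le (one_le_pow₀ (by norm_num))
  have hd0 : 0 < h / 2 ^ k := by positivity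
  have hsplit : radialMass ω (1 - h) 1 =
      radialMass ω (1 - h) (1 - h / 2 ^ k) + radialMass ω (1 - h / 2 ^ k) 1 := by
    rw [radialMass, radialMass, radialMass, ← lintegral_union measurableSet_Ico,
      Ico_union_Ico_eq_Ico (by linarith) (by linarith)]
    exact Ico_disjoint_Ico_same
  have hfin : radialMass ω (1 - h) 1 ≠ ∞ :=
    ((radialMass_le_measure le_rfl).trans_lt (measure_lt_top _ _)).ne
  set A := radialMass ω (1 - h) 1
  have h2 : A ≤ radialMass ω (1 - h) (1 - h / 2 ^ k) + 1 / 2 * A := by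
    conv_lhs => rw [hsplit]
    gcongr
    exact hk h h0 h1
  have h3 : A = 1 / 2 * A + 1 / 2 * A := by
    rw [← add_mul, ENNReal.add_halves, one_mul]
  have h4 : 1 / 2 * A ≤ radialMass ω (1 - h) (1 - h / 2 ^ k) := by
    refine ENNReal.le_of_add_le_add_right (a := 1 / 2 * A) ?_ ?_
    · exact ENNReal.mul_ne_top (by simp) hfin
    · rwa [← h3]
  rw [h3, two_mul]
  exact add_le_add h4 h4

/-- The positive dyadic kernel. -/
noncomputable def dyadicKernel (ω : Measure ℝ) (δ : ℝ) (z ζ : ℂ) : ℝ≥0∞ :=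
  ∑' i, (dyadicSquare δ i).indicator 1 z * (dyadicSquare δ i).indicator 1 ζ /
    diskMeasure ω (dyadicSquare δ i)

/-- The kernel at `z̄ζ` is at most a multiple of `1 / μ(Q)` for the common dyadic square `Q` of `z`
and `ζ`, and this is a single term of one of the dyadic kernels. The constant `4 ^ γ * 9` is `A ^ γ
* (2A + 1)` at `A = 4`. -/
lemma exists_enorm_reprKernel_le (hω : IsRegular ω) (hγ : 1 ≤ γ)
    (hrep : HasKernelRepresentation ω γ ν) :
    ∃ C : ℝ≥0, ∀ z ∈ ball (0 : ℂ) 1, ∀ ζ ∈ ball (0 : ℂ) 1, ‖reprKernel γ ν (conj z * ζ)‖ₑ ≤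
      C * (dyadicKernel ω 0 z ζ + dyadicKernel ω (1 / 3) z ζ) := by
  have := hω.finite
  have := hrep.1
  obtain ⟨C, hC, H⟩ := exists_diagKernel_mul_squareMass_le hω hγ hrep
  refine ⟨Real.toNNReal (4 ^ γ * 9 * C), fun z hz ζ hζ => ?_⟩
  obtain ⟨i, hi, hmem⟩ := exists_common_dyadicSquare hz hζ
  set h : ℝ := 1 / 2 ^ i.1 with hh
  have h0 : 0 < h := one_div_two_pow_pos _
  have h1 : h ≤ 1 := one_div_two_pow_le_one _
  have hM := hω.squareMass_pos h0 h1
  have hw : ‖conj z * ζ‖ < 1 := by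
    rw [norm_mul, Complex.norm_conj]
    rw [mem_ball_zero_iff] at hz hζ
    nlinarith [norm_nonneg z, norm_nonneg ζ]
  have e1 : ‖reprKernel γ ν (conj z * ζ)‖ ≤ 4 ^ γ * 9 * C / squareMass ω h := by
    refine (norm_reprKernel_le_diagKernel (by linarith) hrep.2.1 h0 h1 four_pos hw hi).trans ?_
    rw [le_div_iff₀ hM, mul_assoc, show (2 * 4 + 1 : ℝ) = 9 by norm_num]
    gcongr
    exact H h h0 h1
  have e2 : ∀ δ, z ∈ dyadicSquare δ i → ζ ∈ dyadicSquare δ i →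
      (ENNReal.ofReal (squareMass ω h))⁻¹ ≤ dyadicKernel ω δ z ζ := by
    intro δ hzi hζi
    refine le_trans (le_of_eq ?_) (ENNReal.le_tsum i)
    rw [indicator_of_mem hzi, indicator_of_mem hζi, diskMeasure_dyadicSquare hω.support, ← hh,
      Pi.one_apply, Pi.one_apply, mul_one, one_div]
  calc ‖reprKernel γ ν (conj z * ζ)‖ₑ = ENNReal.ofReal ‖reprKernel γ ν (conj z * ζ)‖ :=
        (ofReal_norm _).symm
    _ ≤ ENNReal.ofReal (4 ^ γ * 9 * C / squareMass ω h) := ENNReal.ofReal_le_ofReal e1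
    _ = ENNReal.ofReal (4 ^ γ * 9 * C) * (ENNReal.ofReal (squareMass ω h))⁻¹ := by
        rw [ENNReal.ofReal_div_of_pos hM, div_eq_mul_inv]
    _ ≤ _ := by
        refine mul_le_mul_right ?_ _
        rcases hmem with hm | hm
        · exact (e2 0 hm.1 hm.2).trans le_self_add
        · exact (e2 _ hm.1 hm.2).trans le_add_self

end Dyadic

/-! ### Sharp weighted estimates for the positive dyadic kernel -/

section Weighted

/-- An `L^p` bound from duality with `L^q`, for a finite measure. -/
lemma lintegral_rpow_le_of_forall_lintegral_mul_le {α : Type*} [MeasurableSpace α] {τ : Measure α}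
    [IsFiniteMeasure τ] {p q : ℝ} (hpq : p.HolderConjugate q) {f : α → ℝ≥0∞} (hf : Measurable f)
    {A : ℝ≥0∞} (hA : ∀ g : α → ℝ≥0∞, Measurable g →
      ∫⁻ x, f x * g x ∂τ ≤ A * (∫⁻ x, g x ^ q ∂τ) ^ (1 / q)) :
    (∫⁻ x, f x ^ p ∂τ) ^ (1 / p) ≤ A := by
  have hp0 : 0 < p := hpq.pos
  have hq0 : 0 < q := hpq.symm.pos
  have hp1 : 0 < p - 1 := hpq.sub_one_pos
  -- Truncation makes `X` finite, so that testing with `g = min f n ^ (p - 1)` gives `X ≤ A X ^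
  -- (1/q)` and the factor `X ^ (1/q)` can be cancelled.
  have htr : ∀ n : ℕ, (∫⁻ x, (min (f x) n) ^ p ∂τ) ^ (1 / p) ≤ A := by
    intro n
    set X := ∫⁻ x, (min (f x) n) ^ p ∂τ with hX
    have hXt : X ≠ ∞ := by
      refine ne_of_lt (lt_of_le_of_lt (b := ∫⁻ _, (n : ℝ≥0∞) ^ p ∂τ) ?_ ?_)
      · exact lintegral_mono fun x => ENNReal.rpow_le_rpow (min_le_right _ _) hp0.le
      · rw [lintegral_const]
        exact ENNReal.mul_lt_top (ENNReal.rpow_lt_top_of_nonneg hp0.le (by simp))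
          (measure_lt_top _ _)
    have h1 : X ≤ A * X ^ (1 / q) := by
      have h2 := hA (fun x => (min (f x) n) ^ (p - 1)) (by fun_prop)
      have h3 : ∀ x, ((min (f x) n) ^ (p - 1)) ^ q = (min (f x) n) ^ p := fun x => by
        rw [← ENNReal.rpow_mul]
        congr 1
        exact hpq.sub_one_mul_conj
      simp only [h3] at h2
      refine le_trans (lintegral_mono fun x => ?_) h2
      calc (min (f x) n) ^ p = (min (f x) n) ^ (1 + (p - 1)) := by ring_nf
        _ = (min (f x) n) * (min (f x) n) ^ (p - 1) := by
            rw [ENNReal.rpow_add_of_nonneg _ _ zero_le_one hp1.le, ENNReal.rpow_one]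
        _ ≤ _ := by gcongr; exact min_le_left _ _
    rcases eq_or_ne X 0 with h0 | h0
    · rw [h0, ENNReal.zero_rpow_of_pos (by positivity)]; exact bot_le
    have h4 : X = X ^ (1 / p) * X ^ (1 / q) := by
      rw [← ENNReal.rpow_add _ _ h0 hXt, one_div, one_div, hpq.inv_add_inv_eq_one, ENNReal.rpow_one]
    have h5 : X ^ (1 / q) ≠ 0 := by simp [h0, hXt]
    have h6 : X ^ (1 / q) ≠ ∞ := ENNReal.rpow_ne_top_of_nonneg (by positivity) hXt
    rw [h4, ← h4] at h1
    exact (ENNReal.mul_le_mul_iff_left h5 h6).1 (h4 ▸ h1)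
  have hsup : ∫⁻ x, f x ^ p ∂τ = ⨆ n : ℕ, ∫⁻ x, (min (f x) n) ^ p ∂τ := by
    rw [← lintegral_iSup (fun n => by fun_prop)]
    · refine lintegral_congr fun x => ?_
      have h1 : f x = ⨆ n : ℕ, min (f x) n := by
        rw [← inf_iSup_eq, ENNReal.iSup_natCast, inf_top_eq]
      conv_lhs => rw [h1]
      exact (ENNReal.orderIsoRpow p hp0).map_iSup _
    · intro m n hmn x
      refine ENNReal.rpow_le_rpow (min_le_min_left _ ?_) hp0.le
      exact_mod_cast hmn
  rw [one_div, ENNReal.rpow_inv_le_iff hp0, hsup]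
  refine iSup_le fun n => ?_
  rw [← ENNReal.rpow_inv_le_iff hp0, ← one_div]
  exact htr n

variable {ω ν : Measure ℝ} {γ p q : ℝ} {w : ℂ → ℝ≥0∞}

lemma weight_rpow_mul_dual (hpq : p.HolderConjugate q) (x : ℝ≥0∞) :
    (x ^ (1 - q)) ^ (1 - p) = x := by
  rw [← ENNReal.rpow_mul, show (1 - q) * (1 - p) = 1 by nlinarith [hpq.mul_eq_add],
    ENNReal.rpow_one]

/-- Hölder's inequality for `1 = w ^ (1/p) * (w ^ (1-q)) ^ (1/q)`. -/
lemma measure_le_weight_mul_dual {α : Type*} [MeasurableSpace α] (μ : Measure α)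
    (hpq : p.HolderConjugate q) {w : α → ℝ≥0∞} (hw : Measurable w)
    (hw0 : ∀ x, w x ≠ 0) (hwt : ∀ x, w x ≠ ∞) {E : Set α} (hE : MeasurableSet E) :
    μ E ≤ μ.withDensity w E ^ (1 / p) * μ.withDensity (fun x => w x ^ (1 - q)) E ^ (1 / q) := by
  have hp0 : 0 < p := hpq.pos
  have hq0 : 0 < q := hpq.symm.pos
  have h1 := ENNReal.lintegral_mul_le_Lp_mul_Lq (μ.restrict E) hpq
    (f := fun x => w x ^ (1 / p)) (g := fun x => (w x ^ (1 - q)) ^ (1 / q))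
    (by fun_prop) (by fun_prop)
  rw [withDensity_apply _ hE, withDensity_apply _ hE]
  have h2 : ∀ x, (w x ^ (1 / p)) ^ p = w x := fun x => by
    rw [← ENNReal.rpow_mul, one_div_mul_cancel hp0.ne', ENNReal.rpow_one]
  have h3 : ∀ x, ((w x ^ (1 - q)) ^ (1 / q)) ^ q = w x ^ (1 - q) := fun x => by
    rw [← ENNReal.rpow_mul, one_div_mul_cancel hq0.ne', ENNReal.rpow_one]
  have h4 : ∀ x, ((fun x => w x ^ (1 / p)) * fun x => (w x ^ (1 - q)) ^ (1 / q)) x = 1 := fun x => by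
    simp only [Pi.mul_apply]
    rw [← ENNReal.rpow_mul, ← ENNReal.rpow_add _ _ (hw0 x) (hwt x)]
    have : 1 / p + (1 - q) * (1 / q) = 0 := by
      have := hpq.inv_add_inv_eq_one
      rw [one_div, one_div, sub_mul, mul_inv_cancel₀ hq0.ne']
      linarith
    rw [this, ENNReal.rpow_zero]
  simp only [h2, h3, h4, setLIntegral_one] at h1
  exact h1

lemma measurable_dyadicKernel (δ : ℝ) :
    Measurable fun q : ℂ × ℂ => dyadicKernel ω δ q.1 q.2 := by
  refine Measurable.tsum fun i => ?_
  have hQm := isLaminar_dyadicSquare.measurable (Q := dyadicSquare δ) i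
  exact (((measurable_one.indicator hQm).comp measurable_fst).mul
    ((measurable_one.indicator hQm).comp measurable_snd)).div_const _

lemma measurable_lintegral_dyadicKernel [IsFiniteMeasure ω] (δ : ℝ) {φ : ℂ → ℝ≥0∞}
    (hφ : Measurable φ) :
    Measurable fun z => ∫⁻ ζ, φ ζ * dyadicKernel ω δ z ζ ∂(diskMeasure ω) :=
  Measurable.lintegral_prod_right' (f := fun q : ℂ × ℂ => φ q.2 * dyadicKernel ω δ q.1 q.2)
    ((hφ.comp measurable_snd).mul (measurable_dyadicKernel δ))

/-- The bilinear form of the positive dyadic kernel. -/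
lemma lintegral_dyadicKernel [IsFiniteMeasure ω] (δ : ℝ) {φ g : ℂ → ℝ≥0∞} (hφ : Measurable φ)
    (hg : Measurable g) :
    ∫⁻ z, (∫⁻ ζ, φ ζ * dyadicKernel ω δ z ζ ∂(diskMeasure ω)) * g z ∂(diskMeasure ω) =
      ∑' i, (∫⁻ ζ in dyadicSquare δ i, φ ζ ∂(diskMeasure ω)) *
        (∫⁻ z in dyadicSquare δ i, g z ∂(diskMeasure ω)) / diskMeasure ω (dyadicSquare δ i) := by
  have hm : ∀ i, MeasurableSet (dyadicSquare δ i) := isLaminar_dyadicSquare.measurable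
  have h1 : ∀ z, ∫⁻ ζ, φ ζ * dyadicKernel ω δ z ζ ∂(diskMeasure ω) =
      ∑' i, (dyadicSquare δ i).indicator 1 z * (∫⁻ ζ in dyadicSquare δ i, φ ζ ∂(diskMeasure ω)) /
        diskMeasure ω (dyadicSquare δ i) := by
    intro z
    simp only [dyadicKernel, ← ENNReal.tsum_mul_left]
    rw [lintegral_tsum fun i => by exact (hφ.mul ((measurable_const.mul
      (measurable_one.indicator (hm i))).div_const _)).aemeasurable]
    refine tsum_congr fun i => ?_
    rw [← lintegral_indicator (hm i)]
    have h2 : ∀ ζ, φ ζ * ((dyadicSquare δ i).indicator 1 z * (dyadicSquare δ i).indicator 1 ζ /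
        diskMeasure ω (dyadicSquare δ i)) = (dyadicSquare δ i).indicator 1 z *
        (diskMeasure ω (dyadicSquare δ i))⁻¹ * (dyadicSquare δ i).indicator φ ζ := by
      intro ζ
      by_cases hζ : ζ ∈ dyadicSquare δ i
      · simp only [indicator_of_mem hζ, div_eq_mul_inv, Pi.one_apply]; ring
      · simp [indicator_of_notMem hζ]
    simp only [h2]
    rw [lintegral_const_mul _ (hφ.indicator (hm i)), div_eq_mul_inv]
    ring
  simp only [h1, ← ENNReal.tsum_mul_right]
  rw [lintegral_tsum fun i => by exact (((measurable_one.indicator (hm i)).mul_const _).div_const _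
    |>.mul hg).aemeasurable]
  refine tsum_congr fun i => ?_
  rw [← lintegral_indicator (hm i) g]
  have h2 : ∀ z, (dyadicSquare δ i).indicator 1 z *
      (∫⁻ ζ in dyadicSquare δ i, φ ζ ∂(diskMeasure ω)) / diskMeasure ω (dyadicSquare δ i) * g z =
      (∫⁻ ζ in dyadicSquare δ i, φ ζ ∂(diskMeasure ω)) / diskMeasure ω (dyadicSquare δ i) *
        (dyadicSquare δ i).indicator g z := by
    intro z
    by_cases hz : z ∈ dyadicSquare δ i
    · simp only [indicator_of_mem hz, Pi.one_apply]; ring_nf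
    · simp [indicator_of_notMem hz]
  simp only [h2]
  rw [lintegral_const_mul _ (hg.indicator (hm i)), div_eq_mul_inv, div_eq_mul_inv]
  ring

/-- Sharp weighted bound for the bilinear form of the dyadic kernel. -/
lemma IsRegular.exists_dyadicKernel_form_le (hω : IsRegular ω) (hpq : p.HolderConjugate q) :
    ∃ K : ℝ≥0∞, K ≠ ∞ ∧ ∀ (δ : ℝ) (w : ℂ → ℝ≥0∞) (B : ℝ≥0∞), Measurable w →
      (∀ z, w z ≠ 0) → (∀ z, w z ≠ ∞) → B ≠ ∞ →
      IsFiniteMeasure ((diskMeasure ω).withDensity w) →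
      IsFiniteMeasure ((diskMeasure ω).withDensity fun z => w z ^ (1 - q)) →
      (∀ i, (diskMeasure ω).withDensity w (dyadicSquare δ i) *
        (diskMeasure ω).withDensity (fun z => w z ^ (1 - q)) (dyadicSquare δ i) ^ (p - 1) ≤
          B * diskMeasure ω (dyadicSquare δ i) ^ p) →
      ∀ φ g : ℂ → ℝ≥0∞, Measurable φ → Measurable g →
        ∫⁻ z, (∫⁻ ζ, φ ζ * dyadicKernel ω δ z ζ ∂(diskMeasure ω)) * g z
            ∂((diskMeasure ω).withDensity w) ≤
          K * B ^ max 1 (1 / (p - 1)) *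
            (∫⁻ z, φ z ^ p ∂((diskMeasure ω).withDensity w)) ^ (1 / p) *
            (∫⁻ z, g z ^ q ∂((diskMeasure ω).withDensity w)) ^ (1 / q) := by
  have := hω.finite
  have hp0 : 0 < p := hpq.pos
  have hq0 : 0 < q := hpq.symm.pos
  have hp1 : 0 < p - 1 := hpq.sub_one_pos
  have hq1 : 0 < q - 1 := hpq.symm.sub_one_pos
  obtain ⟨k, hk⟩ := hω.exists_radialMass_le_half
  set C := (ENNReal.ofReal (2 ^ p * (p / (p - 1))) * k) ^ (1 / p) *
        (ENNReal.ofReal (2 ^ q * (q / (q - 1))) * k) ^ (1 / q) with hC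
  have hCt : C ≠ ∞ := by
    refine ENNReal.mul_ne_top ?_ ?_ <;>
    exact ENNReal.rpow_ne_top_of_nonneg (by positivity)
      (ENNReal.mul_ne_top ENNReal.ofReal_ne_top (ENNReal.natCast_ne_top k))
  have h2t : ∀ r : ℝ, 0 < r → (2 : ℝ≥0∞) ^ r ≠ ∞ := fun r hr =>
    ENNReal.rpow_ne_top_of_nonneg hr.le ENNReal.ofNat_ne_top
  refine ⟨max (2 ^ (p - 1) * C) (2 ^ (q - 1) * C), ?_, ?_⟩
  · exact (max_lt (ENNReal.mul_ne_top (h2t _ hp1) hCt).lt_top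
      (ENNReal.mul_ne_top (h2t _ hq1) hCt).lt_top).ne
  intro δ w B hw hw0 hwt hBt hτ hσ hB φ g hφ hg
  set μ := diskMeasure ω with hμ
  set τ := μ.withDensity w with hτ_def
  set s : ℂ → ℝ≥0∞ := fun z => w z ^ (1 - q) with hs
  set σ := μ.withDensity s with hσ_def
  have hsm : Measurable s := by fun_prop
  have hs0 : ∀ z, s z ≠ 0 := fun z => by simp [hs, hw0 z, hwt z]
  have hst : ∀ z, s z ≠ ∞ := fun z => by simp [hs, hw0 z, hwt z]
  -- Dividing by the dual weight turns integrals of `φ` against `μ` into integrals against `σ`,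
  -- while the norm of `F` in `L^p(σ)` equals that of `φ` in `L^p(τ)`.
  set F : ℂ → ℝ≥0∞ := fun z => φ z / s z with hF
  have hFm : Measurable F := hφ.div hsm
  have hQm : ∀ i, MeasurableSet (dyadicSquare δ i) := isLaminar_dyadicSquare.measurable
  have hsF : ∀ z, s z * F z = φ z := fun z => ENNReal.mul_div_cancel (hs0 z) (hst z)
  have hFσ : ∀ i, ∫⁻ z in dyadicSquare δ i, F z ∂σ = ∫⁻ z in dyadicSquare δ i, φ z ∂μ := by
    intro i
    rw [hσ_def, setLIntegral_withDensity_eq_setLIntegral_mul _ hsm hFm (hQm i)]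
    simp only [Pi.mul_apply, hsF]
  have hFp : ∫⁻ z, F z ^ p ∂σ = ∫⁻ z, φ z ^ p ∂τ := by
    rw [hσ_def, hτ_def, lintegral_withDensity_eq_lintegral_mul _ hsm (by fun_prop),
      lintegral_withDensity_eq_lintegral_mul _ hw (by fun_prop)]
    refine lintegral_congr fun z => ?_
    simp only [Pi.mul_apply]
    have h1 : w z = s z ^ (1 - p) := (weight_rpow_mul_dual hpq (w z)).symm
    rw [h1, ← hsF z, ENNReal.mul_rpow_of_nonneg _ _ hp0.le, ← mul_assoc,
      ← ENNReal.rpow_add _ _ (hs0 z) (hst z), sub_add_cancel, ENNReal.rpow_one]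
  have hform : ∫⁻ z, (∫⁻ ζ, φ ζ * dyadicKernel ω δ z ζ ∂μ) * g z ∂τ =
      ∑' i, (∫⁻ z in dyadicSquare δ i, F z ∂σ) * (∫⁻ z in dyadicSquare δ i, g z ∂τ) /
        μ (dyadicSquare δ i) := by
    rw [hτ_def, lintegral_withDensity_eq_lintegral_mul _ hw 
      (by exact (measurable_lintegral_dyadicKernel δ hφ).mul hg)]
    have h1 : ∀ z, (w * fun z => (∫⁻ ζ, φ ζ * dyadicKernel ω δ z ζ ∂μ) * g z) z =
        (∫⁻ ζ, φ ζ * dyadicKernel ω δ z ζ ∂μ) * (w z * g z) := fun z => by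
      simp only [Pi.mul_apply]; ring
    rw [lintegral_congr h1, lintegral_dyadicKernel δ hφ (by exact hw.mul hg)]
    refine tsum_congr fun i => ?_
    rw [hFσ, setLIntegral_withDensity_eq_setLIntegral_mul _ hw hg (hQm i)]
    rfl
  have hEm : ∀ i, MeasurableSet (dyadicTop δ k i) := measurableSet_dyadicTop
  have hH : ∀ i, μ (dyadicTop δ k i) ≤ τ (dyadicTop δ k i) ^ (1 / p) *
      σ (dyadicTop δ k i) ^ (1 / q) := fun i =>
    measure_le_weight_mul_dual μ hpq hw hw0 hwt (hEm i)
  have hμi : ∀ i, μ (dyadicSquare δ i) ≠ 0 ∧ μ (dyadicSquare δ i) ≠ ∞ := fun i => by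
    rw [hμ, diskMeasure_dyadicSquare hω.support]
    refine ⟨?_, ENNReal.ofReal_ne_top⟩
    simpa using hω.squareMass_pos (one_div_two_pow_pos _) (one_div_two_pow_le_one _)
  have hcμ := diskMeasure_dyadicSquare_le (δ := δ) hω.support hk
  rw [hform]
  rcases le_total 2 p with h2 | h2
  · have hmax : max 1 (1 / (p - 1)) = 1 :=
      max_eq_left (by rw [div_le_one hp1]; linarith)
    rw [hmax, ENNReal.rpow_one]
    refine (isLaminar_dyadicSquare.bilinear_le hEm (fun i => inter_subset_left)
      tsum_indicator_dyadicTop_le h2 hpq hBt ENNReal.ofNat_ne_top (fun i => (hμi i).1)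
      (fun i => (hμi i).2) hcμ hB hH hFm hg).trans ?_
    rw [hFp, mul_comm _ B, mul_assoc (B * _)]
    gcongr
    exact le_max_left _ _
  -- For `p ≤ 2` the form is symmetric under exchanging `(p, τ)` with `(q, σ)`. The characteristic
  -- of the exchanged pair is `B ^ (q - 1)`, and `q - 1 = 1 / (p - 1)`.
  · have hq2 : 2 ≤ q := by
      have := hpq.mul_eq_add
      nlinarith
    have hmax : max 1 (1 / (p - 1)) = q - 1 := by
      have : 1 / (p - 1) = q - 1 := by
        rw [div_eq_iff hp1.ne']
        nlinarith [hpq.mul_eq_add]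
      rw [this]
      exact max_eq_right (by linarith)
    rw [hmax]
    have hB' : ∀ i, σ (dyadicSquare δ i) * τ (dyadicSquare δ i) ^ (q - 1) ≤
        B ^ (q - 1) * μ (dyadicSquare δ i) ^ q := by
      intro i
      have h3 := ENNReal.rpow_le_rpow (hB i) hq1.le
      rw [ENNReal.mul_rpow_of_nonneg _ _ hq1.le, ENNReal.mul_rpow_of_nonneg _ _ hq1.le,
        ← ENNReal.rpow_mul, ← ENNReal.rpow_mul,
        show (p - 1) * (q - 1) = 1 by nlinarith [hpq.mul_eq_add],
        show p * (q - 1) = q by nlinarith [hpq.mul_eq_add], ENNReal.rpow_one, mul_comm] at h3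
      exact h3
    have h4 := isLaminar_dyadicSquare.bilinear_le (σ := τ) (τ := σ) hEm
      (fun i => inter_subset_left) tsum_indicator_dyadicTop_le hq2 hpq.symm
      (ENNReal.rpow_ne_top_of_nonneg hq1.le hBt) ENNReal.ofNat_ne_top (fun i => (hμi i).1)
      (fun i => (hμi i).2) hcμ hB' (fun i => (hH i).trans_eq (mul_comm _ _)) hg hFm
    have h5 : ∑' i, (∫⁻ z in dyadicSquare δ i, F z ∂σ) * (∫⁻ z in dyadicSquare δ i, g z ∂τ) /
        μ (dyadicSquare δ i) = ∑' i, (∫⁻ z in dyadicSquare δ i, g z ∂τ) *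
          (∫⁻ z in dyadicSquare δ i, F z ∂σ) / μ (dyadicSquare δ i) :=
      tsum_congr fun i => by rw [mul_comm (∫⁻ z in dyadicSquare δ i, F z ∂σ)]
    rw [h5]
    refine h4.trans ?_
    rw [hFp, mul_comm _ (B ^ (q - 1)), mul_assoc (B ^ (q - 1) * _),
      mul_comm ((ENNReal.ofReal (2 ^ q * (q / (q - 1))) * k) ^ (1 / q)), ← hC,
      mul_comm ((∫⁻ z, g z ^ q ∂τ) ^ (1 / q))]
    gcongr
    exact le_max_right _ _

/-- Sharp weighted bound for the maximal Bergman projection, in terms of lower integrals. -/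
lemma exists_lintegral_reprKernel_rpow_le (hω : IsRegular ω) (hγ : 1 ≤ γ)
    (hrep : HasKernelRepresentation ω γ ν) (hpq : p.HolderConjugate q) :
    ∃ K : ℝ≥0, ∀ (w : ℂ → ℝ≥0∞) (B : ℝ≥0∞), Measurable w →
      (∀ z, w z ≠ 0) → (∀ z, w z ≠ ∞) → B ≠ ∞ →
      IsFiniteMeasure ((diskMeasure ω).withDensity w) →
      IsFiniteMeasure ((diskMeasure ω).withDensity fun z => w z ^ (1 - q)) →
      (∀ δ i, (diskMeasure ω).withDensity w (dyadicSquare δ i) *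
        (diskMeasure ω).withDensity (fun z => w z ^ (1 - q)) (dyadicSquare δ i) ^ (p - 1) ≤
          B * diskMeasure ω (dyadicSquare δ i) ^ p) →
      ∀ φ : ℂ → ℝ≥0∞, Measurable φ →
        (∫⁻ z, (∫⁻ ζ, φ ζ * ‖reprKernel γ ν (conj z * ζ)‖ₑ ∂(diskMeasure ω)) ^ p
            ∂((diskMeasure ω).withDensity w)) ^ (1 / p) ≤
          K * B ^ max 1 (1 / (p - 1)) *
            (∫⁻ z, φ z ^ p ∂((diskMeasure ω).withDensity w)) ^ (1 / p) := by
  have := hω.finite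
  have := hrep.1
  obtain ⟨K, hK, H⟩ := hω.exists_dyadicKernel_form_le hpq
  obtain ⟨C, hC⟩ := exists_enorm_reprKernel_le hω hγ hrep
  lift K to ℝ≥0 using hK
  refine ⟨2 * C * K, fun w B hw hw0 hwt hBt hτ hσ hB φ hφ => ?_⟩
  set μ := diskMeasure ω with hμ
  have hkm : Measurable fun q : ℂ × ℂ => ‖reprKernel γ ν (conj q.1 * q.2)‖ₑ := by
    have : Measurable (reprKernel γ ν) := stronglyMeasurable_reprKernel.measurable
    refine (this.comp ?_).enorm
    exact (Complex.continuous_conj.measurable.comp measurable_fst).mul measurable_snd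
  refine lintegral_rpow_le_of_forall_lintegral_mul_le hpq
    (Measurable.lintegral_prod_right' (f := fun q : ℂ × ℂ => φ q.2 * _)
      ((hφ.comp measurable_snd).mul hkm)) fun g hg => ?_
  have hball := ae_mem_ball (ω := ω) hω.support
  have hballτ : ∀ᵐ z ∂(μ.withDensity w), z ∈ ball (0 : ℂ) 1 :=
    (withDensity_absolutelyContinuous _ _).ae_le hball
  have hdk : ∀ δ z, Measurable fun ζ => φ ζ * dyadicKernel ω δ z ζ := fun δ z =>
    hφ.mul ((measurable_dyadicKernel δ).comp measurable_prodMk_left)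
  have hdk2 : ∀ δ, Measurable fun z => (∫⁻ ζ, φ ζ * dyadicKernel ω δ z ζ ∂μ) * g z := fun δ =>
    (measurable_lintegral_dyadicKernel δ hφ).mul hg
  calc ∫⁻ z, (∫⁻ ζ, φ ζ * ‖reprKernel γ ν (conj z * ζ)‖ₑ ∂μ) * g z ∂(μ.withDensity w)
      ≤ ∫⁻ z, C * ((∫⁻ ζ, φ ζ * dyadicKernel ω 0 z ζ ∂μ) * g z +
          (∫⁻ ζ, φ ζ * dyadicKernel ω (1 / 3) z ζ ∂μ) * g z) ∂(μ.withDensity w) := by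
        refine lintegral_mono_ae ?_
        filter_upwards [hballτ] with z hz
        rw [← add_mul, ← mul_assoc, ← lintegral_add_left (hdk 0 z),
          ← lintegral_const_mul _ (by exact (hdk 0 z).add (hdk _ z))]
        gcongr 1
        refine lintegral_mono_ae ?_
        filter_upwards [hball] with ζ hζ
        rw [← mul_add, mul_left_comm]
        gcongr
        exact hC z hz ζ hζ
    _ = C * (∫⁻ z, (∫⁻ ζ, φ ζ * dyadicKernel ω 0 z ζ ∂μ) * g z ∂(μ.withDensity w) +
          ∫⁻ z, (∫⁻ ζ, φ ζ * dyadicKernel ω (1 / 3) z ζ ∂μ) * g z ∂(μ.withDensity w)) := by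
        rw [← lintegral_add_left (hdk2 0),
          lintegral_const_mul _ (by exact (hdk2 0).add (hdk2 _))]
    _ ≤ C * (K * B ^ max 1 (1 / (p - 1)) * (∫⁻ z, φ z ^ p ∂(μ.withDensity w)) ^ (1 / p) *
            (∫⁻ z, g z ^ q ∂(μ.withDensity w)) ^ (1 / q) +
          K * B ^ max 1 (1 / (p - 1)) * (∫⁻ z, φ z ^ p ∂(μ.withDensity w)) ^ (1 / p) *
            (∫⁻ z, g z ^ q ∂(μ.withDensity w)) ^ (1 / q)) := by
        gcongr
        · exact H 0 w B hw hw0 hwt hBt hτ hσ (hB 0) φ g hφ hg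
        · exact H (1 / 3) w B hw hw0 hwt hBt hτ hσ (hB _) φ g hφ hg
    _ = _ := by
        push_cast
        ring

end Weighted

/-! ### From the Bekollé–Bonami condition to strong bounds -/

section Strong

variable {ω ν : Measure ℝ} {γ p : ℝ} {v : ℂ → ℝ}

/-- A weight agrees almost everywhere with a measurable, positive and finite one. -/
lemma exists_measurable_weight (hp : 1 < p) (hv : IsOmegaWeight ω v) :
    ∃ w : ℂ → ℝ≥0∞, Measurable w ∧ (∀ z, w z ≠ 0) ∧ (∀ z, w z ≠ ∞) ∧
      (fun z => ENNReal.ofReal (v z)) =ᵐ[diskMeasure ω] w ∧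
      (fun z => ENNReal.ofReal (v z ^ (-(Real.conjExponent p / p)))) =ᵐ[diskMeasure ω]
        fun z => w z ^ (1 - Real.conjExponent p) := by
  classical
  have hpq := Real.HolderConjugate.conjExponent hp
  set v₁ := hv.2.1.mk v with hv₁
  have hm₁ : Measurable v₁ := hv.2.1.stronglyMeasurable_mk.measurable
  -- The measurable representative is set to `1` on the null set where it fails to be positive, so
  -- that all powers of the weight can be manipulated pointwise.
  set v₂ : ℂ → ℝ := fun z => if 0 < v₁ z then v₁ z else 1 with hv₂
  have hm₂ : Measurable v₂ :=
    Measurable.ite (measurableSet_lt measurable_const hm₁) hm₁ measurable_const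
  have hpos : ∀ z, 0 < v₂ z := fun z => by
    simp only [hv₂]; split_ifs with h
    · exact h
    · exact one_pos
  have hae : v =ᵐ[diskMeasure ω] v₂ := by
    filter_upwards [hv.2.1.ae_eq_mk, hv.1] with z h1 h2
    rw [← hv₁] at h1
    simp only [hv₂, ← h1, if_pos h2]
  refine ⟨fun z => ENNReal.ofReal (v₂ z), hm₂.ennreal_ofReal, fun z => by simpa using hpos z,
    fun z => ENNReal.ofReal_ne_top, ?_, ?_⟩
  · filter_upwards [hae] with z hz using by rw [hz]
  · filter_upwards [hae] with z hz
    have : -(Real.conjExponent p / p) = 1 - Real.conjExponent p := by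
      rw [hpq.symm.div_conj_eq_sub_one]; ring
    rw [hz, ENNReal.ofReal_rpow_of_pos (hpos z), this]

lemma weightedMeasure_eq_withDensity {w : ℂ → ℝ≥0∞}
    (h : (fun z => ENNReal.ofReal (v z)) =ᵐ[diskMeasure ω] w) :
    weightedMeasure ω v = (diskMeasure ω).withDensity w :=
  withDensity_congr_ae h

lemma IsOmegaWeight.isFiniteMeasure (hv : IsOmegaWeight ω v) :
    IsFiniteMeasure (weightedMeasure ω v) := by
  refine isFiniteMeasure_withDensity (ne_of_lt ?_)
  refine lt_of_le_of_lt (lintegral_mono fun z => ?_) hv.2.2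
  rw [← ofReal_norm]
  exact ENNReal.ofReal_le_ofReal (le_abs_self _)

lemma weightedMeasure_absolutelyContinuous :
    weightedMeasure ω v ≪ diskMeasure ω := withDensity_absolutelyContinuous _ _

lemma IsOmegaWeight.absolutelyContinuous (hv : IsOmegaWeight ω v) :
    diskMeasure ω ≪ weightedMeasure ω v := by
  refine withDensity_absolutelyContinuous' hv.2.1.aemeasurable.ennreal_ofReal ?_
  filter_upwards [hv.1] with z hz
  simpa using hz

lemma ratio_mul_rpow_le_iff (hp : 1 < p) {t s m B : ℝ≥0∞} (h0 : m ≠ 0) (ht : m ≠ ∞) :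
    t / m * (s / m) ^ (p - 1) ≤ B ↔ t * s ^ (p - 1) ≤ B * m ^ p := by
  have hp1 : 0 ≤ p - 1 := by linarith
  have h1 : t / m * (s / m) ^ (p - 1) = t * s ^ (p - 1) / m ^ p := by
    rw [ENNReal.div_rpow_of_nonneg _ _ hp1, div_eq_mul_inv, div_eq_mul_inv, div_eq_mul_inv,
      mul_mul_mul_comm, ← ENNReal.mul_inv (Or.inl h0) (Or.inl ht)]
    congr 2
    nth_rw 1 [← ENNReal.rpow_one m]
    rw [← ENNReal.rpow_add _ _ h0 ht]
    ring_nf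
  rw [h1, ENNReal.div_le_iff]
  · simp [h0, ht]
  · exact ENNReal.rpow_ne_top_of_nonneg (by linarith) ht

lemma IsRegular.diskMeasure_carlesonSquare_ne_zero (hω : IsRegular ω) {a h : ℝ} (h0 : 0 < h)
    (h1 : h ≤ 1) : diskMeasure ω (carlesonSquare a h) ≠ 0 := by
  have := hω.finite
  rw [diskMeasure_carlesonSquare_eq_ofReal hω.support h0.le h1]
  simpa using hω.squareMass_pos h0 h1

lemma IsRegular.isFiniteMeasure_diskMeasure (hω : IsRegular ω) : IsFiniteMeasure (diskMeasure ω) :=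
  have := hω.finite
  BergmanProjection.isFiniteMeasure_diskMeasure hω.support

/-- The Bekollé–Bonami condition in terms of the two weighted measures. -/
lemma bekolleBonami_le_iff (hω : IsRegular ω) (hp : 1 < p) {w : ℂ → ℝ≥0∞}
    (hvw : (fun z => ENNReal.ofReal (v z)) =ᵐ[diskMeasure ω] w)
    (hvs : (fun z => ENNReal.ofReal (v z ^ (-(Real.conjExponent p / p)))) =ᵐ[diskMeasure ω]
        fun z => w z ^ (1 - Real.conjExponent p)) {B : ℝ≥0∞} :
    bekolleBonami ω p v ≤ B ↔ ∀ a h : ℝ, 0 < h → h ≤ 1 →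
      (diskMeasure ω).withDensity w (carlesonSquare a h) *
        (diskMeasure ω).withDensity (fun z => w z ^ (1 - Real.conjExponent p))
          (carlesonSquare a h) ^ (p - 1) ≤ B * diskMeasure ω (carlesonSquare a h) ^ p := by
  have := hω.isFiniteMeasure_diskMeasure
  have hpq := Real.HolderConjugate.conjExponent hp
  rw [bekolleBonami]
  simp only [iSup_le_iff]
  refine forall₄_congr fun a h h0 h1 => ?_
  rw [hpq.div_conj_eq_sub_one, ← ratio_mul_rpow_le_iff hp
    (hω.diskMeasure_carlesonSquare_ne_zero h0 h1) (measure_ne_top _ _),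
    withDensity_apply _ (measurableSet_carlesonSquare h1),
    withDensity_apply _ (measurableSet_carlesonSquare h1),
    lintegral_congr_ae (ae_restrict_of_ae hvw), lintegral_congr_ae (ae_restrict_of_ae hvs)]

/-- The kernels are controlled only on the disc, which carries `μ`; there they may be replaced by a
jointly measurable formula. -/
lemma aestronglyMeasurable_integralOp (hω : IsRegular ω) {k : ℂ → ℂ → ℂ} {k' : ℂ × ℂ → ℂ}
    (hk' : StronglyMeasurable k')
    (hk : ∀ z ∈ ball (0 : ℂ) 1, ∀ ζ ∈ ball (0 : ℂ) 1, k z ζ = k' (z, ζ)) {f : ℂ → ℂ}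
    (hf : AEStronglyMeasurable f (diskMeasure ω)) :
    AEStronglyMeasurable (integralOp ω k f) (diskMeasure ω) := by
  have := hω.finite
  have hball := ae_mem_ball (ω := ω) hω.support
  refine ⟨fun z => ∫ ζ, hf.mk f ζ * k' (z, ζ) ∂(diskMeasure ω), ?_, ?_⟩
  · exact StronglyMeasurable.integral_prod_right' (f := fun q : ℂ × ℂ => hf.mk f q.2 * k' q)
      ((hf.stronglyMeasurable_mk.comp_measurable measurable_snd).mul hk')
  · filter_upwards [hball] with z hz
    refine integral_congr_ae ?_
    filter_upwards [hball, hf.ae_eq_mk] with ζ hζ h1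
    rw [hk z hz ζ hζ, h1]

lemma stronglyMeasurable_reprKernel_conj_mul [IsFiniteMeasure ν] :
    StronglyMeasurable fun q : ℂ × ℂ => reprKernel γ ν (conj q.1 * q.2) :=
  stronglyMeasurable_reprKernel.comp_measurable
    ((Complex.continuous_conj.measurable.comp measurable_fst).mul measurable_snd)

lemma conj_mul_norm_lt_one {z ζ : ℂ} (hz : z ∈ ball (0 : ℂ) 1) (hζ : ζ ∈ ball (0 : ℂ) 1) :
    ‖conj z * ζ‖ ≤ ‖z‖ ∧ ‖conj z * ζ‖ < 1 := by
  rw [mem_ball_zero_iff] at hz hζ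
  have : ‖conj z * ζ‖ ≤ ‖z‖ := by
    rw [norm_mul, Complex.norm_conj]
    nlinarith [norm_nonneg z]
  exact ⟨this, this.trans_lt hz⟩

/-- Sharp strong bound for the maximal Bergman projection. -/
theorem exists_hasStrongBound_maxProjKernel (hp : 1 < p) (hω : IsRegular ω) (hγ : 1 ≤ γ)
    (hrep : HasKernelRepresentation ω γ ν) :
    ∃ K : ℝ≥0, ∀ v : ℂ → ℝ, IsOmegaWeight ω v → bekolleBonami ω p v < ∞ →
      HasStrongBound ω p v (maxProjKernel ω)
        (K * (bekolleBonami ω p v).toNNReal ^ max 1 (1 / (p - 1))) := by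
  have := hω.finite
  have := hrep.1
  have hμfin := hω.isFiniteMeasure_diskMeasure
  have hpq := Real.HolderConjugate.conjExponent hp
  have hp0 : 0 < p := by linarith
  obtain ⟨K, hK⟩ := exists_lintegral_reprKernel_rpow_le hω hγ hrep hpq
  refine ⟨K, fun v hv hB f hf => ?_⟩
  obtain ⟨w, hw, hw0, hwt, hvw, hvs⟩ := exists_measurable_weight hp hv
  have hτfin := hv.isFiniteMeasure
  have hfμ : AEStronglyMeasurable f (diskMeasure ω) := hf.1.mono_ac hv.absolutelyContinuous
  have hτμ : weightedMeasure ω v ≪ diskMeasure ω := weightedMeasure_absolutelyContinuous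
  have hball := ae_mem_ball (ω := ω) hω.support
  have hτ := weightedMeasure_eq_withDensity hvw
  rw [hτ] at hf hτfin hτμ ⊢
  set μ := diskMeasure ω with hμ
  set q := Real.conjExponent p with hq
  set B := bekolleBonami ω p v with hB_def
  have hBi := (bekolleBonami_le_iff hω hp hvw hvs).1 le_rfl
  rw [← hB_def, ← hq, ← hμ] at hBi
  have hq0 : 0 < q := hpq.symm.pos
  -- The square with `h = 1` is the whole disc. Infinite dual mass would make the characteristic
  -- infinite, since the disc has positive weighted mass.
  have hσfin : IsFiniteMeasure (μ.withDensity fun z => w z ^ (1 - q)) := by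
    have h1 := hBi 0 1 one_pos le_rfl
    rw [carlesonSquare_one] at h1
    refine ⟨?_⟩
    rw [← measure_congr (Filter.eventuallyEq_univ.2
      ((withDensity_absolutelyContinuous μ _).ae_le hball)),
      show {x | (fun z => z ∈ ball (0 : ℂ) 1) x} = ball 0 1 from rfl, lt_top_iff_ne_top]
    intro htop
    rw [htop, ENNReal.top_rpow_of_pos (by linarith), ENNReal.mul_top, top_le_iff] at h1
    · exact ENNReal.mul_ne_top hB.ne (ENNReal.rpow_ne_top_of_nonneg hp0.le (measure_ne_top _ _)) h1
    · intro h2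
      have h3 : μ (ball 0 1) = 0 := withDensity_absolutelyContinuous' hw.aemeasurable
        (Filter.Eventually.of_forall hw0) h2
      rw [← carlesonSquare_one (a := 0)] at h3
      exact hω.diskMeasure_carlesonSquare_ne_zero one_pos le_rfl h3
  obtain ⟨φ, hφm, hφ⟩ : ∃ φ : ℂ → ℝ≥0∞, Measurable φ ∧ (fun z => ‖f z‖ₑ) =ᵐ[μ] φ :=
    ⟨_, hfμ.enorm.measurable_mk, hfμ.enorm.ae_eq_mk⟩
  have hφτ : (fun z => ‖f z‖ₑ) =ᵐ[μ.withDensity w] φ := hτμ.ae_le hφ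
  have hpt : (ENNReal.ofReal p).toReal = p := ENNReal.toReal_ofReal hp0.le
  have hp0' : ENNReal.ofReal p ≠ 0 := by simpa using hp0
  have hnorm : eLpNorm f (ENNReal.ofReal p) (μ.withDensity w) =
      (∫⁻ z, φ z ^ p ∂(μ.withDensity w)) ^ (1 / p) := by
    rw [eLpNorm_eq_lintegral_rpow_enorm_toReal hp0' ENNReal.ofReal_ne_top, hpt]
    congr 1
    refine lintegral_congr_ae ?_
    filter_upwards [hφτ] with z hz using by rw [hz]
  -- Finite dual mass embeds the weighted space in `L¹(μ)` by Hölder; with the boundedness of the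
  -- kernel for fixed `z`, the defining integrals converge absolutely.
  have hφint : ∫⁻ z, φ z ∂μ < ∞ := by
    have h1 := ENNReal.lintegral_mul_le_Lp_mul_Lq μ hpq (f := fun z => φ z * w z ^ (1 / p))
      (g := fun z => (w z ^ (1 - q)) ^ (1 / q)) (by fun_prop) (by fun_prop)
    have h2 : ∀ z, ((fun z => φ z * w z ^ (1 / p)) * fun z => (w z ^ (1 - q)) ^ (1 / q)) z
        = φ z := fun z => by
      simp only [Pi.mul_apply]
      rw [mul_assoc, ← ENNReal.rpow_mul, ← ENNReal.rpow_add _ _ (hw0 z) (hwt z)]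
      have : 1 / p + (1 - q) * (1 / q) = 0 := by
        have := hpq.inv_add_inv_eq_one
        rw [one_div, one_div, sub_mul, mul_inv_cancel₀ hq0.ne']
        linarith
      rw [this, ENNReal.rpow_zero, mul_one]
    have h3 : ∀ z, (φ z * w z ^ (1 / p)) ^ p = w z * φ z ^ p := fun z => by
      rw [ENNReal.mul_rpow_of_nonneg _ _ hp0.le, ← ENNReal.rpow_mul, one_div_mul_cancel hp0.ne',
        ENNReal.rpow_one, mul_comm]
    have h4 : ∀ z, ((w z ^ (1 - q)) ^ (1 / q)) ^ q = w z ^ (1 - q) := fun z => by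
      rw [← ENNReal.rpow_mul, one_div_mul_cancel hq0.ne', ENNReal.rpow_one]
    have h5 : ∫⁻ z, w z * φ z ^ p ∂μ = ∫⁻ z, φ z ^ p ∂(μ.withDensity w) := by
      rw [lintegral_withDensity_eq_lintegral_mul _ hw (by fun_prop)]; rfl
    have h6 : ∫⁻ z, w z ^ (1 - q) ∂μ < ∞ := by
      have := measure_lt_top (μ.withDensity fun z => w z ^ (1 - q)) univ
      rwa [withDensity_apply _ MeasurableSet.univ, setLIntegral_univ] at this
    simp only [h2, h3, h4, h5, ← hnorm] at h1
    exact h1.trans_lt (ENNReal.mul_lt_top hf.2 (ENNReal.rpow_lt_top_of_nonneg (by positivity) h6.ne))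
  have hkeq : ∀ z ∈ ball (0 : ℂ) 1, ∀ ζ ∈ ball (0 : ℂ) 1, maxProjKernel ω z ζ =
      (fun q : ℂ × ℂ => ((‖reprKernel γ ν (conj q.1 * q.2)‖ : ℝ) : ℂ)) (z, ζ) := by
    intro z hz ζ hζ
    rw [maxProjKernel, bergmanKernel_eq_reprKernel hrep hz hζ]
  have hkm : StronglyMeasurable
      fun q : ℂ × ℂ => ((‖reprKernel γ ν (conj q.1 * q.2)‖ : ℝ) : ℂ) :=
    Complex.continuous_ofReal.comp_stronglyMeasurable stronglyMeasurable_reprKernel_conj_mul.norm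
  have hop : AEStronglyMeasurable (integralOp ω (maxProjKernel ω) f) (μ.withDensity w) :=
    (aestronglyMeasurable_integralOp hω hkm hkeq hfμ).mono_ac hτμ
  have hbound : eLpNorm (integralOp ω (maxProjKernel ω) f) (ENNReal.ofReal p) (μ.withDensity w) ≤
      K * B ^ max 1 (1 / (p - 1)) * eLpNorm f (ENNReal.ofReal p) (μ.withDensity w) := by
    rw [hnorm, eLpNorm_eq_lintegral_rpow_enorm_toReal hp0' ENNReal.ofReal_ne_top, hpt]
    refine le_trans ?_ (hK w B hw hw0 hwt hB.ne hτfin hσfin (fun δ i => ?_) φ hφm)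
    · refine ENNReal.rpow_le_rpow (lintegral_mono_ae ?_) (by positivity)
      filter_upwards [hτμ.ae_le hball] with z hz
      refine ENNReal.rpow_le_rpow ?_ hp0.le
      rw [integralOp]
      refine (enorm_integral_le_lintegral_enorm _).trans (lintegral_mono_ae ?_)
      filter_upwards [hball, hφ] with ζ hζ h1
      rw [enorm_mul, hkeq z hz ζ hζ, h1, ← ofReal_norm (((‖_‖ : ℝ) : ℂ)), Complex.norm_real,
        norm_norm, ofReal_norm]
    · rw [dyadicSquare_eq_carlesonSquare]
      exact hBi _ _ (one_div_two_pow_pos _) (one_div_two_pow_le_one _)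
  have hCcoe : ((K * B.toNNReal ^ max 1 (1 / (p - 1)) : ℝ≥0) : ℝ≥0∞) =
      K * B ^ max 1 (1 / (p - 1)) := by
    rw [ENNReal.coe_mul, ENNReal.coe_rpow_of_nonneg _ (le_max_of_le_left zero_le_one),
      ENNReal.coe_toNNReal hB.ne]
  refine ⟨fun z hz => ?_, ⟨hop, ?_⟩, ?_⟩
  · set D : ℝ := (1 - ‖z‖) ^ (-γ) * (ν.real univ * (1 / (1 - ‖z‖))) with hD
    have hz1 : ‖z‖ < 1 := by simpa using hz
    have hfi : Integrable f μ := ⟨hfμ, by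
      rw [HasFiniteIntegral, lintegral_congr_ae hφ]; exact hφint⟩
    have hae : (fun ζ => f ζ * maxProjKernel ω z ζ) =ᵐ[μ]
        fun ζ => ((‖reprKernel γ ν (conj z * ζ)‖ : ℝ) : ℂ) * f ζ := by
      filter_upwards [hball] with ζ hζ
      rw [hkeq z hz ζ hζ, mul_comm]
    refine (integrable_congr hae).2 (hfi.bdd_mul (c := D) ?_ ?_)
    · exact (hkm.comp_measurable measurable_prodMk_left).aestronglyMeasurable
    · filter_upwards [hball] with ζ hζ
      rw [Complex.norm_real, norm_norm]
      exact norm_reprKernel_le (by linarith) hrep.2.1 (conj_mul_norm_lt_one hz hζ).1 hz1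
  · refine hbound.trans_lt (ENNReal.mul_lt_top (ENNReal.mul_lt_top ENNReal.coe_lt_top ?_) hf.2)
    exact ENNReal.rpow_lt_top_of_nonneg (le_max_of_le_left zero_le_one) hB.ne
  · rwa [hCcoe]

/-- Boundedness of the maximal projection implies that of the projection. -/
theorem StrongBounded.projKernel (hω : IsRegular ω) (hrep : HasKernelRepresentation ω γ ν)
    (hv : IsOmegaWeight ω v) (h : StrongBounded ω p v (maxProjKernel ω)) :
    StrongBounded ω p v (projKernel ω) := by
  have := hω.finite
  have := hrep.1
  obtain ⟨C, hC⟩ := h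
  refine ⟨C, fun f hf => ?_⟩
  have hball := ae_mem_ball (ω := ω) hω.support
  have hfμ : AEStronglyMeasurable f (diskMeasure ω) := hf.1.mono_ac hv.absolutelyContinuous
  have hkeq : ∀ z ∈ ball (0 : ℂ) 1, ∀ ζ ∈ ball (0 : ℂ) 1, BergmanProjection.projKernel ω z ζ =
      (fun q : ℂ × ℂ => conj (reprKernel γ ν (conj q.1 * q.2))) (z, ζ) := by
    intro z hz ζ hζ
    rw [BergmanProjection.projKernel, bergmanKernel_eq_reprKernel hrep hz hζ]
  have hkm : StronglyMeasurable fun q : ℂ × ℂ => conj (reprKernel γ ν (conj q.1 * q.2)) :=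
    Complex.continuous_conj.comp_stronglyMeasurable stronglyMeasurable_reprKernel_conj_mul
  have hop : AEStronglyMeasurable (integralOp ω (BergmanProjection.projKernel ω) f)
      (weightedMeasure ω v) :=
    (aestronglyMeasurable_integralOp hω hkm hkeq hfμ).mono_ac weightedMeasure_absolutelyContinuous
  have hfn : MemLp (fun z => ((‖f z‖ : ℝ) : ℂ)) (ENNReal.ofReal p) (weightedMeasure ω v) :=
    hf.norm.ofReal
  obtain ⟨-, h2, h3⟩ := hC _ hfn
  have hle : ∀ z, ‖integralOp ω (BergmanProjection.projKernel ω) f z‖ ≤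
      ‖integralOp ω (maxProjKernel ω) (fun z => ((‖f z‖ : ℝ) : ℂ)) z‖ := by
    intro z
    have h4 : integralOp ω (maxProjKernel ω) (fun z => ((‖f z‖ : ℝ) : ℂ)) z =
        ((∫ ζ, ‖f ζ‖ * ‖bergmanKernel ω z ζ‖ ∂(diskMeasure ω) : ℝ) : ℂ) := by
      rw [integralOp, ← integral_complex_ofReal]
      refine integral_congr_ae (Filter.Eventually.of_forall fun ζ => ?_)
      simp [maxProjKernel]
    rw [h4, Complex.norm_real, Real.norm_of_nonneg (integral_nonneg fun ζ => by positivity),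
      integralOp]
    refine (norm_integral_le_integral_norm _).trans_eq ?_
    simp [BergmanProjection.projKernel]
  have hle' : eLpNorm (integralOp ω (BergmanProjection.projKernel ω) f) (ENNReal.ofReal p)
      (weightedMeasure ω v) ≤ C * eLpNorm f (ENNReal.ofReal p) (weightedMeasure ω v) := by
    refine (eLpNorm_mono hle).trans (h3.trans_eq ?_)
    congr 1
    exact eLpNorm_congr_norm_ae (Filter.Eventually.of_forall fun z => by simp)
  refine ⟨fun z hz => ?_, ⟨hop, hle'.trans_lt (ENNReal.mul_lt_top ENNReal.coe_lt_top hf.2)⟩, hle'⟩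
  refine ((hC f hf).1 z hz).mono ?_ (Filter.Eventually.of_forall fun ζ => ?_)
  · have hkz : StronglyMeasurable fun ζ => conj (reprKernel γ ν (conj z * ζ)) :=
      Complex.continuous_conj.comp_stronglyMeasurable
        (stronglyMeasurable_reprKernel.comp_measurable (measurable_id.const_mul (conj z)))
    refine hfμ.mul (hkz.aestronglyMeasurable.congr ?_)
    filter_upwards [hball] with ζ hζ using (hkeq z hz ζ hζ).symm
  · simp [BergmanProjection.projKernel, maxProjKernel]

/-- Chebyshev's inequality: strong boundedness implies weak boundedness. -/
theorem StrongBounded.weakBounded (hp : 1 < p) {k : ℂ → ℂ → ℂ} (h : StrongBounded ω p v k) :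
    WeakBounded ω p v k := by
  obtain ⟨C, hC⟩ := h
  have hp0 : 0 < p := by linarith
  refine ⟨C, fun f hf => ?_⟩
  obtain ⟨h1, h2, h3⟩ := hC f hf
  refine ⟨h1, h2.1, le_trans (iSup_le fun t => ?_) h3⟩
  have h4 := pow_mul_meas_ge_le_eLpNorm (weightedMeasure ω v) (p := ENNReal.ofReal p)
    (by simpa using hp0) ENNReal.ofReal_ne_top h2.1 ((t : ℝ≥0∞) ^ p)
  rw [ENNReal.toReal_ofReal hp0.le, ENNReal.mul_rpow_of_nonneg _ _ (by positivity),
    ← ENNReal.rpow_mul, mul_one_div_cancel hp0.ne', ENNReal.rpow_one] at h4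
  refine le_trans ?_ h4
  gcongr
  intro hz
  refine ENNReal.rpow_le_rpow ?_ hp0.le
  rw [← ofReal_norm, ← ENNReal.ofReal_coe_nnreal]
  exact ENNReal.ofReal_le_ofReal (le_of_lt hz)

end Strong

/-! ### Necessity of the Bekollé–Bonami condition -/

section Necessity

variable {ω ν : Measure ℝ} {γ p : ℝ} {v : ℂ → ℝ} {C : ℝ≥0} {S T : Set ℂ} {w₀ : ℂ}

/-- The two sets `S` and `T` are separated, in the sense that `conj z * ζ` stays close to `w₀`,
relative to the distance of `w₀` to `1`, for `ζ` in `S` and `z` in `T`. -/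
def NearProduct (γ : ℝ) (S T : Set ℂ) (w₀ : ℂ) : Prop :=
  ∀ ζ ∈ S, ∀ z ∈ T, ‖conj z * ζ - w₀‖ ≤ 1 / (64 * γ) * ‖1 - w₀‖

lemma norm_one_sub_conj (w : ℂ) : ‖1 - conj w‖ = ‖1 - w‖ := by
  rw [← Complex.norm_conj (1 - w), map_sub, map_one]

lemma NearProduct.symm (h : NearProduct γ S T w₀) : NearProduct γ T S (conj w₀) := by
  intro ζ hζ z hz
  rw [norm_one_sub_conj, ← Complex.norm_conj, map_sub, map_mul, Complex.conj_conj,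
    Complex.conj_conj, mul_comm]
  exact h z hz ζ hζ

/-- The Bergman projection of a nonnegative function does not suffer from cancellation on a set
separated from its support. -/
lemma le_norm_integralOp_indicator (hγ : 1 ≤ γ)
    (hrep : HasKernelRepresentation ω γ ν) (hS : MeasurableSet S) (hSb : S ⊆ ball 0 1)
    (hw₀ : ‖w₀‖ < 1) (hST : NearProduct γ S T w₀) {g : ℂ → ℝ≥0}
    (hg : IntegrableOn (fun ζ => (g ζ : ℝ)) S (diskMeasure ω)) {z : ℂ} (hz : z ∈ T)
    (hzb : z ∈ ball (0 : ℂ) 1) :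
    1 / 2 * ‖reprKernel γ ν w₀‖ * ∫ ζ in S, (g ζ : ℝ) ∂(diskMeasure ω) ≤
      ‖integralOp ω (projKernel ω) (S.indicator fun ζ => ((g ζ : ℝ) : ℂ)) z‖ := by
  have := hrep.1
  have hν := hrep.2.1
  set μ := diskMeasure ω
  set k₀ := reprKernel γ ν w₀ with hk₀
  have hclose : ∀ ζ ∈ S, ‖reprKernel γ ν (conj z * ζ) - k₀‖ ≤ 1 / 2 * ‖k₀‖ := fun ζ hζ =>
    norm_reprKernel_sub_le hγ hν (conj_mul_norm_lt_one hzb (hSb hζ)).2 hw₀ (hST ζ hζ z hz)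
  have h1 : integralOp ω (projKernel ω) (S.indicator fun ζ => ((g ζ : ℝ) : ℂ)) z =
      conj (∫ ζ in S, ((g ζ : ℝ) : ℂ) * reprKernel γ ν (conj z * ζ) ∂μ) := by
    rw [integralOp, ← integral_conj, ← integral_indicator hS]
    refine integral_congr_ae (Filter.Eventually.of_forall fun ζ => ?_)
    by_cases hζ : ζ ∈ S
    · simp only [indicator_of_mem hζ, map_mul, Complex.conj_ofReal, projKernel,
        bergmanKernel_eq_reprKernel hrep hzb (hSb hζ)]
    · simp [indicator_of_notMem hζ]
  have hgc : IntegrableOn (fun ζ => ((g ζ : ℝ) : ℂ)) S μ := hg.ofReal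
  have hd : IntegrableOn (fun ζ => ((g ζ : ℝ) : ℂ) * (reprKernel γ ν (conj z * ζ) - k₀)) S μ := by
    refine Integrable.mul_bdd (c := 1 / 2 * ‖k₀‖) hgc ?_ ?_
    · exact ((stronglyMeasurable_reprKernel.comp_measurable
        (measurable_id.const_mul (conj z))).sub stronglyMeasurable_const).aestronglyMeasurable
    · exact (ae_restrict_iff' hS).2 (Filter.Eventually.of_forall hclose)
  have h2 : ∫ ζ in S, ((g ζ : ℝ) : ℂ) * reprKernel γ ν (conj z * ζ) ∂μ =
      (∫ ζ in S, ((g ζ : ℝ) : ℂ) * k₀ ∂μ) +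
        ∫ ζ in S, ((g ζ : ℝ) : ℂ) * (reprKernel γ ν (conj z * ζ) - k₀) ∂μ := by
    rw [← integral_add (hgc.mul_const _) hd]
    exact integral_congr_ae (Filter.Eventually.of_forall fun ζ => by ring)
  have hX : 0 ≤ ∫ ζ in S, (g ζ : ℝ) ∂μ := integral_nonneg fun ζ => (g ζ).2
  have h3 : ‖∫ ζ in S, ((g ζ : ℝ) : ℂ) * k₀ ∂μ‖ = (∫ ζ in S, (g ζ : ℝ) ∂μ) * ‖k₀‖ := by
    rw [integral_mul_const, integral_complex_ofReal, norm_mul, Complex.norm_real,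
      Real.norm_of_nonneg hX]
  have h4 : ‖∫ ζ in S, ((g ζ : ℝ) : ℂ) * (reprKernel γ ν (conj z * ζ) - k₀) ∂μ‖ ≤
      (∫ ζ in S, (g ζ : ℝ) ∂μ) * (1 / 2 * ‖k₀‖) := by
    rw [← integral_mul_const]
    refine norm_integral_le_of_norm_le (hg.mul_const _) ?_
    refine (ae_restrict_iff' hS).2 (Filter.Eventually.of_forall fun ζ hζ => ?_)
    rw [norm_mul, Complex.norm_real, NNReal.norm_eq]
    exact mul_le_mul_of_nonneg_left (hclose ζ hζ) (g ζ).2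
  rw [h1, Complex.norm_conj, h2]
  have h5 := norm_sub_le_norm_add (∫ ζ in S, ((g ζ : ℝ) : ℂ) * k₀ ∂μ)
    (∫ ζ in S, ((g ζ : ℝ) : ℂ) * (reprKernel γ ν (conj z * ζ) - k₀) ∂μ)
  nlinarith

/-- The weak-type inequality for the operator with kernel `k`, with constant `C`. -/
def HasWeakBound (ω : Measure ℝ) (p : ℝ) (v : ℂ → ℝ) (k : ℂ → ℂ → ℂ) (C : ℝ≥0) : Prop :=
  ∀ f : ℂ → ℂ, MemLp f (ENNReal.ofReal p) (weightedMeasure ω v) →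
    weakLpNorm p (weightedMeasure ω v) (integralOp ω k f)
      ≤ C * eLpNorm f (ENNReal.ofReal p) (weightedMeasure ω v)

/-- Testing the weak-type inequality on bounded functions. -/
lemma HasWeakBound.testing (hC : HasWeakBound ω p v (projKernel ω) C) (hp : 1 < p)
    (hω : IsRegular ω) (hγ : 1 ≤ γ) (hrep : HasKernelRepresentation ω γ ν)
    (hv : IsOmegaWeight ω v) (hS : MeasurableSet S) (hSb : S ⊆ ball 0 1) (hTb : T ⊆ ball 0 1)
    (hw₀ : ‖w₀‖ < 1) (hST : NearProduct γ S T w₀) {g : ℂ → ℝ≥0} (hg : Measurable g) {M : ℝ≥0}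
    (hgM : ∀ z, g z ≤ M) :
    (‖reprKernel γ ν w₀‖ₑ / 4 * ∫⁻ z in S, g z ∂(diskMeasure ω)) ^ p * weightedMeasure ω v T ≤
      C ^ p * ∫⁻ z in S, (g z : ℝ≥0∞) ^ p ∂(weightedMeasure ω v) := by
  have hμfin := hω.isFiniteMeasure_diskMeasure
  have hτfin := hv.isFiniteMeasure
  have hp0 : 0 < p := by linarith
  set μ := diskMeasure ω
  set τ := weightedMeasure ω v
  set f : ℂ → ℂ := S.indicator fun ζ => ((g ζ : ℝ) : ℂ) with hf
  have hgm : Measurable fun ζ => ((g ζ : ℝ) : ℂ) :=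
    Complex.measurable_ofReal.comp (measurable_coe_nnreal_real.comp hg)
  have hfL : MemLp f (ENNReal.ofReal p) τ := by
    refine MemLp.of_bound (hgm.indicator hS).aestronglyMeasurable M
      (Filter.Eventually.of_forall fun ζ => ?_)
    refine (norm_indicator_le_norm_self _ _).trans ?_
    rw [Complex.norm_real, NNReal.norm_eq]
    exact hgM ζ
  have hgint : IntegrableOn (fun ζ => (g ζ : ℝ)) S μ := by
    refine Integrable.of_bound (C := (M : ℝ))
      (measurable_coe_nnreal_real.comp hg).aestronglyMeasurable
      (Filter.Eventually.of_forall fun ζ => ?_)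
    rw [NNReal.norm_eq]
    exact hgM ζ
  have hXeq : ∫⁻ z in S, g z ∂μ = ENNReal.ofReal (∫ z in S, (g z : ℝ) ∂μ) := by
    rw [ofReal_integral_eq_lintegral_ofReal hgint
      (Filter.Eventually.of_forall fun ζ => (g ζ).2)]
    simp
  have hfn : eLpNorm f (ENNReal.ofReal p) τ ^ p = ∫⁻ z in S, (g z : ℝ≥0∞) ^ p ∂τ := by
    rw [eLpNorm_eq_lintegral_rpow_enorm_toReal (by simpa using hp0) ENNReal.ofReal_ne_top,
      ENNReal.toReal_ofReal hp0.le, ← ENNReal.rpow_mul, one_div_mul_cancel hp0.ne',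
      ENNReal.rpow_one, ← lintegral_indicator hS]
    refine lintegral_congr fun ζ => ?_
    by_cases hζ : ζ ∈ S
    · simp [hf, indicator_of_mem hζ, enorm_eq_nnnorm]
    · simp [hf, indicator_of_notMem hζ, hp0]
  set X := ∫ z in S, (g z : ℝ) ∂μ with hX
  have hX0 : 0 ≤ X := integral_nonneg fun ζ => (g ζ).2
  -- The level is half of the lower bound from `le_norm_integralOp_indicator`, so when it is nonzero
  -- all of `T` lies in the strict superlevel set.
  set t : ℝ≥0 := ‖reprKernel γ ν w₀‖₊ / 4 * X.toNNReal with ht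
  have htc : (t : ℝ≥0∞) = ‖reprKernel γ ν w₀‖ₑ / 4 * ∫⁻ z in S, g z ∂μ := by
    rw [hXeq, ht, ENNReal.coe_mul, ENNReal.coe_div (by norm_num)]
    rfl
  rw [← htc]
  rcases eq_or_ne t 0 with h0 | h0
  · rw [h0]; simp [hp0]
  have htr : (t : ℝ) = ‖reprKernel γ ν w₀‖ / 4 * X := by
    rw [ht]; simp [hX0]
  have htpos : 0 < (t : ℝ) := by
    have := pos_iff_ne_zero.2 h0
    exact_mod_cast this
  have hsub : T ⊆ {z | (t : ℝ) < ‖integralOp ω (projKernel ω) f z‖} := by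
    intro z hz
    have := le_norm_integralOp_indicator hγ hrep hS hSb hw₀ hST hgint hz (hTb hz)
    change (t : ℝ) < _
    refine lt_of_lt_of_le ?_ this
    rw [← hX]
    linarith
  have h1 : (t : ℝ≥0∞) * τ T ^ (1 / p) ≤ C * eLpNorm f (ENNReal.ofReal p) τ := by
    refine le_trans ?_ (hC f hfL)
    refine le_trans ?_ (le_iSup _ t)
    gcongr
  have h2 := ENNReal.rpow_le_rpow h1 hp0.le
  rwa [ENNReal.mul_rpow_of_nonneg _ _ hp0.le, ENNReal.mul_rpow_of_nonneg _ _ hp0.le,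
    ← ENNReal.rpow_mul, one_div_mul_cancel hp0.ne', ENNReal.rpow_one, hfn] at h2

/-- Testing on the constant `1` compares the weighted masses of separated sets. -/
lemma HasWeakBound.measure_le (hC : HasWeakBound ω p v (projKernel ω) C) (hp : 1 < p)
    (hω : IsRegular ω) (hγ : 1 ≤ γ) (hrep : HasKernelRepresentation ω γ ν)
    (hv : IsOmegaWeight ω v) (hS : MeasurableSet S) (hSb : S ⊆ ball 0 1) (hTb : T ⊆ ball 0 1)
    (hw₀ : ‖w₀‖ < 1) (hST : NearProduct γ S T w₀) :
    (‖reprKernel γ ν w₀‖ₑ / 4 * diskMeasure ω S) ^ p * weightedMeasure ω v T ≤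
      C ^ p * weightedMeasure ω v S := by
  have := hC.testing hp hω hγ hrep hv hS hSb hTb hw₀ hST (g := fun _ => 1) measurable_const
    (M := 1) (fun _ => le_rfl)
  simpa using this

/-- Testing on the dual weight `s = w ^ (1-q)`. Since `s` is not yet known to be integrable, it is
truncated at height `n`, and monotone convergence recovers it. -/
lemma HasWeakBound.dual_measure_le (hC : HasWeakBound ω p v (projKernel ω) C) (hp : 1 < p)
    (hω : IsRegular ω) (hγ : 1 ≤ γ) (hrep : HasKernelRepresentation ω γ ν)
    (hv : IsOmegaWeight ω v) {w : ℂ → ℝ≥0∞} (hw : Measurable w) (hw0 : ∀ z, w z ≠ 0)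
    (hwt : ∀ z, w z ≠ ∞) (hτ : weightedMeasure ω v = (diskMeasure ω).withDensity w)
    (hS : MeasurableSet S) (hSb : S ⊆ ball 0 1) (hTb : T ⊆ ball 0 1)
    (hw₀ : ‖w₀‖ < 1) (hST : NearProduct γ S T w₀) :
    (‖reprKernel γ ν w₀‖ₑ / 4) ^ p * (diskMeasure ω).withDensity
        (fun z => w z ^ (1 - Real.conjExponent p)) S ^ (p - 1) * weightedMeasure ω v T ≤
      C ^ p := by
  have hpq := Real.HolderConjugate.conjExponent hp
  have hμfin := hω.isFiniteMeasure_diskMeasure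
  set q := Real.conjExponent p
  have hp0 : 0 < p := by linarith
  have hp1 : 0 < p - 1 := by linarith
  set s : ℂ → ℝ≥0∞ := fun z => w z ^ (1 - q) with hs
  have hsm : Measurable s := by fun_prop
  have hs0 : ∀ z, s z ≠ 0 := fun z => by simp [hs, hw0 z, hwt z]
  have hst : ∀ z, s z ≠ ∞ := fun z => by simp [hs, hw0 z, hwt z]
  set k := ‖reprKernel γ ν w₀‖ₑ / 4 with hk
  set g : ℕ → ℂ → ℝ≥0∞ := fun n z => min (s z) n with hg
  have hgm : ∀ n, Measurable (g n) := fun n => hsm.min measurable_const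
  have hgt : ∀ n z, g n z ≠ ∞ := fun n z => (min_le_left _ _).trans_lt (hst z).lt_top |>.ne
  have htr : ∀ n, k ^ p * (∫⁻ z in S, g n z ∂(diskMeasure ω)) ^ (p - 1) * weightedMeasure ω v T ≤
      C ^ p := by
    intro n
    have h1 := hC.testing hp hω hγ hrep hv hS hSb hTb hw₀ hST (g := fun z => (g n z).toNNReal)
      (hgm n).ennreal_toNNReal (M := n)
      (fun z => by
        rw [← ENNReal.coe_le_coe, ENNReal.coe_toNNReal (hgt n z)]
        exact_mod_cast min_le_right _ _)
    simp only [ENNReal.coe_toNNReal (hgt n _)] at h1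
    rw [← hk] at h1
    set A := ∫⁻ z in S, g n z ∂(diskMeasure ω) with hA
    -- From `w s ^ (p-1) = 1` and `g ≤ s` one gets `w g ^ p ≤ g`. The right side of the testing
    -- inequality is then linear in `A`, and one power of `A` cancels because truncation keeps it
    -- finite.
    have h2 : ∫⁻ z in S, g n z ^ p ∂(weightedMeasure ω v) ≤ A := by
      rw [hτ, setLIntegral_withDensity_eq_setLIntegral_mul _ hw (by fun_prop) hS]
      refine lintegral_mono fun z => ?_
      simp only [Pi.mul_apply]
      have h3 : g n z ^ p = g n z * g n z ^ (p - 1) := by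
        conv_rhs => rw [← ENNReal.rpow_one (g n z), ← ENNReal.rpow_mul, one_mul]
        rw [← ENNReal.rpow_add_of_nonneg _ _ zero_le_one hp1.le]
        ring_nf
      have h4 : w z * s z ^ (p - 1) = 1 := by
        have : w z = s z ^ (1 - p) := (weight_rpow_mul_dual hpq (w z)).symm
        rw [this, ← ENNReal.rpow_add _ _ (hs0 z) (hst z)]
        simp
      calc w z * g n z ^ p = g n z * (w z * g n z ^ (p - 1)) := by rw [h3]; ring
        _ ≤ g n z * (w z * s z ^ (p - 1)) := by
            gcongr
            exact min_le_left _ _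
        _ = g n z := by rw [h4, mul_one]
    have hAt : A ≠ ∞ := by
      refine ne_of_lt (lt_of_le_of_lt (lintegral_mono fun z => min_le_right _ _)
        (b := ∫⁻ _ in S, (n : ℝ≥0∞) ∂(diskMeasure ω)) ?_)
      rw [setLIntegral_const]
      exact ENNReal.mul_lt_top (by simp) (measure_lt_top _ _)
    rcases eq_or_ne A 0 with h0 | h0
    · rw [h0, ENNReal.zero_rpow_of_pos hp1]; simp
    have h5 := h1.trans (mul_le_mul_right h2 _)
    have h6 : A ^ p = A ^ (p - 1) * A := by
      conv_rhs => rw [← ENNReal.rpow_one A, ← ENNReal.rpow_mul, one_mul]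
      rw [← ENNReal.rpow_add _ _ h0 hAt]
      ring_nf
    rw [ENNReal.mul_rpow_of_nonneg _ _ hp0.le, h6] at h5
    refine (ENNReal.mul_le_mul_iff_left h0 hAt).1 (le_trans (le_of_eq ?_) h5)
    ring
  have hsup : (diskMeasure ω).withDensity s S = ⨆ n : ℕ, ∫⁻ z in S, g n z ∂(diskMeasure ω) := by
    rw [withDensity_apply _ hS, ← lintegral_iSup hgm]
    · refine lintegral_congr fun z => ?_
      rw [← inf_iSup_eq, ENNReal.iSup_natCast, inf_top_eq]
    · intro m n hmn z
      exact min_le_min_left _ (by exact_mod_cast hmn)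
  have hmap : (⨆ n : ℕ, ∫⁻ z in S, g n z ∂(diskMeasure ω)) ^ (p - 1) =
      ⨆ n : ℕ, (∫⁻ z in S, g n z ∂(diskMeasure ω)) ^ (p - 1) :=
    (ENNReal.orderIsoRpow (p - 1) hp1).map_iSup _
  rw [hsup, hmap, ENNReal.mul_iSup, ENNReal.iSup_mul]
  exact iSup_le htr

end Necessity

/-! ### Separated Carleson squares and the proof of necessity -/

section Geometry

variable {ω ν : Measure ℝ} {γ p : ℝ} {v : ℂ → ℝ} {C : ℝ≥0} {a h : ℝ}

lemma norm_polar_sub_polar_le {r ρ : ℝ} (hr0 : 0 ≤ r) (hr1 : r ≤ 1) (θ φ : ℝ) :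
    ‖(r : ℂ) * Complex.exp (θ * Complex.I) - ρ * Complex.exp (φ * Complex.I)‖ ≤
      |r - ρ| + |θ - φ| := by
  have h1 : (r : ℂ) * Complex.exp (θ * Complex.I) - ρ * Complex.exp (φ * Complex.I) =
      r * (Complex.exp (φ * Complex.I) * (Complex.exp (((θ - φ : ℝ) : ℂ) * Complex.I) - 1)) +
        ((r - ρ : ℝ) : ℂ) * Complex.exp (φ * Complex.I) := by
    rw [mul_sub, ← Complex.exp_add]
    push_cast
    ring_nf
  have h2 : ‖Complex.exp (((θ - φ : ℝ) : ℂ) * Complex.I) - 1‖ ≤ |θ - φ| := by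
    rw [mul_comm]; exact Real.norm_exp_I_mul_ofReal_sub_one_le
  rw [h1]
  refine (norm_add_le _ _).trans ?_
  rw [norm_mul, norm_mul, norm_mul, Complex.norm_exp_ofReal_mul_I, Complex.norm_real,
    Complex.norm_real, Real.norm_of_nonneg hr0, Real.norm_eq_abs, one_mul, mul_one]
  nlinarith [abs_nonneg (θ - φ), norm_nonneg (Complex.exp (((θ - φ : ℝ) : ℂ) * Complex.I) - 1)]

lemma conj_polar_mul_polar (r ρ θ φ : ℝ) :
    conj ((ρ : ℂ) * Complex.exp (φ * Complex.I)) * (r * Complex.exp (θ * Complex.I)) =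
      ((ρ * r : ℝ) : ℂ) * Complex.exp (((θ - φ : ℝ) : ℂ) * Complex.I) := by
  rw [map_mul, ← Complex.exp_conj, map_mul, Complex.conj_ofReal, Complex.conj_ofReal,
    Complex.conj_I, mul_mul_mul_comm, ← Complex.exp_add]
  push_cast
  ring_nf

/-- Two squares of the same size whose distance is a large multiple of their size are
separated. -/
lemma exists_nearProduct_carlesonSquare (hγ : 1 ≤ γ) (h0 : 0 < h) (hh : 512 * γ * h ≤ 1) :
    ∃ w₀ : ℂ, ‖w₀‖ < 1 ∧ ‖1 - w₀‖ ≤ 2049 * γ * h ∧ NearProduct γ (carlesonSquare a h)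
      (carlesonSquare (a + 2 * Real.pi * (256 * γ * h)) h) w₀ := by
  have hγ0 : 0 < γ := by linarith
  have hπ := Real.pi_pos
  have hπ4 := Real.pi_lt_d2
  have h1 : 512 * h ≤ 1 := by nlinarith
  -- The centre `w₀` has angle `-ψ` with `ψ ≤ π`, so `|1 - w₀| ≥ ψ / π = 512γh`. The products `z̄ζ`
  -- stay within `h + 2πh ≤ 8h` of `w₀`, and `8h` is exactly `1 / (64γ)` of `512γh`.
  set ψ : ℝ := 2 * Real.pi * (256 * γ * h) with hψ
  have hψ0 : 0 ≤ ψ := by positivity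
  have hψπ : ψ ≤ Real.pi := by nlinarith
  refine ⟨((1 - h : ℝ) : ℂ) * Complex.exp (((-ψ : ℝ) : ℂ) * Complex.I), ?_, ?_, ?_⟩
  · rw [norm_polar (by linarith)]; linarith
  · refine (norm_one_sub_polar_le (by linarith) (by linarith) _).trans ?_
    rw [abs_neg, abs_of_nonneg hψ0, hψ]
    have : h ≤ γ * h := by nlinarith
    have : Real.pi * (γ * h) ≤ 3.15 * (γ * h) := by gcongr
    nlinarith
  · rintro _ ⟨r, θ, hr, hr1, hθ, hθ', rfl⟩ _ ⟨ρ, φ, hρ, hρ1, hφ, hφ', rfl⟩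
    have h2 := abs_le_pi_mul_norm_one_sub_polar (ρ := 1 - h) (by linarith) (by linarith) (θ := -ψ)
      (by rwa [abs_neg, abs_of_nonneg hψ0])
    rw [abs_neg, abs_of_nonneg hψ0] at h2
    set N := ‖1 - ((1 - h : ℝ) : ℂ) * Complex.exp (((-ψ : ℝ) : ℂ) * Complex.I)‖
    have h3 : 512 * γ * h ≤ N := by
      refine le_of_mul_le_mul_left ?_ hπ
      calc _ = ψ := by rw [hψ]; ring
        _ ≤ _ := h2
    rw [conj_polar_mul_polar]
    refine (norm_polar_sub_polar_le (by nlinarith) (by nlinarith) _ _).trans ?_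
    have h4 : |ρ * r - (1 - h)| ≤ h := by
      rw [abs_le]; constructor <;> nlinarith
    have h5 : |θ - φ - -ψ| ≤ 2 * Real.pi * h := by
      rw [abs_le]; constructor <;> linarith
    calc _ ≤ h + 2 * Real.pi * h := add_le_add h4 h5
      _ ≤ 8 * h := by nlinarith
      _ = 1 / (64 * γ) * (512 * γ * h) := by field_simp; norm_num
      _ ≤ _ := by gcongr

lemma carlesonSquare_mono {h' : ℝ} (hh : h ≤ h') : carlesonSquare a h ⊆ carlesonSquare a h' := by
  rintro z ⟨r, θ, hr, hr1, hθ, hθ', rfl⟩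
  refine ⟨r, θ, by linarith, hr1, hθ, hθ'.trans_le ?_, rfl⟩
  have := Real.pi_pos
  gcongr

/-- A point of the closed disc has a neighbourhood that is separated from a Carleson square. -/
lemma exists_nearProduct_ball (hγ : 1 ≤ γ) (ζ₀ : ℂ) (hζ₀ : ‖ζ₀‖ ≤ 1) :
    ∃ ε > 0, ∃ a h : ℝ, 0 < h ∧ h ≤ 1 ∧ ∃ w₀ : ℂ, ‖w₀‖ < 1 ∧
      NearProduct γ (ball ζ₀ ε ∩ ball 0 1) (carlesonSquare a h) w₀ := by
  have hγ0 : 0 < γ := by linarith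
  have hπ := Real.pi_pos
  have hπ4 := Real.pi_lt_d2
  set ε : ℝ := 1 / (1024 * γ) with hε
  have hε0 : 0 < ε := by positivity
  have hε1 : ε ≤ 1 / 1024 := by
    rw [hε]; exact one_div_le_one_div_of_le (by norm_num) (by linarith)
  -- The square is placed at the boundary point opposite to `ζ₀`. Products are then close to
  -- `-|ζ₀|`, at distance at least `1` from `1`, and the total error `10ε` is below `16ε = 1 /
  -- (64γ)`. The factor `1 - ε` only keeps `w₀` inside the open disc.
  set z₀ : ℂ := Complex.exp (((ζ₀.arg + Real.pi : ℝ) : ℂ) * Complex.I) with hz₀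
  have hz₀n : ‖z₀‖ = 1 := Complex.norm_exp_ofReal_mul_I _
  have hprod : conj z₀ * ζ₀ = -(‖ζ₀‖ : ℂ) := by
    conv_lhs => rw [← Complex.norm_mul_exp_arg_mul_I ζ₀]
    have := conj_polar_mul_polar ‖ζ₀‖ 1 ζ₀.arg (ζ₀.arg + Real.pi)
    rw [Complex.ofReal_one, one_mul, one_mul] at this
    rw [hz₀, this, sub_add_cancel_left, Complex.ofReal_neg, neg_mul, Complex.exp_neg,
      Complex.exp_pi_mul_I]
    norm_num
  refine ⟨ε, hε0, ζ₀.arg + Real.pi, ε, hε0, by linarith, ((1 - ε : ℝ) : ℂ) * (-(‖ζ₀‖ : ℂ)),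
    ?_, ?_⟩
  · rw [norm_mul, norm_neg, Complex.norm_real, Complex.norm_real, norm_norm,
      Real.norm_of_nonneg (by linarith)]
    nlinarith [norm_nonneg ζ₀]
  · rintro ζ ⟨hζ, hζ1⟩ _ ⟨ρ, φ, hρ, hρ1, hφ, hφ', rfl⟩
    have hN : 1 ≤ ‖1 - ((1 - ε : ℝ) : ℂ) * (-(‖ζ₀‖ : ℂ))‖ := by
      have : 1 - ((1 - ε : ℝ) : ℂ) * (-(‖ζ₀‖ : ℂ)) = ((1 + (1 - ε) * ‖ζ₀‖ : ℝ) : ℂ) := by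
        push_cast; ring
      rw [this, Complex.norm_real]
      refine le_trans ?_ (le_abs_self _)
      nlinarith [norm_nonneg ζ₀]
    rw [mem_ball, dist_eq_norm] at hζ
    rw [mem_ball_zero_iff] at hζ1
    set z : ℂ := (ρ : ℂ) * Complex.exp (φ * Complex.I) with hz
    have hzz : ‖z - z₀‖ ≤ 8 * ε := by
      have := norm_polar_sub_polar_le (ρ := 1) (by linarith) hρ1.le φ (ζ₀.arg + Real.pi)
      rw [Complex.ofReal_one, one_mul] at this
      refine this.trans ?_
      rw [abs_of_nonpos (by linarith), abs_of_nonneg (by linarith)]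
      nlinarith
    have h1 : conj z * ζ - ((1 - ε : ℝ) : ℂ) * (-(‖ζ₀‖ : ℂ)) =
        conj (z - z₀) * ζ + conj z₀ * (ζ - ζ₀) + ((ε : ℝ) : ℂ) * (-(‖ζ₀‖ : ℂ)) := by
      rw [← hprod, map_sub]; push_cast; ring
    have h2 : ‖conj z * ζ - ((1 - ε : ℝ) : ℂ) * (-(‖ζ₀‖ : ℂ))‖ ≤ 8 * ε + ε + ε := by
      rw [h1]
      refine norm_add₃_le.trans (add_le_add (add_le_add ?_ ?_) ?_)
      · rw [norm_mul, Complex.norm_conj]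
        nlinarith [norm_nonneg (z - z₀), norm_nonneg ζ]
      · rw [norm_mul, Complex.norm_conj, hz₀n, one_mul]
        exact hζ.le
      · rw [norm_mul, norm_neg, Complex.norm_real, Complex.norm_real, norm_norm,
          Real.norm_of_nonneg hε0.le]
        nlinarith [norm_nonneg ζ₀]
    refine h2.trans ?_
    calc 8 * ε + ε + ε ≤ 16 * ε := by linarith
      _ = 1 / (64 * γ) * 1 := by rw [hε]; field_simp; norm_num
      _ ≤ _ := by gcongr

/-- The dual measure is finite on the disc when the weak-type inequality holds. -/
lemma HasWeakBound.dual_measure_ball_ne_top (hC : HasWeakBound ω p v (projKernel ω) C)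
    (hp : 1 < p) (hω : IsRegular ω) (hγ : 1 ≤ γ) (hrep : HasKernelRepresentation ω γ ν)
    (hv : IsOmegaWeight ω v) {w : ℂ → ℝ≥0∞} (hw : Measurable w) (hw0 : ∀ z, w z ≠ 0)
    (hwt : ∀ z, w z ≠ ∞) (hτ : weightedMeasure ω v = (diskMeasure ω).withDensity w) :
    (diskMeasure ω).withDensity (fun z => w z ^ (1 - Real.conjExponent p)) (ball 0 1) ≠ ∞ := by
  have := hrep.1
  have hp1 : 0 < p - 1 := by linarith
  set σ := (diskMeasure ω).withDensity (fun z => w z ^ (1 - Real.conjExponent p)) with hσ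
  have key : σ (closedBall 0 1 ∩ ball 0 1) ≠ ∞ := by
    -- The testing inequality shows that every point of the closed disc has a neighbourhood of
    -- finite dual mass; by compactness finitely many of them cover.
    refine (isCompact_closedBall (0 : ℂ) 1).induction_on (p := fun s => σ (s ∩ ball 0 1) ≠ ∞)
      (by simp) (fun s t hst ht => ne_top_of_le_ne_top ht (measure_mono (by gcongr))) ?_ ?_
    · intro s t hs ht
      rw [union_inter_distrib_right]
      exact ne_top_of_le_ne_top (ENNReal.add_ne_top.2 ⟨hs, ht⟩) (measure_union_le _ _)
    · intro ζ₀ hζ₀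
      obtain ⟨ε, hε, a, h, h0, h1, w₀, hw₀, hnear⟩ :=
        exists_nearProduct_ball hγ ζ₀ (by simpa using hζ₀)
      refine ⟨ball ζ₀ ε, mem_nhdsWithin_of_mem_nhds (ball_mem_nhds _ hε), fun htop => ?_⟩
      have h2 := hC.dual_measure_le hp hω hγ hrep hv hw hw0 hwt hτ
        (measurableSet_ball.inter measurableSet_ball) inter_subset_right
        (carlesonSquare_subset_ball h1) hw₀ hnear
      have h3 : weightedMeasure ω v (carlesonSquare a h) ≠ 0 := fun h4 =>
        hω.diskMeasure_carlesonSquare_ne_zero h0 h1 (hv.absolutelyContinuous h4)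
      have h4 : (‖reprKernel γ ν w₀‖ₑ / 4) ^ p ≠ 0 := by
        have h5 := diagKernel_le_norm_reprKernel (γ := γ) (by linarith) hrep.2.1 one_pos le_rfl
          one_le_two hw₀ (by
            have := norm_sub_le (1 : ℂ) w₀
            rw [norm_one] at this
            linarith)
        have h6 := diagKernel_pos hω hrep one_pos le_rfl
        have h7 : reprKernel γ ν w₀ ≠ 0 := by
          intro h8
          rw [h8, norm_zero, mul_zero] at h5
          linarith
        simp [h7, ENNReal.rpow_eq_zero_iff, ENNReal.div_eq_top]
      rw [← hσ, htop, ENNReal.top_rpow_of_pos hp1, ENNReal.mul_top h4, ENNReal.top_mul h3,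
        top_le_iff] at h2
      exact ENNReal.rpow_ne_top_of_nonneg (by linarith) ENNReal.coe_ne_top h2
  rwa [inter_eq_right.2 ball_subset_closedBall] at key

/-- On squares separated at the scale of their size, the kernel is at least a multiple of the
inverse of the measure of the squares. -/
lemma exists_le_enorm_reprKernel_mul (hω : IsRegular ω) (hγ : 1 ≤ γ)
    (hrep : HasKernelRepresentation ω γ ν) {A : ℝ} (hA : 1 ≤ A) :
    ∃ c : ℝ≥0∞, c ≠ 0 ∧ ∀ (a h : ℝ) (w₀ : ℂ), 0 < h → h ≤ 1 / 2 → ‖w₀‖ < 1 →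
      ‖1 - w₀‖ ≤ A * h → c ≤ ‖reprKernel γ ν w₀‖ₑ / 4 * diskMeasure ω (carlesonSquare a h) := by
  have := hω.finite
  have := hrep.1
  obtain ⟨c, hc, H⟩ := exists_le_diagKernel_mul_squareMass hω hrep
  have hA0 : 0 < 2 * A ^ (γ + 1) := by positivity
  refine ⟨ENNReal.ofReal (c / (2 * A ^ (γ + 1)) / 4), by simpa using by positivity,
    fun a h w₀ h0 h1 hw₀ hwh => ?_⟩
  have h2 := diagKernel_le_norm_reprKernel (γ := γ) (by linarith) hrep.2.1 h0 (by linarith) hA hw₀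
    hwh
  have h3 := hω.squareMass_pos h0 (by linarith)
  rw [diskMeasure_carlesonSquare_eq_ofReal hω.support h0.le (by linarith), ← ofReal_norm,
    show (4 : ℝ≥0∞) = ENNReal.ofReal 4 by norm_num, ← ENNReal.ofReal_div_of_pos (by norm_num),
    ← ENNReal.ofReal_mul (by positivity)]
  refine ENNReal.ofReal_le_ofReal ?_
  have h4 : c ≤ 2 * A ^ (γ + 1) * ‖reprKernel γ ν w₀‖ * squareMass ω h :=
    (H h h0 h1).trans (by gcongr)
  have h5 : c / (2 * A ^ (γ + 1)) ≤ ‖reprKernel γ ν w₀‖ * squareMass ω h := by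
    rw [div_le_iff₀ hA0]; linarith
  linarith

/-- Weak boundedness of the Bergman projection implies the Bekollé–Bonami condition. -/
theorem WeakBounded.bekolleBonami_lt_top (hp : 1 < p) (hω : IsRegular ω) (hγ : 1 ≤ γ)
    (hrep : HasKernelRepresentation ω γ ν) (hv : IsOmegaWeight ω v)
    (h : WeakBounded ω p v (projKernel ω)) : bekolleBonami ω p v < ∞ := by
  have := hω.finite
  have hμfin := hω.isFiniteMeasure_diskMeasure
  have hτfin := hv.isFiniteMeasure
  have hp0 : 0 < p := by linarith
  have hp1 : 0 < p - 1 := by linarith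
  obtain ⟨C, hC'⟩ := h
  have hC : HasWeakBound ω p v (projKernel ω) C := fun f hf => (hC' f hf).2.2
  obtain ⟨w, hw, hw0, hwt, hvw, hvs⟩ := exists_measurable_weight hp hv
  have hτ := weightedMeasure_eq_withDensity hvw
  have hσ := hC.dual_measure_ball_ne_top hp hω hγ hrep hv hw hw0 hwt hτ
  obtain ⟨c, hc, Hc⟩ := exists_le_enorm_reprKernel_mul hω hγ hrep (A := 2049 * γ) (by linarith)
  -- Below `h₀` a square has a separated partner of the same size, which yields `B₁`. Above it the
  -- plain mass is at least `m`, and the finite total masses of the weight and its dual yield `B₂`.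
  set h₀ : ℝ := 1 / (512 * γ) with hh₀
  have hh₀0 : 0 < h₀ := by positivity
  have hh₀1 : h₀ ≤ 1 / 512 := by
    rw [hh₀]; exact one_div_le_one_div_of_le (by norm_num) (by linarith)
  set m : ℝ≥0∞ := ENNReal.ofReal (squareMass ω h₀) with hm
  have hm0 : m ≠ 0 := by simpa [hm] using hω.squareMass_pos hh₀0 (by linarith)
  set σ := (diskMeasure ω).withDensity (fun z => w z ^ (1 - Real.conjExponent p)) with hσ_def
  set B₁ : ℝ≥0∞ := C ^ p * C ^ p / (c ^ p * c ^ p) with hB₁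
  set B₂ : ℝ≥0∞ := weightedMeasure ω v univ * σ (ball 0 1) ^ (p - 1) / m ^ p with hB₂
  have hcp : c ^ p ≠ 0 := by simp [hc, hp0, hp0.le]
  have hmp : m ^ p ≠ 0 := by simp [hm0, hp0, hp0.le]
  have hCp : (C : ℝ≥0∞) ^ p ≠ ∞ := ENNReal.rpow_ne_top_of_nonneg hp0.le ENNReal.coe_ne_top
  have hB₁t : B₁ ≠ ∞ := ENNReal.div_ne_top (ENNReal.mul_ne_top hCp hCp) (mul_ne_zero hcp hcp)
  have hB₂t : B₂ ≠ ∞ := ENNReal.div_ne_top (ENNReal.mul_ne_top (measure_ne_top _ _)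
    (ENNReal.rpow_ne_top_of_nonneg hp1.le hσ)) hmp
  refine lt_of_le_of_lt (b := max B₁ B₂) ?_ (max_lt hB₁t.lt_top hB₂t.lt_top)
  rw [bekolleBonami_le_iff hω hp hvw hvs, ← hτ, ← hσ_def]
  intro a h h0 h1
  set S := carlesonSquare a h with hS
  have hSm : MeasurableSet S := measurableSet_carlesonSquare h1
  have hSb : S ⊆ ball 0 1 := carlesonSquare_subset_ball h1
  rcases le_total h h₀ with hh | hh
  · have hh' : 512 * γ * h ≤ 1 := by
      calc 512 * γ * h ≤ 512 * γ * h₀ := by gcongr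
        _ = 1 := by rw [hh₀]; field_simp
    obtain ⟨w₀, hw₀, hwn, hnear⟩ := exists_nearProduct_carlesonSquare (a := a) hγ h0 hh'
    rw [← hS] at hnear
    set T := carlesonSquare (a + 2 * Real.pi * (256 * γ * h)) h with hT
    have hTm : MeasurableSet T := measurableSet_carlesonSquare h1
    have hTb : T ⊆ ball 0 1 := carlesonSquare_subset_ball h1
    -- Testing on `T` bounds the weighted mass of `S` by that of `T`; testing the dual weight on `S`
    -- bounds the dual mass of `S` together with the weighted mass of `T`. In the product `T`
    -- disappears.
    have h2 := hC.measure_le hp hω hγ hrep hv hTm hTb hSb (by simpa using hw₀) hnear.symm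
    have h3 := hC.dual_measure_le hp hω hγ hrep hv hw hw0 hwt hτ hSm hSb hTb hw₀ hnear
    rw [← hσ_def] at h3
    have h4 := Hc (a + 2 * Real.pi * (256 * γ * h)) h (conj w₀) h0 (by linarith)
      (by simpa using hw₀) (by rwa [norm_one_sub_conj])
    have h5 := Hc a h w₀ h0 (by linarith) hw₀ hwn
    rw [← hT] at h4
    rw [← hS] at h5
    set M := diskMeasure ω S with hM
    have h6 : c ^ p * weightedMeasure ω v S ≤ C ^ p * weightedMeasure ω v T := by
      refine le_trans ?_ h2
      gcongr
    have h7 : c ^ p * (σ S ^ (p - 1) * weightedMeasure ω v T) ≤ C ^ p * M ^ p := by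
      calc _ ≤ (‖reprKernel γ ν w₀‖ₑ / 4 * M) ^ p * (σ S ^ (p - 1) * weightedMeasure ω v T) := by
            gcongr
        _ = (‖reprKernel γ ν w₀‖ₑ / 4) ^ p * σ S ^ (p - 1) * weightedMeasure ω v T * M ^ p := by
            rw [ENNReal.mul_rpow_of_nonneg _ _ hp0.le]; ring
        _ ≤ _ := by gcongr
    have hct : c ^ p ≠ ∞ := ENNReal.rpow_ne_top_of_nonneg hp0.le
      (ne_top_of_le_ne_top (ENNReal.mul_ne_top (ENNReal.div_ne_top enorm_ne_top (by norm_num))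
        (measure_ne_top _ _)) h5)
    have h8 : weightedMeasure ω v S * σ S ^ (p - 1) * (c ^ p * c ^ p) ≤ C ^ p * C ^ p * M ^ p := by
      calc _ = (c ^ p * weightedMeasure ω v S) * (c ^ p * σ S ^ (p - 1)) := by ring
        _ ≤ (C ^ p * weightedMeasure ω v T) * (c ^ p * σ S ^ (p - 1)) := by gcongr
        _ = C ^ p * (c ^ p * (σ S ^ (p - 1) * weightedMeasure ω v T)) := by ring
        _ ≤ C ^ p * (C ^ p * M ^ p) := by gcongr
        _ = _ := by ring
    have h9 := (ENNReal.le_div_iff_mul_le (Or.inl (mul_ne_zero hcp hcp))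
      (Or.inl (ENNReal.mul_ne_top hct hct))).2 h8
    refine h9.trans ?_
    rw [ENNReal.mul_div_right_comm]
    gcongr
    exact le_max_left _ _
  · have h2 : m ≤ diskMeasure ω S := by
      rw [hm, ← diskMeasure_carlesonSquare_eq_ofReal (a := a) hω.support hh₀0.le (by linarith)]
      exact measure_mono (carlesonSquare_mono hh)
    have hmt : m ^ p ≠ ∞ := ENNReal.rpow_ne_top_of_nonneg hp0.le ENNReal.ofReal_ne_top
    calc weightedMeasure ω v S * σ S ^ (p - 1)
        ≤ weightedMeasure ω v univ * σ (ball 0 1) ^ (p - 1) := by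
          gcongr
          exact subset_univ _
      _ = B₂ * m ^ p := (ENNReal.div_mul_cancel hmp hmt).symm
      _ ≤ _ := by
          gcongr
          exact le_max_right _ _

end Geometry

end BergmanProjection

/-! ### Assembly of the equivalences and of the quantitative bound -/

theorem theorem2 (p : ℝ) (hp : 1 < p) (ω : MeasureTheory.Measure ℝ)
    (hω : BergmanProjection.IsRegular ω)
    (hrep : ∃ γ : ℝ, 1 ≤ γ ∧ ∃ ν : MeasureTheory.Measure ℝ,
      BergmanProjection.HasKernelRepresentation ω γ ν) :
    ∃ C : ℝ≥0, ∀ v : ℂ → ℝ, BergmanProjection.IsOmegaWeight ω v →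
      [BergmanProjection.StrongBounded ω p v (BergmanProjection.maxProjKernel ω),
        BergmanProjection.StrongBounded ω p v (BergmanProjection.projKernel ω),
        BergmanProjection.WeakBounded ω p v (BergmanProjection.projKernel ω),
        BergmanProjection.bekolleBonami ω p v < ∞].TFAE ∧
      (BergmanProjection.bekolleBonami ω p v < ∞ →
        BergmanProjection.strongNorm ω p v (BergmanProjection.maxProjKernel ω)
          ≤ C * BergmanProjection.bekolleBonami ω p v ^ max 1 (1 / (p - 1))) := by
  obtain ⟨γ, hγ, ν, hrep⟩ := hrep
  obtain ⟨K, hK⟩ := BergmanProjection.exists_hasStrongBound_maxProjKernel hp hω hγ hrep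
  refine ⟨K, fun v hv => ⟨?_, fun hB => ?_⟩⟩
  · tfae_have 1 → 2 := fun h => h.projKernel hω hrep hv
    tfae_have 2 → 3 := fun h => h.weakBounded hp
    tfae_have 3 → 4 := fun h => h.bekolleBonami_lt_top hp hω hγ hrep hv
    tfae_have 4 → 1 := fun h => ⟨_, hK v hv h⟩
    tfae_finish
  · refine (iInf₂_le _ (hK v hv hB)).trans_eq ?_
    rw [ENNReal.coe_mul, ENNReal.coe_rpow_of_nonneg _ (le_max_of_le_left zero_le_one),
      ENNReal.coe_toNNReal hB.ne]
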